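/- Let $\Omega\subset\mathbb R^n$ be a bounded open set with Lipschitz boundary, and let $f,f_0\in BV(\Omega)\cap L^2(\Omega)$ be real-valued with $TV(f)>TV(f_0)$, where $TV(u)=|Du|(\Omega)$ is the total variation of the distributional derivative $Du$ of $u$. For $\gamma\in(0,\infty)$ and $g\in\mathbb R^n$ let $|g|_\gamma=\|g\|_2-\frac1{2\gamma}$ if $\|g\|_2\ge 1/\gamma$ and $|g|_\gamma=\frac\gamma2\|g\|_2^2$ otherwise; for a finite $\mathbb R^n$-valued Borel measure on $\Omega$ with Lebesgue decomposition $\nu=h\,\mathcal L^n+\nu^s$ let $|\nu|_\gamma(V)=\int_V|h(x)|_\gamma\,dx+|\nu^s|(V)$, and let $|\nu|_\infty=|\nu|$ be the total variation measure. For $\alpha\in[0,\infty]$, $\mu\in[0,\infty)$ and $\gamma\in(0,\infty]$ let $$u_\alpha\in\operatorname*{arg\,min}_{u\in BV(\Omega)}\Bigl(\tfrac12\|f-u\|_{L^2(\Omega)}^2+\alpha\,|Du|_\gamma(\Omega)+\tfrac\mu2\|\nabla u\|_{L^2(\Omega;\mathbb R^n)}^2\Bigr),$$ where $\|\nabla u\|_{L^2(\Omega;\mathbb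 R^n)}=\infty$ if $u$ has no weak gradient in $L^2(\Omega;\mathbb R^n)$, and $0\cdot\infty=0$. Then there are $\bar\mu,\bar\gamma\in(0,\infty)$ such that for all $\mu\in[0,\bar\mu]$ and $\gamma\in[\bar\gamma,\infty]$ every optimal solution $\alpha\in[0,\infty]$ of the problem $$\min_{\alpha\in[0,\infty]}\tfrac12\|f_0-u_\alpha\|_{L^2(\Omega)}^2$$ satisfies $\alpha>0$. -/

import Mathlib

open MeasureTheory TopologicalSpace Topology
open scoped NNReal ENNReal

noncomputable section

namespace TVDenoising

/-- `Ω` has Lipschitz boundary: near each boundary point `x`, for a suitable unit vector `v`, the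
set `Ω` is the strict epigraph in direction `v` of a Lipschitz function of the coordinates
orthogonal to `v`. (A function of those coordinates is a function `g` on the whole space that is
constant along `v`.) -/
def HasLipschitzBoundary {n : ℕ} (Ω : Opens (EuclideanSpace ℝ (Fin n))) : Prop :=
  ∀ x ∈ frontier (Ω : Set (EuclideanSpace ℝ (Fin n))),
    ∃ (v : EuclideanSpace ℝ (Fin n)) (g : EuclideanSpace ℝ (Fin n) → ℝ) (K : ℝ≥0),
      ‖v‖ = 1 ∧ LipschitzWith K g ∧ (∀ y, ∀ t : ℝ, g (y + t • v) = g y) ∧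
        ∀ᶠ y in 𝓝 x, (y ∈ Ω ↔ g y < inner ℝ v y)

/-- The finite `ℝⁿ`-valued Borel measure `ν`, concentrated on `Ω`, is the distributional derivative
of `u` in `Ω`: `∫_Ω u ∇φ dx = -∫_Ω φ dν` for all `φ ∈ C_c^∞(Ω)`. -/
def IsDerivMeasure {n : ℕ} (Ω : Opens (EuclideanSpace ℝ (Fin n)))
    (u : EuclideanSpace ℝ (Fin n) → ℝ)
    (ν : VectorMeasure (EuclideanSpace ℝ (Fin n)) (EuclideanSpace ℝ (Fin n))) : Prop :=
  ν.variation (Ω : Set (EuclideanSpace ℝ (Fin n)))ᶜ = 0 ∧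
  ν.variation (Ω : Set (EuclideanSpace ℝ (Fin n))) < ∞ ∧
  ∀ φ : TestFunction Ω ℝ ⊤,
    ∫ x in Ω, u x • gradient φ x = - VectorMeasure.integral ν φ (ContinuousLinearMap.lsmul ℝ ℝ)

/-- The space `BV(Ω)`: integrable functions on `Ω` whose distributional derivative is a finite
`ℝⁿ`-valued measure. Functions are represented by functions on `ℝⁿ`, of which only the values
almost everywhere in `Ω` matter. -/
def BV {n : ℕ} (Ω : Opens (EuclideanSpace ℝ (Fin n))) : Set (EuclideanSpace ℝ (Fin n) → ℝ) :=
  {u | IntegrableOn u Ω ∧ ∃ ν, IsDerivMeasure Ω u ν}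

open scoped Classical in
/-- The distributional derivative `Du` of `u ∈ BV(Ω)` (which is unique). -/
def D {n : ℕ} (Ω : Opens (EuclideanSpace ℝ (Fin n))) (u : EuclideanSpace ℝ (Fin n) → ℝ) :
    VectorMeasure (EuclideanSpace ℝ (Fin n)) (EuclideanSpace ℝ (Fin n)) :=
  if h : ∃ ν, IsDerivMeasure Ω u ν then h.choose else 0

/-- The total variation `TV(u) = |Du|(Ω)` of `u ∈ BV(Ω)`. -/
def TV {n : ℕ} (Ω : Opens (EuclideanSpace ℝ (Fin n))) (u : EuclideanSpace ℝ (Fin n) → ℝ) : ℝ≥0∞ :=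
  (D Ω u).variation Ω

/-- The Huber regularisation `|g|_γ` of the Euclidean norm, for `γ ∈ (0, ∞]`. -/
def huberNorm {n : ℕ} (γ : ℝ≥0∞) (g : EuclideanSpace ℝ (Fin n)) : ℝ :=
  if γ = ∞ then ‖g‖
  else if 1 / γ.toReal ≤ ‖g‖ then ‖g‖ - 1 / (2 * γ.toReal)
  else γ.toReal / 2 * ‖g‖ ^ 2

/-- The density (with respect to the Lebesgue measure) of the absolutely continuous part of an
`ℝⁿ`-valued measure, computed componentwise. -/
def acDensity {n : ℕ}
    (ν : VectorMeasure (EuclideanSpace ℝ (Fin n)) (EuclideanSpace ℝ (Fin n)))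
    (x : EuclideanSpace ℝ (Fin n)) : EuclideanSpace ℝ (Fin n) :=
  WithLp.toLp 2 fun i =>
    SignedMeasure.rnDeriv
      (ν.mapRange (EuclideanSpace.proj i : EuclideanSpace ℝ (Fin n) →L[ℝ] ℝ).toLinearMap.toAddMonoidHom
        (EuclideanSpace.proj i : EuclideanSpace ℝ (Fin n) →L[ℝ] ℝ).continuous) volume x

/-- The singular part of an `ℝⁿ`-valued measure with respect to the Lebesgue measure. -/
def singularPart {n : ℕ}
    (ν : VectorMeasure (EuclideanSpace ℝ (Fin n)) (EuclideanSpace ℝ (Fin n))) :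
    VectorMeasure (EuclideanSpace ℝ (Fin n)) (EuclideanSpace ℝ (Fin n)) :=
  ν - volume.withDensityᵥ (acDensity ν)

/-- The Huber regularisation `|ν|_γ` of the total variation measure of `ν = f 𝓛ⁿ + νˢ`, namely
`|ν|_γ(V) = ∫_V |f(x)|_γ dx + |νˢ|(V)` for `γ < ∞`, and `|ν|_∞ = |ν|`. -/
def huberMeasure {n : ℕ} (γ : ℝ≥0∞)
    (ν : VectorMeasure (EuclideanSpace ℝ (Fin n)) (EuclideanSpace ℝ (Fin n))) :
    Measure (EuclideanSpace ℝ (Fin n)) :=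
  if γ = ∞ then ν.variation
  else volume.withDensity (fun x => ENNReal.ofReal (huberNorm γ (acDensity ν x)))
    + (singularPart ν).variation

/-- `g` is the weak gradient of `u` in `Ω`. -/
def IsWeakGradient {n : ℕ} (Ω : Opens (EuclideanSpace ℝ (Fin n)))
    (u : EuclideanSpace ℝ (Fin n) → ℝ)
    (g : EuclideanSpace ℝ (Fin n) → EuclideanSpace ℝ (Fin n)) : Prop :=
  LocallyIntegrableOn u Ω ∧ LocallyIntegrableOn g Ω ∧
  ∀ φ : TestFunction Ω ℝ ⊤, ∫ x in Ω, u x • gradient φ x = - ∫ x in Ω, φ x • g x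

/-- `‖∇u‖²` in `L²(Ω; ℝⁿ)`, with value `∞` when `u` has no weak gradient in `L²`. (The weak
gradient is unique almost everywhere, so the infimum is over at most one value.) -/
def gradNormSq {n : ℕ} (Ω : Opens (EuclideanSpace ℝ (Fin n)))
    (u : EuclideanSpace ℝ (Fin n) → ℝ) : ℝ≥0∞ :=
  ⨅ (g : EuclideanSpace ℝ (Fin n) → EuclideanSpace ℝ (Fin n)) (_ : IsWeakGradient Ω u g),
    eLpNorm g 2 (volume.restrict Ω) ^ 2

/-- `½ ‖f - u‖²` in `L²(Ω)`. -/
def halfSqDist {n : ℕ} (Ω : Opens (EuclideanSpace ℝ (Fin n)))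
    (f u : EuclideanSpace ℝ (Fin n) → ℝ) : ℝ≥0∞ :=
  eLpNorm (fun x => f x - u x) 2 (volume.restrict Ω) ^ 2 / 2

/-- The denoising functional `½‖f - u‖² + α |Du|_γ(Ω) + (μ/2) ‖∇u‖²` on `BV(Ω)`, with values in
`[0, ∞]` and the convention `0 · ∞ = 0` of convex analysis for the last two terms. -/
def denoisingEnergy {n : ℕ} (Ω : Opens (EuclideanSpace ℝ (Fin n)))
    (f : EuclideanSpace ℝ (Fin n) → ℝ) (γ : ℝ≥0∞) (μ : ℝ≥0) (α : ℝ≥0∞)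
    (u : EuclideanSpace ℝ (Fin n) → ℝ) : ℝ≥0∞ :=
  halfSqDist Ω f u + α * huberMeasure γ (D Ω u) Ω + (μ : ℝ≥0∞) / 2 * gradNormSq Ω u

/-- `u` minimises the denoising functional over `BV(Ω)`. -/
def IsDenoised {n : ℕ} (Ω : Opens (EuclideanSpace ℝ (Fin n)))
    (f : EuclideanSpace ℝ (Fin n) → ℝ) (γ : ℝ≥0∞) (μ : ℝ≥0) (α : ℝ≥0∞)
    (u : EuclideanSpace ℝ (Fin n) → ℝ) : Prop :=
  u ∈ BV Ω ∧ ∀ w ∈ BV Ω, denoisingEnergy Ω f γ μ α u ≤ denoisingEnergy Ω f γ μ α w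

/-- `α ∈ [0, ∞]` is an optimal solution of the bilevel problem
`min_α ½‖f₀ - u_α‖²` subject to `u_α ∈ argmin_{u ∈ BV(Ω)} ½‖f - u‖² + α |Du|_γ(Ω) + (μ/2) ‖∇u‖²`. -/
def IsOptimalParameter {n : ℕ} (Ω : Opens (EuclideanSpace ℝ (Fin n)))
    (f f₀ : EuclideanSpace ℝ (Fin n) → ℝ) (γ : ℝ≥0∞) (μ : ℝ≥0) (α : ℝ≥0∞) : Prop :=
  ∃ u, IsDenoised Ω f γ μ α u ∧
    ∀ β w, IsDenoised Ω f γ μ β w → halfSqDist Ω f₀ u ≤ halfSqDist Ω f₀ w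

end TVDenoising

end

/-! Why `α = 0` loses: put `A = ‖f - f₀‖` in `L²`, which is positive since the total variations
differ. At `α = 0` only the gradient penalty acts, so for small `μ` any minimiser `v` is within `ρ`
of `f`, and `‖f₀ - v‖ ≥ A - ρ`. It suffices to find one fixed `β > 0`, independent of `μ` and `γ`,
whose minimiser `u` is strictly closer to `f₀` by a definite amount.

For small `β` and `μ` the minimiser `u` is close to `f`. Lower semicontinuity of the total
variation, in the quantitative form of a single test field `Φ` with `∫ f div Φ > TV(f₀)`, keeps
`TV(u)` above `TV(f₀)` by a fixed gap. The Huber functional differs from the total variation by at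
most `|Ω| / (2γ)`, so for large `γ` a gap survives. The energy is the sum of half a squared distance
and a convex function, hence grows quadratically at `u`. Comparing `u` with a competitor `q` near
`f₀` of almost the same total variation gives `½‖u - q‖² ≤ ½‖f - q‖² + small - βδ`, so `‖u - f₀‖` is
at most about `√(A² - βδ) < A`.

Two facts carry the analysis. The competitors must have finite `‖∇·‖²`, so `f` and `f₀` are
approximated strictly in `BV` by functions smooth up to the boundary
(`exists_smooth_strict_approximation`); here the Lipschitz boundary enters, through mollifiers
shifted so as to sample inside `Ω`. The minimiser at `β` must also exist, as optimality compares
only with parameters that have one (`exists_strong_denoised`). For this the Huber term is written as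
an infimal convolution with an auxiliary field `y`. The energy then becomes half the squared
distance to `(f, 0)` in a Hilbert space of pairs `(u, y)`, plus a supremum of continuous affine
functionals indexed by test fields. Such a problem has a strong minimiser by completeness alone, and
a Riesz theorem for functionals on test fields (`exists_vectorMeasure_representation`) returns it to
`BV`. -/

namespace TVDenoising

/-! ### Integration against vector measures with a density -/

section VectorMeasureIntegral

variable {X E F G : Type*} {mX : MeasurableSpace X}
  [NormedAddCommGroup E] [NormedSpace ℝ E] [NormedAddCommGroup F] [NormedSpace ℝ F]
  [NormedAddCommGroup G] [NormedSpace ℝ G]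
  {ρ : Measure X} {h : X → F} (B : E →L[ℝ] F →L[ℝ] G)

/-- The measure `‖h‖ρ` ignores the set where `h = 0`, and there the bilinear expression vanishes
anyway. -/
lemma bilin_ae_congr (hh : Integrable h ρ) {f g : X → E}
    (hfg : f =ᵐ[ρ.withDensity fun x => ‖h x‖ₑ] g) :
    (fun x => B (f x) (h x)) =ᵐ[ρ] fun x => B (g x) (h x) := by
  have h1 := (ae_withDensity_iff' hh.aestronglyMeasurable.enorm).1 hfg
  filter_upwards [h1] with x hx
  by_cases h0 : h x = 0
  · simp [h0]
  · rw [hx (by simpa using h0)]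

lemma integrable_bilin (hh : Integrable h ρ) {f : X → E}
    (hf : Integrable f (ρ.withDensity fun x => ‖h x‖ₑ)) :
    Integrable (fun x => B (f x) (h x)) ρ := by
  obtain ⟨g, hg, hfg⟩ := hf.aestronglyMeasurable
  have hi : Integrable g (ρ.withDensity fun x => ‖h x‖ₑ) := hf.congr hfg
  refine Integrable.congr ?_ (bilin_ae_congr B hh hfg).symm
  have hi2 : Integrable (fun x => ‖h x‖ₑ.toReal • g x) ρ :=
    (integrable_withDensity_iff_integrable_smul₀' hh.aestronglyMeasurable.enorm
      (by filter_upwards with x using enorm_lt_top)).1 hi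
  refine (hi2.norm.const_mul ‖B‖).mono' ?_ ?_
  · exact B.aestronglyMeasurable_comp₂ hg.aestronglyMeasurable hh.aestronglyMeasurable
  · filter_upwards with x
    refine (B.le_opNorm₂ _ _).trans_eq ?_
    simp [norm_smul]; ring

/-- The variation of the measure is `‖h‖ρ`, and both sides are continuous in `f` for its `L¹` norm,
so indicators suffice. With a polar decomposition this turns every vector measure integral below
into an ordinary one. -/
lemma integral_withDensityᵥ [CompleteSpace F] [CompleteSpace G] (hh : Integrable h ρ) {f : X → E}
    (hf : Integrable f (ρ.withDensity fun x => ‖h x‖ₑ)) :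
    VectorMeasure.integral (ρ.withDensityᵥ h) f B = ∫ x, B (f x) (h x) ∂ρ := by
  have hvar := Measure.variation_withDensityᵥ hh
  refine Integrable.induction (μ := (ρ.withDensity fun x => ‖h x‖ₑ)) (P := fun f =>
    VectorMeasure.integral (ρ.withDensityᵥ h) f B = ∫ x, B (f x) (h x) ∂ρ) ?_ ?_ ?_ ?_ hf
  · intro c s hs hc
    have : IsFiniteMeasure ((ρ.withDensityᵥ h).variation.restrict s) := ⟨by simpa [hvar]⟩
    rw [VectorMeasure.integral_indicator_const c hs, withDensityᵥ_apply hh hs,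
      ← ContinuousLinearMap.integral_comp_comm (B c) hh.integrableOn, ← integral_indicator hs]
    congr with x
    by_cases hx : x ∈ s <;> simp [hx]
  · intro f g _ hf hg h1 h2
    rw [VectorMeasure.integral_add (by rwa [← hvar] at hf) (by rwa [← hvar] at hg), h1, h2,
      ← integral_add (integrable_bilin B hh hf) (integrable_bilin B hh hg)]
    simp
  · apply isClosed_eq
    · rw [← hvar]; exact VectorMeasure.continuous_integral
    · refine (LipschitzWith.of_dist_le_mul (K := ‖B‖₊) fun f g => ?_).continuous
      rw [dist_eq_norm, ← integral_sub (integrable_bilin B hh (L1.integrable_coeFn f))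
        (integrable_bilin B hh (L1.integrable_coeFn g)), dist_eq_norm, L1.norm_eq_integral_norm,
        integral_withDensity_eq_integral_toReal_smul₀ hh.aestronglyMeasurable.enorm
          (by filter_upwards with x using enorm_lt_top), coe_nnnorm, ← integral_const_mul]
      have hfg : Integrable (fun x => ‖h x‖ₑ.toReal • ‖(f - g) x‖) ρ :=
        (integrable_withDensity_iff_integrable_smul₀' hh.aestronglyMeasurable.enorm
          (by filter_upwards with x using enorm_lt_top)).1 (L1.integrable_coeFn (f - g)).norm
      refine norm_integral_le_of_norm_le (hfg.const_mul _) ?_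
      have h2 := bilin_ae_congr B hh (Lp.coeFn_sub f g)
      have h3 := (ae_withDensity_iff' hh.aestronglyMeasurable.enorm).1 (Lp.coeFn_sub f g)
      filter_upwards [h3] with x hx
      by_cases h0 : h x = 0
      · simp [h0]
      · rw [hx (by simpa using h0), ← _root_.sub_apply, ← map_sub]
        refine (B.le_opNorm₂ _ _).trans_eq ?_
        simp; ring
  · intro f g hfg _ h1
    rw [← hvar] at hfg
    rw [VectorMeasure.integral_congr_ae hfg.symm, h1]
    rw [hvar] at hfg
    exact integral_congr_ae (bilin_ae_congr B hh hfg)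

end VectorMeasureIntegral

/-! ### Polar decomposition of vector measures -/

section Polar

variable {X : Type*} {mX : MeasurableSpace X} {n : ℕ}

/-- Radon–Nikodym for signed measures, applied to each coordinate. -/
lemma vectorMeasure_eq_withDensityᵥ_of_ac
    (ν : VectorMeasure X (EuclideanSpace ℝ (Fin n))) (ρ : Measure X) [IsFiniteMeasure ρ]
    (hac : ∀ s, MeasurableSet s → ρ s = 0 → ν s = 0) :
    ∃ h, Integrable h ρ ∧ ν = ρ.withDensityᵥ h := by
  let p (i : Fin n) : EuclideanSpace ℝ (Fin n) →L[ℝ] ℝ := EuclideanSpace.proj i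
  let ν' (i : Fin n) : SignedMeasure X :=
    ν.mapRange (p i).toLinearMap.toAddMonoidHom (p i).continuous
  have hac' (i : Fin n) : ν' i ≪ᵥ ρ.toENNRealVectorMeasure := by
    refine VectorMeasure.AbsolutelyContinuous.mk fun s hs h0 => ?_
    rw [Measure.toENNRealVectorMeasure_apply_measurable hs] at h0
    change p i (ν s) = 0
    rw [hac s hs h0, map_zero]
  have hint (i : Fin n) : Integrable ((ν' i).rnDeriv ρ) ρ := SignedMeasure.integrable_rnDeriv _ _
  let h : X → EuclideanSpace ℝ (Fin n) := fun x => WithLp.toLp 2 fun i => (ν' i).rnDeriv ρ x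
  have hh : Integrable h ρ :=
    ((EuclideanSpace.equiv (Fin n) ℝ).symm.toContinuousLinearMap).integrable_comp
      (Integrable.of_eval (f := fun x i => (ν' i).rnDeriv ρ x) hint)
  refine ⟨h, hh, ?_⟩
  ext s hs i
  rw [withDensityᵥ_apply hh hs]
  have h1 := congrArg (fun τ : SignedMeasure X => τ s)
    (SignedMeasure.withDensityᵥ_rnDeriv_eq (ν' i) ρ (hac' i))
  simp only [withDensityᵥ_apply (hint i) hs] at h1
  have h2 : p i (∫ x in s, h x ∂ρ) = ∫ x in s, p i (h x) ∂ρ :=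
    ((p i).integral_comp_comm hh.integrableOn).symm
  change (p i) (ν s) = p i (∫ x in s, h x ∂ρ)
  rw [h2]
  exact h1.symm

lemma exists_polar (ν : VectorMeasure X (EuclideanSpace ℝ (Fin n)))
    [IsFiniteMeasure ν.variation] :
    ∃ h, Integrable h ν.variation ∧ ν = ν.variation.withDensityᵥ h :=
  vectorMeasure_eq_withDensityᵥ_of_ac ν _ fun s _ h0 => by
    have := ν.enorm_measure_le_variation s
    rw [h0] at this
    simpa using this

end Polar

end TVDenoising


namespace TVDenoising

/-! ### Test fields, divergence, and uniqueness of the distributional derivative -/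

section TestFields

variable {n : ℕ} {Ω : Opens (EuclideanSpace ℝ (Fin n))}

/-- The divergence of a vector field on `ℝⁿ`. -/
noncomputable def divergence (Φ : EuclideanSpace ℝ (Fin n) → EuclideanSpace ℝ (Fin n))
    (x : EuclideanSpace ℝ (Fin n)) : ℝ :=
  ∑ i, fderiv ℝ Φ x (EuclideanSpace.single i 1) i

lemma divergence_add {Φ Ψ : EuclideanSpace ℝ (Fin n) → EuclideanSpace ℝ (Fin n)}
    {x : EuclideanSpace ℝ (Fin n)} (hΦ : DifferentiableAt ℝ Φ x) (hΨ : DifferentiableAt ℝ Ψ x) :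
    divergence (fun y => Φ y + Ψ y) x = divergence Φ x + divergence Ψ x := by
  simp [divergence, fderiv_fun_add hΦ hΨ, Finset.sum_add_distrib]

lemma gradient_apply {φ : EuclideanSpace ℝ (Fin n) → ℝ} {x : EuclideanSpace ℝ (Fin n)}
    (i : Fin n) :
    gradient φ x i = fderiv ℝ φ x (EuclideanSpace.single i 1) := by
  rw [← inner_gradient_left, EuclideanSpace.inner_single_right]
  simp

lemma divergence_smul_fun {ψ : EuclideanSpace ℝ (Fin n) → ℝ}
    {Φ : EuclideanSpace ℝ (Fin n) → EuclideanSpace ℝ (Fin n)}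
    {x : EuclideanSpace ℝ (Fin n)} (hψ : DifferentiableAt ℝ ψ x) (hΦ : DifferentiableAt ℝ Φ x) :
    divergence (fun y => ψ y • Φ y) x = ψ x * divergence Φ x + inner ℝ (gradient ψ x) (Φ x) := by
  simp only [divergence, fderiv_fun_smul hψ hΦ]
  simp [Finset.sum_add_distrib, Finset.mul_sum, gradient_apply, PiLp.inner_apply, mul_comm,
    -inner_gradient_left]

lemma divergence_const_smul (c : ℝ) {Φ : EuclideanSpace ℝ (Fin n) → EuclideanSpace ℝ (Fin n)}
    {x : EuclideanSpace ℝ (Fin n)} (hΦ : DifferentiableAt ℝ Φ x) :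
    divergence (fun y => c • Φ y) x = c * divergence Φ x := by
  simp [divergence, fderiv_fun_const_smul hΦ, Finset.mul_sum]

lemma TestFunction.differentiable {F : Type*} [NormedAddCommGroup F] [NormedSpace ℝ F]
    (Φ : TestFunction Ω F ⊤) : Differentiable ℝ Φ :=
  Φ.contDiff.differentiable (by simp)

lemma continuous_divergence {Φ : EuclideanSpace ℝ (Fin n) → EuclideanSpace ℝ (Fin n)}
    (hΦ : ContDiff ℝ (⊤ : ℕ∞) Φ) : Continuous (divergence Φ) := by
  have h := hΦ.continuous_fderiv (by simp)
  unfold divergence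
  fun_prop

lemma support_divergence_subset (Φ : EuclideanSpace ℝ (Fin n) → EuclideanSpace ℝ (Fin n)) :
    Function.support (divergence Φ) ⊆ tsupport Φ := by
  intro x hx
  by_contra h
  exact hx (by simp [divergence, fderiv_of_notMem_tsupport (𝕜 := ℝ) h])

lemma hasCompactSupport_divergence {Φ : EuclideanSpace ℝ (Fin n) → EuclideanSpace ℝ (Fin n)}
    (hΦ : HasCompactSupport Φ) : HasCompactSupport (divergence Φ) :=
  HasCompactSupport.mono' hΦ (support_divergence_subset Φ)

lemma continuous_gradient {φ : EuclideanSpace ℝ (Fin n) → ℝ} (hφ : ContDiff ℝ (⊤ : ℕ∞) φ) :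
    Continuous (gradient φ) := by
  have h := hφ.continuous_fderiv (by simp)
  unfold gradient
  exact (InnerProductSpace.toDual ℝ _).symm.continuous.comp h

lemma support_gradient_subset (φ : EuclideanSpace ℝ (Fin n) → ℝ) :
    Function.support (gradient φ) ⊆ tsupport φ := by
  intro x hx
  by_contra h
  exact hx (by simp [gradient, fderiv_of_notMem_tsupport (𝕜 := ℝ) h])

lemma hasCompactSupport_gradient {φ : EuclideanSpace ℝ (Fin n) → ℝ}
    (hφ : HasCompactSupport φ) : HasCompactSupport (gradient φ) :=
  HasCompactSupport.mono' hφ (support_gradient_subset φ)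

/-- The `i`-th component of a test field. -/
noncomputable def testComponent (Φ : TestFunction Ω (EuclideanSpace ℝ (Fin n)) ⊤) (i : Fin n) :
    TestFunction Ω ℝ ⊤ where
  toFun x := Φ x i
  contDiff' := (contDiff_euclidean.1 Φ.contDiff) i
  hasCompactSupport' := Φ.hasCompactSupport.comp_left (g := fun v : EuclideanSpace ℝ (Fin n) => v i) (by simp)
  tsupport_subset' :=
    (tsupport_comp_subset (g := fun v : EuclideanSpace ℝ (Fin n) => v i) (by simp) Φ).trans
      Φ.tsupport_subset

/-- The test field `φ eᵢ`. -/
noncomputable def testAxis (φ : TestFunction Ω ℝ ⊤) (i : Fin n) :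
    TestFunction Ω (EuclideanSpace ℝ (Fin n)) ⊤ where
  toFun x := φ x • EuclideanSpace.single i 1
  contDiff' := φ.contDiff.smul contDiff_const
  hasCompactSupport' := φ.hasCompactSupport.smul_right
  tsupport_subset' := (tsupport_smul_subset_left _ _).trans φ.tsupport_subset

lemma TestFunction.integrable_smul {F : Type*} [NormedAddCommGroup F] [NormedSpace ℝ F]
    (φ : TestFunction Ω ℝ ⊤) {ρ : Measure (EuclideanSpace ℝ (Fin n))}
    {h : EuclideanSpace ℝ (Fin n) → F} (hh : Integrable h ρ) :
    Integrable (fun x => φ x • h x) ρ := by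
  obtain ⟨C, hC⟩ := φ.continuous.bounded_above_of_compact_support φ.hasCompactSupport
  exact hh.bdd_smul C φ.continuous.aestronglyMeasurable (.of_forall hC)

lemma integrable_inner_of_bdd {F : Type*} [NormedAddCommGroup F] [InnerProductSpace ℝ F]
    {X : Type*} [MeasurableSpace X] {ρ : Measure X} {Φ h : X → F}
    (hΦ : AEStronglyMeasurable Φ ρ) {C : ℝ} (hC : ∀ x, ‖Φ x‖ ≤ C)
    (hh : Integrable h ρ) : Integrable (fun x => inner ℝ (Φ x) (h x)) ρ := by
  refine (hh.norm.const_mul C).mono' (hΦ.inner hh.aestronglyMeasurable) (.of_forall fun x => ?_)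
  refine (norm_inner_le_norm _ _).trans ?_
  gcongr
  exact hC x

lemma TestFunction.exists_bound {F : Type*} [NormedAddCommGroup F] [NormedSpace ℝ F]
    (Φ : TestFunction Ω F ⊤) : ∃ C, ∀ x, ‖Φ x‖ ≤ C :=
  Φ.continuous.bounded_above_of_compact_support Φ.hasCompactSupport

lemma TestFunction.integrable_inner (Φ : TestFunction Ω (EuclideanSpace ℝ (Fin n)) ⊤)
    {ρ : Measure (EuclideanSpace ℝ (Fin n))}
    {h : EuclideanSpace ℝ (Fin n) → EuclideanSpace ℝ (Fin n)} (hh : Integrable h ρ) :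
    Integrable (fun x => inner ℝ (Φ x) (h x)) ρ := by
  obtain ⟨C, hC⟩ := TestFunction.exists_bound Φ
  exact integrable_inner_of_bdd Φ.continuous.aestronglyMeasurable hC hh

lemma integrable_mul_divergence {u : EuclideanSpace ℝ (Fin n) → ℝ}
    {ρ : Measure (EuclideanSpace ℝ (Fin n))} (hu : Integrable u ρ)
    (Φ : TestFunction Ω (EuclideanSpace ℝ (Fin n)) ⊤) :
    Integrable (fun x => u x * divergence Φ x) ρ := by
  have hc := continuous_divergence Φ.contDiff
  obtain ⟨C, hC⟩ := hc.bounded_above_of_compact_support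
    (hasCompactSupport_divergence Φ.hasCompactSupport)
  exact hu.mul_bdd (c := C) hc.aestronglyMeasurable (.of_forall hC)

lemma integrable_smul_gradient {u : EuclideanSpace ℝ (Fin n) → ℝ}
    {ρ : Measure (EuclideanSpace ℝ (Fin n))} (hu : Integrable u ρ) (φ : TestFunction Ω ℝ ⊤) :
    Integrable (fun x => u x • gradient φ x) ρ := by
  have hc := continuous_gradient φ.contDiff
  obtain ⟨C, hC⟩ := hc.bounded_above_of_compact_support
    (hasCompactSupport_gradient φ.hasCompactSupport)
  exact hu.smul_bdd C hc.aestronglyMeasurable (.of_forall hC)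

lemma integral_apply {X : Type*} [MeasurableSpace X] {ρ : Measure X}
    {h : X → EuclideanSpace ℝ (Fin n)} (hh : Integrable h ρ) (i : Fin n) :
    (∫ x, h x ∂ρ) i = ∫ x, h x i ∂ρ :=
  ((EuclideanSpace.proj i : EuclideanSpace ℝ (Fin n) →L[ℝ] ℝ).integral_comp_comm hh).symm

/-- A weak derivative can be tested with scalar functions or with vector fields. -/
lemma forall_gradient_iff_forall_divergence {u : EuclideanSpace ℝ (Fin n) → ℝ}
    (hu : IntegrableOn u Ω) {ρ : Measure (EuclideanSpace ℝ (Fin n))}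
    {h : EuclideanSpace ℝ (Fin n) → EuclideanSpace ℝ (Fin n)} (hh : Integrable h ρ) :
    (∀ φ : TestFunction Ω ℝ ⊤, ∫ x in Ω, u x • gradient φ x = - ∫ x, φ x • h x ∂ρ) ↔
      ∀ Φ : TestFunction Ω (EuclideanSpace ℝ (Fin n)) ⊤,
        ∫ x in Ω, u x * divergence Φ x = - ∫ x, inner ℝ (Φ x) (h x) ∂ρ := by
  constructor
  · intro H Φ
    have h1 (i : Fin n) := congrArg (fun v : EuclideanSpace ℝ (Fin n) => v i) (H (testComponent Φ i))
    simp only [PiLp.neg_apply] at h1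
    have h2 (i : Fin n) : ∫ x in Ω, u x * fderiv ℝ Φ x (EuclideanSpace.single i 1) i
        = - ∫ x, Φ x i * h x i ∂ρ := by
      have := h1 i
      rw [integral_apply (integrable_smul_gradient hu _),
        integral_apply (TestFunction.integrable_smul _ hh)] at this
      simp only [PiLp.smul_apply, smul_eq_mul] at this
      refine Eq.trans (integral_congr_ae (.of_forall fun x => ?_)) this
      rw [gradient_apply]
      have hd : HasFDerivAt (testComponent Φ i)
          ((EuclideanSpace.proj i : EuclideanSpace ℝ (Fin n) →L[ℝ] ℝ).comp (fderiv ℝ Φ x)) x :=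
        (EuclideanSpace.proj i : EuclideanSpace ℝ (Fin n) →L[ℝ] ℝ).hasFDerivAt.comp x
          (TestFunction.differentiable Φ x).hasFDerivAt
      simp only [hd.fderiv]
      rfl
    have hi1 (i : Fin n) :
        IntegrableOn (fun x => u x * fderiv ℝ Φ x (EuclideanSpace.single i 1) i) Ω := by
      have hc : Continuous fun x => fderiv ℝ Φ x (EuclideanSpace.single i 1) i := by
        have := Φ.contDiff.continuous_fderiv (by simp)
        fun_prop
      obtain ⟨C, hC⟩ := hc.bounded_above_of_compact_support <|
        (Φ.hasCompactSupport.fderiv ℝ).comp_left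
          (g := fun T : EuclideanSpace ℝ (Fin n) →L[ℝ] EuclideanSpace ℝ (Fin n) =>
            T (EuclideanSpace.single i 1) i) (by simp)
      exact hu.mul_bdd (c := C) hc.aestronglyMeasurable (.of_forall hC)
    have hi2 (i : Fin n) : Integrable (fun x => Φ x i * h x i) ρ := by
      exact TestFunction.integrable_smul (testComponent Φ i)
        ((EuclideanSpace.proj i : EuclideanSpace ℝ (Fin n) →L[ℝ] ℝ).integrable_comp hh)
    simp only [divergence, Finset.mul_sum, PiLp.inner_apply]
    rw [integral_finsetSum _ fun i _ => hi1 i, Finset.sum_congr rfl fun i _ => h2 i,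
      Finset.sum_neg_distrib, ← integral_finsetSum _ fun i _ => hi2 i]
    simp [mul_comm]
  · intro H φ
    ext i
    have h1 := H (testAxis φ i)
    rw [integral_apply (integrable_smul_gradient hu _), PiLp.neg_apply,
        integral_apply (TestFunction.integrable_smul _ hh)]
    refine Eq.trans (integral_congr_ae (.of_forall fun x => ?_)) (h1.trans ?_)
    · have := divergence_smul_fun (TestFunction.differentiable φ x)
        (differentiableAt_const (EuclideanSpace.single i (1 : ℝ)))
      have h3 : divergence (testAxis φ i) x = gradient φ x i := by
        refine this.trans ?_
        simp [divergence, gradient_apply (φ := φ)]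
      simp [h3]
    · congr 1
      refine integral_congr_ae (.of_forall fun x => ?_)
      change inner ℝ (φ x • EuclideanSpace.single i (1:ℝ)) (h x) = _
      simp [inner_smul_left, EuclideanSpace.inner_single_left]

lemma TestFunction.integral_withDensityᵥ (Φ : TestFunction Ω (EuclideanSpace ℝ (Fin n)) ⊤)
    {ρ : Measure (EuclideanSpace ℝ (Fin n))}
    {h : EuclideanSpace ℝ (Fin n) → EuclideanSpace ℝ (Fin n)} (hh : Integrable h ρ) :
    VectorMeasure.integral (ρ.withDensityᵥ h) Φ (innerSL ℝ) = ∫ x, inner ℝ (Φ x) (h x) ∂ρ := by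
  have : IsFiniteMeasure (ρ.withDensity fun x => ‖h x‖ₑ) := ⟨by simpa using! hh.2⟩
  obtain ⟨C, hC⟩ := TestFunction.exists_bound Φ
  exact TVDenoising.integral_withDensityᵥ _ hh
    (Integrable.of_bound Φ.continuous.aestronglyMeasurable C (.of_forall hC))

lemma isFiniteMeasure_variation {ν : VectorMeasure (EuclideanSpace ℝ (Fin n))
    (EuclideanSpace ℝ (Fin n))}
    (h1 : ν.variation (Ω : Set (EuclideanSpace ℝ (Fin n)))ᶜ = 0)
    (h2 : ν.variation (Ω : Set (EuclideanSpace ℝ (Fin n))) < ∞) :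
    IsFiniteMeasure ν.variation := by
  refine ⟨?_⟩
  rw [← measure_add_measure_compl (Ω.isOpen.measurableSet), h1, add_zero]
  exact h2

/-- Once `ν` is written as a density times its own variation, both formulations concern ordinary
integrals. Vector fields are the tests in terms of which the total variation is a supremum. -/
lemma isDerivMeasure_iff {u : EuclideanSpace ℝ (Fin n) → ℝ} (hu : IntegrableOn u Ω)
    {ν : VectorMeasure (EuclideanSpace ℝ (Fin n)) (EuclideanSpace ℝ (Fin n))} :
    IsDerivMeasure Ω u ν ↔ ν.variation (Ω : Set (EuclideanSpace ℝ (Fin n)))ᶜ = 0 ∧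
      ν.variation (Ω : Set (EuclideanSpace ℝ (Fin n))) < ∞ ∧
      ∀ Φ : TestFunction Ω (EuclideanSpace ℝ (Fin n)) ⊤,
        ∫ x in Ω, u x * divergence Φ x = - VectorMeasure.integral ν Φ (innerSL ℝ) := by
  unfold IsDerivMeasure
  refine and_congr_right fun h1 => and_congr_right fun h2 => ?_
  have := isFiniteMeasure_variation h1 h2
  obtain ⟨h, hh, hν⟩ := exists_polar ν
  generalize hρ : ν.variation = ρ at *
  subst hν
  simp only [TestFunction.integral_withDensityᵥ _ hh]
  rw [← forall_gradient_iff_forall_divergence hu hh]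
  refine forall_congr' fun φ => ?_
  obtain ⟨C, hC⟩ := TestFunction.exists_bound φ
  have : IsFiniteMeasure (ρ.withDensity fun x => ‖h x‖ₑ) := ⟨by simpa using! hh.2⟩
  rw [TVDenoising.integral_withDensityᵥ _ hh
    (Integrable.of_bound φ.continuous.aestronglyMeasurable C (.of_forall hC))]
  rfl

/-- The polar density of the difference is orthogonal to all test functions, so the fundamental
lemma of the calculus of variations, applied with the variation as base measure, makes it vanish on
`Ω`; outside `Ω` there is no mass. -/
lemma vectorMeasure_ext_of_testFunction
    {ν₁ ν₂ : VectorMeasure (EuclideanSpace ℝ (Fin n)) (EuclideanSpace ℝ (Fin n))}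
    [IsFiniteMeasure ν₁.variation] [IsFiniteMeasure ν₂.variation]
    (h₁ : ν₁.variation (Ω : Set (EuclideanSpace ℝ (Fin n)))ᶜ = 0)
    (h₂ : ν₂.variation (Ω : Set (EuclideanSpace ℝ (Fin n)))ᶜ = 0)
    (H : ∀ φ : TestFunction Ω ℝ ⊤, VectorMeasure.integral ν₁ φ (ContinuousLinearMap.lsmul ℝ ℝ) =
      VectorMeasure.integral ν₂ φ (ContinuousLinearMap.lsmul ℝ ℝ)) : ν₁ = ν₂ := by
  have hle : (ν₁ - ν₂).variation ≤ ν₁.variation + ν₂.variation := VectorMeasure.variation_sub_le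
  have : IsFiniteMeasure (ν₁ - ν₂).variation := isFiniteMeasure_of_le _ hle
  obtain ⟨h, hh, hν⟩ := exists_polar (ν₁ - ν₂)
  have h0 : ∀ φ : TestFunction Ω ℝ ⊤, ∫ x, φ x • h x ∂(ν₁ - ν₂).variation = 0 := by
    intro φ
    obtain ⟨C, hC⟩ := TestFunction.exists_bound φ
    have : IsFiniteMeasure ((ν₁ - ν₂).variation.withDensity fun x => ‖h x‖ₑ) :=
      ⟨by simpa using! hh.2⟩
    have h3 := TVDenoising.integral_withDensityᵥ (ContinuousLinearMap.lsmul ℝ ℝ) hh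
      (Integrable.of_bound φ.continuous.aestronglyMeasurable C (.of_forall hC))
    rw [← hν, VectorMeasure.integral_sub_vectorMeasure
      (Integrable.of_bound φ.continuous.aestronglyMeasurable C (.of_forall hC))
      (Integrable.of_bound φ.continuous.aestronglyMeasurable C (.of_forall hC)), H, sub_self] at h3
    exact h3.symm
  have hae : ∀ᵐ x ∂(ν₁ - ν₂).variation, x ∈ (Ω : Set (EuclideanSpace ℝ (Fin n))) → h x = 0 :=
    Ω.isOpen.ae_eq_zero_of_integral_contDiff_smul_eq_zero
      (hh.locallyIntegrable.locallyIntegrableOn _)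
      fun g h1 h2 h3 => h0 ⟨g, h1, h2, h3⟩
  have hae2 : ∀ᵐ x ∂(ν₁ - ν₂).variation, x ∈ (Ω : Set (EuclideanSpace ℝ (Fin n))) := by
    rw [ae_iff]
    refine le_antisymm ((hle _).trans ?_) zero_le
    simp only [Measure.add_apply]
    change ν₁.variation (Ω : Set (EuclideanSpace ℝ (Fin n)))ᶜ +
      ν₂.variation (Ω : Set (EuclideanSpace ℝ (Fin n)))ᶜ ≤ 0
    rw [h₁, h₂, add_zero]
  have hz : h =ᵐ[(ν₁ - ν₂).variation] 0 := by
    filter_upwards [hae, hae2] with x a b using a b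
  rw [← sub_eq_zero, hν, WithDensityᵥEq.congr_ae hz, withDensityᵥ_zero]

lemma IsDerivMeasure.unique {u : EuclideanSpace ℝ (Fin n) → ℝ}
    {ν₁ ν₂ : VectorMeasure (EuclideanSpace ℝ (Fin n)) (EuclideanSpace ℝ (Fin n))}
    (h₁ : IsDerivMeasure Ω u ν₁) (h₂ : IsDerivMeasure Ω u ν₂) : ν₁ = ν₂ := by
  have := isFiniteMeasure_variation h₁.1 h₁.2.1
  have := isFiniteMeasure_variation h₂.1 h₂.2.1
  refine vectorMeasure_ext_of_testFunction h₁.1 h₂.1 fun φ => ?_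
  rw [← neg_inj, ← h₁.2.2 φ, ← h₂.2.2 φ]

lemma IsDerivMeasure.D_eq {u : EuclideanSpace ℝ (Fin n) → ℝ}
    {ν : VectorMeasure (EuclideanSpace ℝ (Fin n)) (EuclideanSpace ℝ (Fin n))}
    (h : IsDerivMeasure Ω u ν) : D Ω u = ν := by
  have he : ∃ ν, IsDerivMeasure Ω u ν := ⟨ν, h⟩
  rw [D, dif_pos he]
  exact he.choose_spec.unique h

lemma isDerivMeasure_D {u : EuclideanSpace ℝ (Fin n) → ℝ} (hu : u ∈ BV Ω) :
    IsDerivMeasure Ω u (D Ω u) := by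
  obtain ⟨ν, hν⟩ := hu.2
  rwa [hν.D_eq]

/-- The integral of a test field of norm at most one is bounded by the total variation. -/
lemma TestFunction.integral_le_variation (Φ : TestFunction Ω (EuclideanSpace ℝ (Fin n)) ⊤)
    (hΦ : ∀ x, ‖Φ x‖ ≤ 1)
    {ν : VectorMeasure (EuclideanSpace ℝ (Fin n)) (EuclideanSpace ℝ (Fin n))}
    (h1 : ν.variation (Ω : Set (EuclideanSpace ℝ (Fin n)))ᶜ = 0)
    (h2 : ν.variation (Ω : Set (EuclideanSpace ℝ (Fin n))) < ∞) :
    |VectorMeasure.integral ν Φ (innerSL ℝ)| ≤ (ν.variation Ω).toReal := by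
  have := isFiniteMeasure_variation h1 h2
  have hu : ν.variation Set.univ = ν.variation Ω := by
    rw [← measure_add_measure_compl (Ω.isOpen.measurableSet), h1, add_zero]
  rw [← hu, ← Real.norm_eq_abs]
  refine VectorMeasure.norm_integral_le_integral_norm.trans ?_
  have h3 : ‖(innerSL ℝ : EuclideanSpace ℝ (Fin n) →L[ℝ] EuclideanSpace ℝ (Fin n) →L[ℝ] ℝ)‖ ≤ 1 :=
    norm_innerSL_le ℝ
  have h4 : ∫ a, ‖Φ a‖ ∂ν.variation ≤ (ν.variation Set.univ).toReal := by
    obtain ⟨C, hC⟩ := TestFunction.exists_bound Φ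
    refine (integral_mono (μ := ν.variation) (g := fun _ => (1 : ℝ))
      (Integrable.of_bound Φ.continuous.aestronglyMeasurable C (.of_forall hC)).norm
      (integrable_const _) hΦ).trans ?_
    simp [Measure.real]
  have h5 : 0 ≤ ∫ a, ‖Φ a‖ ∂ν.variation := integral_nonneg fun _ => norm_nonneg _
  nlinarith

end TestFields

end TVDenoising


namespace TVDenoising

/-! ### Hahn–Banach extensions -/

section HahnBanach

variable {V T : Type*} [AddCommGroup V] [Module ℝ V] [AddCommGroup T] [Module ℝ T]

lemma exists_linear_extension_prod (p : V × T → ℝ) (hom : ∀ c : ℝ, 0 < c → ∀ x, p (c • x) = c * p x)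
    (add : ∀ x y, p (x + y) ≤ p x + p y) (L : T →ₗ[ℝ] ℝ) (hL : ∀ Φ, L Φ ≤ p (0, Φ)) :
    ∃ Λ : V × T →ₗ[ℝ] ℝ, (∀ Φ, Λ (0, Φ) = L Φ) ∧ ∀ x, Λ x ≤ p x := by
  obtain ⟨Λ, h1, h2⟩ := exists_extension_of_le_sublinear
    ⟨LinearMap.range (LinearMap.inr ℝ V T),
      (L ∘ₗ LinearMap.snd ℝ V T) ∘ₗ (LinearMap.range (LinearMap.inr ℝ V T)).subtype⟩ p hom add
    (by
      rintro ⟨-, Φ, rfl⟩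
      exact hL Φ)
  exact ⟨Λ, fun Φ => h1 ⟨(0, Φ), Φ, rfl⟩, h2⟩

/-- A linear functional on `T` dominated by a sublinear functional along `j : T → V` factors
through a dominated linear functional on `V`. -/
lemma exists_linear_factor (p : V → ℝ) (hom : ∀ c : ℝ, 0 < c → ∀ x, p (c • x) = c * p x)
    (add : ∀ x y, p (x + y) ≤ p x + p y) (j : T →ₗ[ℝ] V) (L : T →ₗ[ℝ] ℝ)
    (hL : ∀ Φ, L Φ ≤ p (j Φ)) :
    ∃ l : V →ₗ[ℝ] ℝ, (∀ Φ, l (j Φ) = L Φ) ∧ ∀ x, l x ≤ p x := by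
  obtain ⟨Λ, h1, h2⟩ := exists_linear_extension_prod (fun x : V × T => p (x.1 + j x.2))
    (fun c hc x => by rw [← hom c hc]; simp)
    (fun x y => by
      refine le_trans (le_of_eq ?_) (add _ _)
      congr 1
      simp only [Prod.fst_add, Prod.snd_add, map_add]
      abel) L (by simpa using hL)
  have h0 : p 0 = 0 := by
    have := hom 2 (by norm_num) 0
    rw [smul_zero] at this
    linarith
  refine ⟨Λ ∘ₗ LinearMap.inl ℝ V T, fun Φ => ?_, fun x => by simpa using h2 (x, 0)⟩
  -- The dominating function takes the value `p 0 = 0` at this pair and at its opposite, which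
  -- forces `Λ` to vanish there. Hence `j` need not be injective.
  have h3 := h2 (j Φ, -Φ)
  have h4 := h2 (-j Φ, Φ)
  simp only [map_neg, add_neg_cancel, neg_add_cancel, h0] at h3 h4
  have e1 : Λ (j Φ, -Φ) = Λ (j Φ, 0) - L Φ := by
    rw [← h1 Φ, ← map_sub]; simp
  have e2 : Λ (-j Φ, Φ) = L Φ - Λ (j Φ, 0) := by
    rw [← h1 Φ, ← map_sub]; simp
  change Λ (j Φ, 0) = L Φ
  linarith

end HahnBanach

/-! ### Suprema of positive parts -/

section SupPos

variable {X : Type*}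

/-- The supremum of the positive part of a function. -/
noncomputable def supPos (f : X → ℝ) : ℝ := ⨆ x, max (f x) 0

lemma supPos_le {f : X → ℝ} {c : ℝ} (hc : 0 ≤ c) (h : ∀ x, f x ≤ c) : supPos f ≤ c :=
  Real.iSup_le (fun x => max_le (h x) hc) hc

lemma supPos_nonneg (f : X → ℝ) : 0 ≤ supPos f := Real.iSup_nonneg fun _ => le_max_right _ _

/-- An unbounded real supremum has the default value `0`, so boundedness is needed here. -/
lemma le_supPos {f : X → ℝ} (hf : ∃ C, ∀ x, f x ≤ C) (x : X) : f x ≤ supPos f := by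
  obtain ⟨C, hC⟩ := hf
  refine (le_max_left _ 0).trans (le_ciSup (f := fun x => max (f x) 0) ⟨max C 0, ?_⟩ x)
  rintro _ ⟨y, rfl⟩
  exact max_le_max_right 0 (hC y)

lemma supPos_const_mul {c : ℝ} (hc : 0 ≤ c) (f : X → ℝ) :
    supPos (fun x => c * f x) = c * supPos f := by
  unfold supPos
  rw [Real.mul_iSup_of_nonneg hc]
  congr with x
  rw [mul_max_of_nonneg _ _ hc, mul_zero]

end SupPos

/-! ### Riesz representation of functionals on test fields -/

section Riesz

open CompactlySupported

variable {n : ℕ} {Ω : Opens (EuclideanSpace ℝ (Fin n))}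

/-- The class in `L²(ρ)` of a test field, as a linear map. -/
noncomputable def testToLp (Ω : Opens (EuclideanSpace ℝ (Fin n)))
    (ρ : Measure (EuclideanSpace ℝ (Fin n))) [IsFiniteMeasureOnCompacts ρ] :
    TestFunction Ω (EuclideanSpace ℝ (Fin n)) ⊤ →ₗ[ℝ] Lp (EuclideanSpace ℝ (Fin n)) 2 ρ where
  toFun Φ := (Φ.continuous.memLp_of_hasCompactSupport Φ.hasCompactSupport).toLp Φ
  map_add' _ _ := rfl
  map_smul' _ _ := rfl

lemma coeFn_testToLp (ρ : Measure (EuclideanSpace ℝ (Fin n))) [IsFiniteMeasureOnCompacts ρ]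
    (Φ : TestFunction Ω (EuclideanSpace ℝ (Fin n)) ⊤) : testToLp Ω ρ Φ =ᵐ[ρ] Φ :=
  MemLp.coeFn_toLp (Φ.continuous.memLp_of_hasCompactSupport Φ.hasCompactSupport)

/-- A functional on test fields which is bounded in `L²` is represented by an `L²` function. -/
lemma exists_L2_representation (ρ : Measure (EuclideanSpace ℝ (Fin n)))
    [IsFiniteMeasureOnCompacts ρ] (L : TestFunction Ω (EuclideanSpace ℝ (Fin n)) ⊤ →ₗ[ℝ] ℝ)
    {C : ℝ} (hC : 0 ≤ C) (hL : ∀ Φ, L Φ ≤ C * ‖testToLp Ω ρ Φ‖) :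
    ∃ g : Lp (EuclideanSpace ℝ (Fin n)) 2 ρ, ‖g‖ ≤ C ∧
      ∀ Φ, L Φ = inner ℝ g (testToLp Ω ρ Φ) := by
  obtain ⟨l, h1, h2⟩ := exists_linear_factor
    (fun z : Lp (EuclideanSpace ℝ (Fin n)) 2 ρ => C * ‖z‖)
    (fun c hc x => by rw [norm_smul, Real.norm_of_nonneg hc.le]; ring)
    (fun x y => by rw [← mul_add]; gcongr; exact norm_add_le x y) (testToLp Ω ρ) L hL
  let l' : StrongDual ℝ (Lp (EuclideanSpace ℝ (Fin n)) 2 ρ) := l.mkContinuous C fun x => by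
    rw [Real.norm_eq_abs, abs_le]
    have := h2 (-x)
    rw [map_neg, norm_neg] at this
    exact ⟨by linarith, h2 x⟩
  refine ⟨(InnerProductSpace.toDual ℝ _).symm l', ?_, fun Φ => ?_⟩
  · rw [LinearIsometryEquiv.norm_map]
    exact LinearMap.mkContinuous_norm_le _ hC _
  · rw [InnerProductSpace.toDual_symm_apply]
    exact (h1 Φ).symm

/-- The norm of a test field as a compactly supported continuous function. -/
noncomputable def testNorm (Φ : TestFunction Ω (EuclideanSpace ℝ (Fin n)) ⊤) :
    C_c(EuclideanSpace ℝ (Fin n), ℝ) where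
  toFun x := ‖Φ x‖
  continuous_toFun := Φ.continuous.norm
  hasCompactSupport' := Φ.hasCompactSupport.norm

lemma exists_le_of_compactlySupported (g : C_c(EuclideanSpace ℝ (Fin n), ℝ)) :
    ∃ C, ∀ x, g x ≤ C := by
  obtain ⟨C, hC⟩ := g.continuous.bounded_above_of_compact_support g.hasCompactSupport
  exact ⟨C, fun x => (le_abs_self _).trans (hC x)⟩

/-- Extend `L` by Hahn–Banach to pairs of a scalar function `g` and a field `Φ`, dominated by `M sup
(g + |Φ|)⁺`. The restriction to scalar functions is a positive functional, hence a measure. It plays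
the role of the total variation, and no density of test fields is needed. -/
lemma exists_dominating_measure (L : TestFunction Ω (EuclideanSpace ℝ (Fin n)) ⊤ →ₗ[ℝ] ℝ)
    {M : ℝ} (hM : 0 ≤ M) (hL : ∀ Φ : TestFunction Ω (EuclideanSpace ℝ (Fin n)) ⊤,
      (∀ x, ‖Φ x‖ ≤ 1) → L Φ ≤ M) :
    ∃ ρ : Measure (EuclideanSpace ℝ (Fin n)), ρ Set.univ ≤ ENNReal.ofReal M ∧
      ∀ Φ, L Φ ≤ ∫ x, ‖Φ x‖ ∂ρ := by
  have hbdd (g : C_c(EuclideanSpace ℝ (Fin n), ℝ))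
      (Φ : TestFunction Ω (EuclideanSpace ℝ (Fin n)) ⊤) : ∃ C, ∀ x, g x + ‖Φ x‖ ≤ C :=
    exists_le_of_compactlySupported (g + testNorm Φ)
  obtain ⟨Λ, h1, h2⟩ := exists_linear_extension_prod
    (fun y : C_c(EuclideanSpace ℝ (Fin n), ℝ) × TestFunction Ω (EuclideanSpace ℝ (Fin n)) ⊤ =>
      M * supPos fun x => y.1 x + ‖y.2 x‖)
    (fun c hc y => by
      rw [mul_left_comm, ← supPos_const_mul hc.le]
      congr 2 with x
      simp [norm_smul, abs_of_pos hc, mul_add])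
    (fun y z => by
      rw [← mul_add]
      gcongr
      refine supPos_le (add_nonneg (supPos_nonneg _) (supPos_nonneg _)) fun x => ?_
      have a := le_supPos (hbdd y.1 y.2) x
      have b := le_supPos (hbdd z.1 z.2) x
      have c := norm_add_le (y.2 x) (z.2 x)
      change (y.1 x + z.1 x) + ‖y.2 x + z.2 x‖ ≤ _
      linarith) L (fun Φ => by
      simp only [CompactlySupportedContinuousMap.coe_zero, Pi.zero_apply, zero_add]
      have hb : ∀ x, ‖Φ x‖ ≤ supPos fun x => ‖Φ x‖ := le_supPos (TestFunction.exists_bound Φ)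
      rcases (supPos_nonneg fun x => ‖Φ x‖).eq_or_lt with h0 | h0
      · have : Φ = 0 := by
          ext1 x
          have := hb x
          rw [← h0] at this
          simpa using this
        rw [← h0]
        simp [this]
      · have := hL ((supPos fun x => ‖Φ x‖)⁻¹ • Φ) fun x => by
          change ‖(supPos fun x => ‖Φ x‖)⁻¹ • Φ x‖ ≤ 1
          rw [norm_smul, norm_inv, Real.norm_of_nonneg h0.le]
          exact inv_mul_le_one_of_le₀ (hb x) h0.le
        rw [map_smul, smul_eq_mul, inv_mul_le_iff₀ h0] at this
        linarith)
  let Λ' : C_c(EuclideanSpace ℝ (Fin n), ℝ) →ₚ[ℝ] ℝ :=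
    PositiveLinearMap.mk₀ (Λ ∘ₗ LinearMap.inl ℝ _ _) fun g hg => by
      have := h2 (-g, 0)
      have h3 : (supPos fun x => (-g) x + ‖(0 : TestFunction Ω (EuclideanSpace ℝ (Fin n)) ⊤) x‖)
          ≤ 0 := supPos_le le_rfl fun x => by
        have hx : 0 ≤ g x := hg x
        simpa using hx
      have h4 : Λ (-g, 0) = - Λ (g, 0) := by rw [← map_neg]; simp
      change 0 ≤ Λ (g, 0)
      dsimp only at this
      nlinarith
  have hΛ' (g : C_c(EuclideanSpace ℝ (Fin n), ℝ)) : Λ' g = Λ (g, 0) := rfl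
  refine ⟨RealRMK.rieszMeasure Λ', ?_, fun Φ => ?_⟩
  -- Total mass: the measure of a compact set is at most `Λ'` of a cutoff with values in `[0, 1]`,
  -- which is at most `M`.
  · rw [isOpen_univ.measure_eq_iSup_isCompact]
    refine iSup₂_le fun K _ => iSup_le fun hK => ?_
    obtain ⟨f, hf1, hf2, -, hf3⟩ := exists_continuousMap_one_of_isCompact_subset_isOpen hK
      isOpen_univ (Set.subset_univ K)
    let f' : C_c(EuclideanSpace ℝ (Fin n), ℝ) := ⟨f, hf2⟩
    refine (RealRMK.rieszMeasure_le_of_eq_one Λ' (f := f') (fun x => (hf3 x).1) hK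
      (fun x hx => hf1 hx)).trans (ENNReal.ofReal_le_ofReal ?_)
    rw [hΛ']
    refine (h2 _).trans ?_
    refine mul_le_of_le_one_right hM (supPos_le zero_le_one fun x => ?_)
    have h1 : f' x ≤ 1 := (hf3 x).2
    simpa using h1
  · have h3 : ∫ x, ‖Φ x‖ ∂(RealRMK.rieszMeasure Λ') = Λ (testNorm Φ, 0) :=
      RealRMK.integral_rieszMeasure Λ' (testNorm Φ)
    rw [h3]
    -- For this pair `g + |Φ|` is identically zero, so domination reads `L Φ ≤ Λ (|Φ|, 0)`.
    have h4 := h2 (-testNorm Φ, Φ)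
    have h5 : (supPos fun x => (-testNorm Φ) x + ‖Φ x‖) ≤ 0 := supPos_le le_rfl fun x => by
      change -‖Φ x‖ + ‖Φ x‖ ≤ 0
      simp
    have h6 : Λ (-testNorm Φ, Φ) = L Φ - Λ (testNorm Φ, 0) := by
      rw [← h1, ← map_sub]; simp
    dsimp only at h4
    nlinarith

/-- Riesz representation: a functional on test fields in `Ω` which is bounded by `M` on the unit
ball of the supremum norm is given by a vector measure of total variation at most `M`. -/
lemma exists_vectorMeasure_representation
    (L : TestFunction Ω (EuclideanSpace ℝ (Fin n)) ⊤ →ₗ[ℝ] ℝ)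
    {M : ℝ} (hM : 0 ≤ M) (hL : ∀ Φ : TestFunction Ω (EuclideanSpace ℝ (Fin n)) ⊤,
      (∀ x, ‖Φ x‖ ≤ 1) → L Φ ≤ M) :
    ∃ ν : VectorMeasure (EuclideanSpace ℝ (Fin n)) (EuclideanSpace ℝ (Fin n)),
      ν.variation (Ω : Set (EuclideanSpace ℝ (Fin n)))ᶜ = 0 ∧
      ν.variation Ω ≤ ENNReal.ofReal M ∧
      ∀ Φ : TestFunction Ω (EuclideanSpace ℝ (Fin n)) ⊤,
        VectorMeasure.integral ν Φ (innerSL ℝ) = L Φ := by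
  obtain ⟨ρ₀, hρ₀, hLρ₀⟩ := exists_dominating_measure L hM hL
  have : IsFiniteMeasure ρ₀ := ⟨hρ₀.trans_lt ENNReal.ofReal_lt_top⟩
  set ρ := ρ₀.restrict (Ω : Set (EuclideanSpace ℝ (Fin n))) with hρ
  have hρM : ρ Set.univ ≤ ENNReal.ofReal M := (Measure.restrict_le_self _).trans hρ₀
  have hLρ (Φ : TestFunction Ω (EuclideanSpace ℝ (Fin n)) ⊤) : L Φ ≤ ∫ x, ‖Φ x‖ ∂ρ := by
    rw [hρ, setIntegral_eq_integral_of_forall_compl_eq_zero]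
    · exact hLρ₀ Φ
    · intro x hx
      rw [norm_eq_zero]
      exact image_eq_zero_of_notMem_tsupport fun h => hx (Φ.tsupport_subset h)
  have hint (z : Lp (EuclideanSpace ℝ (Fin n)) 2 ρ) : Integrable z ρ :=
    (Lp.memLp z).integrable one_le_two
  have hsub (c : ℝ) (x : Lp (EuclideanSpace ℝ (Fin n)) 2 ρ) :
      ∫ y, ‖(c • x : Lp (EuclideanSpace ℝ (Fin n)) 2 ρ) y‖ ∂ρ = |c| * ∫ y, ‖x y‖ ∂ρ := by
    rw [← integral_const_mul]
    refine integral_congr_ae ?_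
    filter_upwards [Lp.coeFn_smul c x] with y hy
    simp [hy, norm_smul]
  -- The extension lives on the Hilbert space `L²(ρ)` but is dominated by the `L¹` norm. The first
  -- provides a density `σ` without `L¹`–`L∞` duality, the second controls its total mass.
  obtain ⟨l, hl1, hl2⟩ := exists_linear_factor
    (fun z : Lp (EuclideanSpace ℝ (Fin n)) 2 ρ => ∫ x, ‖z x‖ ∂ρ)
    (fun c hc x => by rw [hsub, abs_of_pos hc])
    (fun x y => by
      rw [← integral_add (hint x).norm (hint y).norm]
      refine integral_mono_ae (hint _).norm ((hint x).norm.add (hint y).norm) ?_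
      filter_upwards [Lp.coeFn_add x y] with t ht
      rw [ht]
      exact norm_add_le _ _) (testToLp Ω ρ) L fun Φ => by
        refine (hLρ Φ).trans_eq (integral_congr_ae ?_)
        filter_upwards [coeFn_testToLp ρ Φ] with x hx
        rw [hx]
  have hL1 (z : Lp (EuclideanSpace ℝ (Fin n)) 2 ρ) :
      ∫ x, ‖z x‖ ∂ρ ≤ ‖(indicatorConstLp 2 MeasurableSet.univ (measure_ne_top ρ _) (1 : ℝ))‖ * ‖z‖ := by
    have hz : MemLp (fun x => ‖z x‖) 2 ρ := (Lp.memLp z).norm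
    have h1 := real_inner_le_norm
      (indicatorConstLp 2 MeasurableSet.univ (measure_ne_top ρ _) (1 : ℝ)) (hz.toLp _)
    rw [L2.inner_indicatorConstLp_one, Measure.restrict_univ, Lp.norm_toLp, eLpNorm_norm,
      ← Lp.norm_def] at h1
    refine le_trans (le_of_eq (integral_congr_ae ?_)) h1
    exact hz.coeFn_toLp.symm
  let l' : StrongDual ℝ (Lp (EuclideanSpace ℝ (Fin n)) 2 ρ) := l.mkContinuous _ fun x => by
    rw [Real.norm_eq_abs, abs_le]
    have h1 := hl2 (-x)
    have h2 := hsub (-1) x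
    rw [neg_one_smul] at h2
    rw [map_neg, h2, abs_neg, abs_one, one_mul] at h1
    exact ⟨by linarith [hL1 x], (hl2 x).trans (hL1 x)⟩
  set σ := (InnerProductSpace.toDual ℝ _).symm l' with hσdef
  have hσ (z : Lp (EuclideanSpace ℝ (Fin n)) 2 ρ) : inner ℝ σ z = l z :=
    InnerProductSpace.toDual_symm_apply
  refine ⟨ρ.withDensityᵥ σ, ?_, ?_, fun Φ => ?_⟩
  · rw [Measure.variation_withDensityᵥ (hint σ)]
    refine withDensity_absolutelyContinuous _ _ ?_
    rw [hρ, Measure.restrict_apply Ω.isOpen.measurableSet.compl]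
    simp
  · rw [Measure.variation_withDensityᵥ (hint σ)]
    -- Testing with `σ / |σ|` (zero where `σ` vanishes) yields `∫ |σ| dρ ≤ ρ(univ) ≤ M`.
    have hzm : MemLp (fun x => ‖σ x‖⁻¹ • σ x) 2 ρ :=
      MemLp.of_bound ((Lp.aestronglyMeasurable σ).norm.inv₀.smul (Lp.aestronglyMeasurable σ)) 1
        (.of_forall fun x => by simp [norm_smul, inv_mul_le_one])
    have h1 : ∫ x, ‖σ x‖ ∂ρ ≤ (ρ Set.univ).toReal := by
      have h2 := hσ (hzm.toLp _)
      rw [L2.inner_def] at h2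
      have h3 : ∫ x, inner ℝ (σ x) (hzm.toLp _ x) ∂ρ = ∫ x, ‖σ x‖ ∂ρ := by
        refine integral_congr_ae ?_
        filter_upwards [hzm.coeFn_toLp] with x hx
        rw [hx, inner_smul_right, real_inner_self_eq_norm_sq]
        by_cases h0 : ‖σ x‖ = 0
        · simp [h0]
        · field_simp
      rw [← h3, h2]
      refine (hl2 _).trans ?_
      refine (integral_mono_ae (g := fun _ => (1 : ℝ)) (hint _).norm (integrable_const _) ?_).trans ?_
      · filter_upwards [hzm.coeFn_toLp] with x hx
        rw [hx]
        simp [norm_smul, inv_mul_le_one]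
      · simp [Measure.real]
    rw [withDensity_apply _ Ω.isOpen.measurableSet]
    refine (setLIntegral_le_lintegral _ _).trans (le_trans ?_ hρM)
    rw [← ofReal_integral_norm_eq_lintegral_enorm (hint σ)]
    exact ENNReal.ofReal_le_of_le_toReal h1
  · rw [TestFunction.integral_withDensityᵥ _ (hint σ), ← hl1, ← hσ, L2.inner_def]
    refine integral_congr_ae ?_
    filter_upwards [coeFn_testToLp ρ Φ] with x hx
    rw [hx, real_inner_comm]

end Riesz

end TVDenoising


namespace TVDenoising

/-! ### Total variation as a supremum over test fields -/

section TotalVariation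

variable {n : ℕ} {Ω : Opens (EuclideanSpace ℝ (Fin n))}

/-- The functional `Φ ↦ ∫_Ω u div Φ` on test fields. -/
noncomputable def divPairing {u : EuclideanSpace ℝ (Fin n) → ℝ} (hu : IntegrableOn u Ω) :
    TestFunction Ω (EuclideanSpace ℝ (Fin n)) ⊤ →ₗ[ℝ] ℝ where
  toFun Φ := ∫ x in Ω, u x * divergence Φ x
  map_add' Φ Ψ := by
    rw [← integral_add (integrable_mul_divergence hu Φ) (integrable_mul_divergence hu Ψ)]
    refine integral_congr_ae (.of_forall fun x => ?_)
    have := divergence_add (TestFunction.differentiable Φ x) (TestFunction.differentiable Ψ x)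
    change u x * divergence (fun y => Φ y + Ψ y) x = _
    rw [this]; ring
  map_smul' c Φ := by
    rw [RingHom.id_apply, smul_eq_mul, ← integral_const_mul]
    refine integral_congr_ae (.of_forall fun x => ?_)
    have := divergence_const_smul c (TestFunction.differentiable Φ x)
    change u x * divergence (fun y => c • Φ y) x = _
    rw [this]; ring

/-- The vector measure representing `-∫ u div Φ` is the derivative. -/
lemma mem_BV_of_divPairing_le {u : EuclideanSpace ℝ (Fin n) → ℝ} (hu : IntegrableOn u Ω)
    {M : ℝ} (hM : 0 ≤ M) (h : ∀ Φ : TestFunction Ω (EuclideanSpace ℝ (Fin n)) ⊤,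
      (∀ x, ‖Φ x‖ ≤ 1) → ∫ x in Ω, u x * divergence Φ x ≤ M) :
    u ∈ BV Ω ∧ TV Ω u ≤ ENNReal.ofReal M := by
  obtain ⟨ν, h1, h2, h3⟩ := exists_vectorMeasure_representation (-divPairing hu) hM
    fun Φ hΦ => by
      rw [LinearMap.neg_apply, ← map_neg]
      exact h (-Φ) fun x => by
        change ‖-Φ x‖ ≤ 1
        rw [norm_neg]
        exact hΦ x
  have hν : IsDerivMeasure Ω u ν := (isDerivMeasure_iff hu).2
    ⟨h1, h2.trans_lt ENNReal.ofReal_lt_top, fun Φ => by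
      rw [h3, LinearMap.neg_apply, neg_neg]; rfl⟩
  refine ⟨⟨hu, ν, hν⟩, ?_⟩
  rwa [TV, hν.D_eq]

lemma TV_lt_top {u : EuclideanSpace ℝ (Fin n) → ℝ} (hu : u ∈ BV Ω) : TV Ω u < ∞ :=
  (isDerivMeasure_D hu).2.1

lemma divPairing_le_TV {u : EuclideanSpace ℝ (Fin n) → ℝ} (hu : u ∈ BV Ω)
    (Φ : TestFunction Ω (EuclideanSpace ℝ (Fin n)) ⊤) (hΦ : ∀ x, ‖Φ x‖ ≤ 1) :
    ∫ x in Ω, u x * divergence Φ x ≤ (TV Ω u).toReal := by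
  have hD := (isDerivMeasure_iff hu.1).1 (isDerivMeasure_D hu)
  rw [hD.2.2 Φ]
  exact (neg_le_abs _).trans (TestFunction.integral_le_variation Φ hΦ hD.1 hD.2.1)

lemma TV_le_of_divPairing_le {u : EuclideanSpace ℝ (Fin n) → ℝ} (hu : u ∈ BV Ω)
    {M : ℝ} (hM : 0 ≤ M) (h : ∀ Φ : TestFunction Ω (EuclideanSpace ℝ (Fin n)) ⊤,
      (∀ x, ‖Φ x‖ ≤ 1) → ∫ x in Ω, u x * divergence Φ x ≤ M) :
    TV Ω u ≤ ENNReal.ofReal M :=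
  (mem_BV_of_divPairing_le hu.1 hM h).2

end TotalVariation

/-! ### The Huber functional as an infimal convolution -/

section Huber

variable {n : ℕ} {Ω : Opens (EuclideanSpace ℝ (Fin n))}

lemma variation_eq_of_forall_subset {X : Type*} [MeasurableSpace X] {V : Type*}
    [NormedAddCommGroup V] {μ ν : VectorMeasure X V} {S : Set X} (hS : MeasurableSet S)
    (h : ∀ T, MeasurableSet T → T ⊆ S → μ T = ν T) : μ.variation S = ν.variation S := by
  have h1 : μ.restrict S = ν.restrict S := by
    ext T hT
    rw [VectorMeasure.restrict_apply _ hS hT, VectorMeasure.restrict_apply _ hS hT]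
    exact h _ (hT.inter hS) Set.inter_subset_right
  have h2 := congrArg (fun τ : VectorMeasure X V => τ.variation S) h1
  simpa [VectorMeasure.variation_restrict hS] using h2

lemma integrable_acDensity
    (ν : VectorMeasure (EuclideanSpace ℝ (Fin n)) (EuclideanSpace ℝ (Fin n))) :
    Integrable (acDensity ν) volume :=
  ((EuclideanSpace.equiv (Fin n) ℝ).symm.toContinuousLinearMap).integrable_comp
    (Integrable.of_eval fun _ => SignedMeasure.integrable_rnDeriv _ _)

lemma measurable_acDensity
    (ν : VectorMeasure (EuclideanSpace ℝ (Fin n)) (EuclideanSpace ℝ (Fin n))) :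
    Measurable (acDensity ν) :=
  (EuclideanSpace.equiv (Fin n) ℝ).symm.continuous.measurable.comp
    (measurable_pi_lambda _ fun _ => SignedMeasure.measurable_rnDeriv _ _)

/-- The singular part of a vector measure is concentrated on a Lebesgue null set. -/
lemma exists_null_singularPart
    (ν : VectorMeasure (EuclideanSpace ℝ (Fin n)) (EuclideanSpace ℝ (Fin n))) :
    ∃ A, MeasurableSet A ∧ volume A = 0 ∧
      ∀ T, MeasurableSet T → T ⊆ Aᶜ → singularPart ν T = 0 := by
  let p (i : Fin n) : EuclideanSpace ℝ (Fin n) →L[ℝ] ℝ := EuclideanSpace.proj i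
  let ν' (i : Fin n) : SignedMeasure (EuclideanSpace ℝ (Fin n)) :=
    ν.mapRange (p i).toLinearMap.toAddMonoidHom (p i).continuous
  choose S hS h1 h2 using fun i => SignedMeasure.mutuallySingular_singularPart (ν' i) volume
  refine ⟨⋃ i, (S i)ᶜ, MeasurableSet.iUnion fun i => (hS i).compl, ?_, fun T hT hTA => ?_⟩
  · refine measure_iUnion_null fun i => ?_
    have := h2 i (S i)ᶜ le_rfl
    rwa [Measure.toENNRealVectorMeasure_apply_measurable (hS i).compl] at this
  · ext i
    have h3 : T ⊆ S i := fun x hx => by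
      by_contra h
      exact hTA hx (Set.mem_iUnion.2 ⟨i, h⟩)
    have h4 := congrArg (fun τ : SignedMeasure (EuclideanSpace ℝ (Fin n)) => τ T)
      (SignedMeasure.singularPart_add_withDensity_rnDeriv_eq (s := ν' i) volume)
    simp only [_root_.add_apply, h1 i T h3, zero_add,
      withDensityᵥ_apply (SignedMeasure.integrable_rnDeriv _ _) hT] at h4
    rw [singularPart, _root_.sub_apply, withDensityᵥ_apply (integrable_acDensity ν) hT,
      PiLp.sub_apply, integral_apply (integrable_acDensity ν).integrableOn]
    change p i (ν T) - ∫ x in T, (ν' i).rnDeriv volume x = 0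
    rw [h4]
    exact sub_self _

/-- Split `Ω` along a Lebesgue null set carrying the singular part: off it only the density
`acDensity ν - b` is visible, on it only the singular part. -/
lemma variation_sub_withDensityᵥ
    (ν : VectorMeasure (EuclideanSpace ℝ (Fin n)) (EuclideanSpace ℝ (Fin n)))
    {b : EuclideanSpace ℝ (Fin n) → EuclideanSpace ℝ (Fin n)} (hb : IntegrableOn b Ω) :
    (ν - (volume.restrict Ω).withDensityᵥ b).variation Ω =
      (∫⁻ x in Ω, ‖acDensity ν x - b x‖ₑ) + (singularPart ν).variation Ω := by
  obtain ⟨A, hA, hA0, hsing⟩ := exists_null_singularPart ν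
  have hΩ : MeasurableSet (Ω : Set (EuclideanSpace ℝ (Fin n))) := Ω.isOpen.measurableSet
  have ha := integrable_acDensity ν
  have hb' : Integrable ((Ω : Set (EuclideanSpace ℝ (Fin n))).indicator b) volume :=
    hb.integrable_indicator hΩ
  rw [← measure_sdiff_add_inter _ hA]
  congr 1
  · have h1 : (ν - (volume.restrict Ω).withDensityᵥ b).variation (Ω \ A) =
        (volume.withDensityᵥ
          (acDensity ν - (Ω : Set (EuclideanSpace ℝ (Fin n))).indicator b)).variation (Ω \ A) := by
      refine variation_eq_of_forall_subset (hΩ.diff hA) fun T hT hTs => ?_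
      have hs := hsing T hT fun x hx => (hTs hx).2
      rw [singularPart, _root_.sub_apply, sub_eq_zero] at hs
      rw [_root_.sub_apply, hs, withDensityᵥ_sub ha hb', _root_.sub_apply]
      congr 1
      rw [withDensityᵥ_apply hb hT, withDensityᵥ_apply hb' hT, setIntegral_indicator hΩ,
        Measure.restrict_restrict hT]
    rw [h1, Measure.variation_withDensityᵥ (ha.sub hb'), withDensity_apply _ (hΩ.diff hA),
      Measure.restrict_congr_set (sdiff_null_ae_eq_self hA0)]
    refine setLIntegral_congr_fun hΩ fun x hx => ?_
    simp [Set.indicator_of_mem hx]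
  · have h1 : (ν - (volume.restrict Ω).withDensityᵥ b).variation (Ω ∩ A) =
        (singularPart ν).variation (Ω ∩ A) := by
      refine variation_eq_of_forall_subset (hΩ.inter hA) fun T hT hTs => ?_
      have hT0 : volume T = 0 := measure_mono_null (fun x hx => (hTs hx).2) hA0
      rw [_root_.sub_apply, withDensityᵥ_apply hb hT, singularPart, _root_.sub_apply,
        withDensityᵥ_apply ha hT, Measure.restrict_restrict hT,
        Measure.restrict_zero_set (measure_mono_null Set.inter_subset_left hT0),
        Measure.restrict_zero_set hT0]
      simp
    have h2 : (singularPart ν).variation (Ω \ A) = 0 := by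
      rw [variation_eq_of_forall_subset (ν := 0) (hΩ.diff hA) fun T hT hTs => by
        rw [hsing T hT fun x hx => (hTs hx).2]; rfl]
      simp
    rw [h1, ← measure_sdiff_add_inter (Ω : Set (EuclideanSpace ℝ (Fin n))) hA, h2, zero_add]

/-- The Huber function is the infimal convolution of `|·|` and `(γ/2)|·|²`. This is the upper bound,
obtained by completing the square; `huberClamp` is the choice of `k` with equality. -/
lemma huberNorm_le {γ : ℝ≥0∞} (hγ : γ ≠ 0) (hγ' : γ ≠ ∞) (g k : EuclideanSpace ℝ (Fin n)) :
    huberNorm γ g ≤ ‖g - k‖ + γ.toReal / 2 * ‖k‖ ^ 2 := by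
  have hc : 0 < γ.toReal := ENNReal.toReal_pos hγ hγ'
  have h1 := norm_sub_norm_le g k
  have h0 := norm_nonneg (g - k)
  rw [huberNorm, if_neg hγ']
  generalize γ.toReal = c at *
  split_ifs with h
  · have : 1 / (2 * c) = (1 / c) / 2 := by field_simp
    have h2 : 0 ≤ (c * ‖k‖ - 1) ^ 2 / (2 * c) := by positivity
    have h3 : (c * ‖k‖ - 1) ^ 2 / (2 * c) = c / 2 * ‖k‖ ^ 2 - ‖k‖ + 1 / (2 * c) := by
      field_simp
      ring
    linarith
  · rw [not_le, lt_div_iff₀ hc] at h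
    rcases le_total ‖g‖ ‖k‖ with h2 | h2
    · have : ‖g‖ ^ 2 ≤ ‖k‖ ^ 2 := by gcongr
      nlinarith
    · have h3 : c / 2 * (‖g‖ ^ 2 - ‖k‖ ^ 2) = (‖g‖ - ‖k‖) * (c * (‖g‖ + ‖k‖) / 2) := by ring
      have h4 : c * (‖g‖ + ‖k‖) / 2 ≤ 1 := by nlinarith
      nlinarith [mul_le_mul_of_nonneg_left h4 (sub_nonneg.2 h2)]

/-- The truncation of `g` at norm `1 / γ`. -/
noncomputable def huberClamp (γ : ℝ≥0∞) (g : EuclideanSpace ℝ (Fin n)) :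
    EuclideanSpace ℝ (Fin n) :=
  if 1 / γ.toReal ≤ ‖g‖ then (γ.toReal * ‖g‖)⁻¹ • g else g

lemma measurable_huberClamp (γ : ℝ≥0∞) :
    Measurable (huberClamp γ : EuclideanSpace ℝ (Fin n) → EuclideanSpace ℝ (Fin n)) := by
  refine Measurable.ite (measurableSet_le measurable_const measurable_norm) ?_ measurable_id
  exact ((measurable_norm.const_mul _).inv).smul measurable_id

lemma norm_huberClamp_le {γ : ℝ≥0∞} (hγ : γ ≠ 0) (hγ' : γ ≠ ∞) (g : EuclideanSpace ℝ (Fin n)) :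
    ‖huberClamp γ g‖ ≤ 1 / γ.toReal := by
  have hc : 0 < γ.toReal := ENNReal.toReal_pos hγ hγ'
  unfold huberClamp
  split_ifs with h
  · have hg : 0 < ‖g‖ := lt_of_lt_of_le (by positivity) h
    rw [norm_smul, Real.norm_of_nonneg (by positivity)]
    field_simp
    rfl
  · exact (not_le.1 h).le

lemma huberNorm_eq_clamp {γ : ℝ≥0∞} (hγ : γ ≠ 0) (hγ' : γ ≠ ∞) (g : EuclideanSpace ℝ (Fin n)) :
    ‖g - huberClamp γ g‖ + γ.toReal / 2 * ‖huberClamp γ g‖ ^ 2 = huberNorm γ g := by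
  have hc : 0 < γ.toReal := ENNReal.toReal_pos hγ hγ'
  rw [huberNorm, if_neg hγ']
  unfold huberClamp
  generalize γ.toReal = c at *
  split_ifs with h
  · have hg : 0 < ‖g‖ := lt_of_lt_of_le (by positivity) h
    have h1 : g - (c * ‖g‖)⁻¹ • g = (1 - (c * ‖g‖)⁻¹) • g := by rw [sub_smul, one_smul]
    have h2 : (c * ‖g‖)⁻¹ ≤ 1 := by
      rw [div_le_iff₀ hc] at h
      exact inv_le_one_of_one_le₀ (by linarith)
    rw [h1, norm_smul, norm_smul, Real.norm_of_nonneg (by linarith),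
      Real.norm_of_nonneg (by positivity)]
    field_simp
    ring
  · simp

lemma huberNorm_nonneg {γ : ℝ≥0∞} (hγ : γ ≠ 0) (g : EuclideanSpace ℝ (Fin n)) :
    0 ≤ huberNorm γ g := by
  by_cases hγ' : γ = ∞
  · simp [huberNorm, hγ']
  · rw [← huberNorm_eq_clamp hγ hγ']
    positivity

/-- Below the threshold the defect is `1/(2γ) - (γ|g| - 1)²/(2γ)`, above it exactly `1/(2γ)`.
Integrated over a bounded set, this makes the Huber functional uniformly close to the total
variation for large `γ`. -/
lemma norm_le_huberNorm_add {γ : ℝ≥0∞} (hγ : γ ≠ 0) (hγ' : γ ≠ ∞)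
    (g : EuclideanSpace ℝ (Fin n)) : ‖g‖ ≤ huberNorm γ g + 1 / (2 * γ.toReal) := by
  have hc : 0 < γ.toReal := ENNReal.toReal_pos hγ hγ'
  rw [huberNorm, if_neg hγ']
  generalize γ.toReal = c at *
  split_ifs with h
  · linarith
  · have h2 : 0 ≤ (c * ‖g‖ - 1) ^ 2 / (2 * c) := by positivity
    have h3 : (c * ‖g‖ - 1) ^ 2 / (2 * c) = c / 2 * ‖g‖ ^ 2 - ‖g‖ + 1 / (2 * c) := by
      field_simp
      ring
    linarith

lemma huberMeasure_apply {γ : ℝ≥0∞} (hγ' : γ ≠ ∞)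
    (ν : VectorMeasure (EuclideanSpace ℝ (Fin n)) (EuclideanSpace ℝ (Fin n))) :
    huberMeasure γ ν Ω = (∫⁻ x in Ω, ENNReal.ofReal (huberNorm γ (acDensity ν x))) +
      (singularPart ν).variation Ω := by
  rw [huberMeasure, if_neg hγ', Measure.add_apply, withDensity_apply _ Ω.isOpen.measurableSet]

lemma eLpNorm_two_sq {X F : Type*} [MeasurableSpace X] [NormedAddCommGroup F] (f : X → F)
    (ρ : Measure X) : eLpNorm f 2 ρ ^ 2 = ∫⁻ x, ‖f x‖ₑ ^ 2 ∂ρ := by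
  have := eLpNorm_nnreal_pow_eq_lintegral (f := f) (μ := ρ) (p := 2) (by norm_num)
  simpa using this

/-- The Huber regularisation is an infimal convolution: this is the scale of the quadratic part. -/
noncomputable def huberScale (γ : ℝ≥0∞) : ℝ := if γ = ∞ then 0 else (√γ.toReal)⁻¹

lemma ofReal_norm_add_half_sq (g y : EuclideanSpace ℝ (Fin n)) :
    ENNReal.ofReal (‖g‖ + 2⁻¹ * ‖y‖ ^ 2) = ‖g‖ₑ + 2⁻¹ * ‖y‖ₑ ^ 2 := by
  rw [ENNReal.ofReal_add (by positivity) (by positivity), ENNReal.ofReal_mul (by positivity),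
    ENNReal.ofReal_pow (norm_nonneg _), ofReal_norm, ofReal_norm,
    ENNReal.ofReal_inv_of_pos two_pos, ENNReal.ofReal_ofNat]

lemma aemeasurable_enorm_acDensity_sub
    (ν : VectorMeasure (EuclideanSpace ℝ (Fin n)) (EuclideanSpace ℝ (Fin n)))
    {y : EuclideanSpace ℝ (Fin n) → EuclideanSpace ℝ (Fin n)} (hy : IntegrableOn y Ω) (c : ℝ) :
    AEMeasurable (fun x => ‖acDensity ν x - c • y x‖ₑ)
      (volume.restrict (Ω : Set (EuclideanSpace ℝ (Fin n)))) :=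
  ((integrable_acDensity ν).integrableOn.sub (hy.fun_smul c)).aestronglyMeasurable.enorm

lemma huberMeasure_le {γ : ℝ≥0∞} (hγ : γ ≠ 0)
    (ν : VectorMeasure (EuclideanSpace ℝ (Fin n)) (EuclideanSpace ℝ (Fin n)))
    {y : EuclideanSpace ℝ (Fin n) → EuclideanSpace ℝ (Fin n)} (hy : IntegrableOn y Ω) :
    huberMeasure γ ν Ω ≤
      (ν - (volume.restrict Ω).withDensityᵥ (fun x => huberScale γ • y x)).variation Ω +
        eLpNorm y 2 (volume.restrict Ω) ^ 2 / 2 := by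
  by_cases hγ' : γ = ∞
  · have h0 : (fun x => huberScale γ • y x) = 0 := by
      ext1 x; simp [huberScale, hγ']
    rw [h0, withDensityᵥ_zero, sub_zero, huberMeasure, if_pos hγ']
    exact le_self_add
  have hc : 0 < γ.toReal := ENNReal.toReal_pos hγ hγ'
  have hm : AEMeasurable (fun x => ‖acDensity ν x - huberScale γ • y x‖ₑ)
      (volume.restrict (Ω : Set (EuclideanSpace ℝ (Fin n)))) :=
    aemeasurable_enorm_acDensity_sub ν hy _
  rw [variation_sub_withDensityᵥ ν (hy.fun_smul _), huberMeasure_apply hγ', add_right_comm]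
  gcongr
  rw [eLpNorm_two_sq, ENNReal.div_eq_inv_mul, ← lintegral_const_mul'' _
    (hy.aestronglyMeasurable.enorm.pow_const 2), ← lintegral_add_left' hm]
  refine lintegral_mono fun x => ?_
  have h1 := huberNorm_le hγ hγ' (acDensity ν x) (huberScale γ • y x)
  -- The scale `γ^(-1/2)` normalises the quadratic cost to `½|y|²`. As it is `0` for `γ = ∞`, the
  -- same formula covers the unregularised case.
  have h2 : γ.toReal / 2 * ‖huberScale γ • y x‖ ^ 2 = 2⁻¹ * ‖y x‖ ^ 2 := by
    rw [huberScale, if_neg hγ', norm_smul, mul_pow, norm_inv, Real.norm_of_nonneg (by positivity),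
      inv_pow, Real.sq_sqrt hc.le]
    field_simp
  rw [h2] at h1
  exact (ENNReal.ofReal_le_ofReal h1).trans_eq (ofReal_norm_add_half_sq _ _)

lemma exists_le_huberMeasure (hΩ : volume (Ω : Set (EuclideanSpace ℝ (Fin n))) ≠ ∞)
    {γ : ℝ≥0∞} (hγ : γ ≠ 0)
    (ν : VectorMeasure (EuclideanSpace ℝ (Fin n)) (EuclideanSpace ℝ (Fin n))) :
    ∃ y : EuclideanSpace ℝ (Fin n) → EuclideanSpace ℝ (Fin n), MemLp y 2 (volume.restrict Ω) ∧
      (ν - (volume.restrict Ω).withDensityᵥ (fun x => huberScale γ • y x)).variation Ω +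
        eLpNorm y 2 (volume.restrict Ω) ^ 2 / 2 ≤ huberMeasure γ ν Ω := by
  by_cases hγ' : γ = ∞
  · refine ⟨0, MemLp.zero, ?_⟩
    have h0 : (fun x => huberScale γ • (0 : EuclideanSpace ℝ (Fin n) →
      EuclideanSpace ℝ (Fin n)) x) = 0 := by ext1 x; simp
    rw [h0, withDensityᵥ_zero, sub_zero, huberMeasure, if_pos hγ']
    simp
  have : IsFiniteMeasure (volume.restrict (Ω : Set (EuclideanSpace ℝ (Fin n)))) :=
    ⟨by simpa using hΩ.lt_top⟩
  have hc : 0 < γ.toReal := ENNReal.toReal_pos hγ hγ'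
  have hs : 0 < huberScale γ := by
    rw [huberScale, if_neg hγ']; positivity
  set y := fun x => (huberScale γ)⁻¹ • huberClamp γ (acDensity ν x) with hy
  have hym : Measurable y := ((measurable_huberClamp γ).comp (measurable_acDensity ν)).const_smul
    (huberScale γ)⁻¹
  have hy2 : MemLp y 2 (volume.restrict Ω) := by
    refine MemLp.of_bound hym.aestronglyMeasurable ((huberScale γ)⁻¹ * (1 / γ.toReal))
      (.of_forall fun x => ?_)
    rw [norm_smul, Real.norm_of_nonneg (by positivity)]
    gcongr
    exact norm_huberClamp_le hγ hγ' _
  refine ⟨y, hy2, ?_⟩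
  have hyi : IntegrableOn y Ω := hy2.integrable one_le_two
  have hm : AEMeasurable (fun x => ‖acDensity ν x - huberScale γ • y x‖ₑ)
      (volume.restrict (Ω : Set (EuclideanSpace ℝ (Fin n)))) :=
    aemeasurable_enorm_acDensity_sub ν hyi _
  rw [variation_sub_withDensityᵥ ν (hyi.fun_smul _), huberMeasure_apply hγ', add_right_comm]
  gcongr
  rw [eLpNorm_two_sq, ENNReal.div_eq_inv_mul, ← lintegral_const_mul'' _
    (hym.enorm.pow_const 2).aemeasurable, ← lintegral_add_left' hm]
  refine lintegral_mono fun x => ?_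
  have h1 := huberNorm_eq_clamp hγ hγ' (acDensity ν x)
  have h3 : huberScale γ • y x = huberClamp γ (acDensity ν x) := by
    rw [hy, smul_smul, mul_inv_cancel₀ hs.ne', one_smul]
  have h2 : γ.toReal / 2 * ‖huberClamp γ (acDensity ν x)‖ ^ 2 = 2⁻¹ * ‖y x‖ ^ 2 := by
    rw [← h3, huberScale, if_neg hγ', norm_smul, mul_pow, norm_inv,
      Real.norm_of_nonneg (by positivity), inv_pow, Real.sq_sqrt hc.le]
    field_simp
  rw [← h1, h2, ofReal_norm_add_half_sq, h3]

lemma huberMeasure_le_variation {γ : ℝ≥0∞} (hγ : γ ≠ 0)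
    (ν : VectorMeasure (EuclideanSpace ℝ (Fin n)) (EuclideanSpace ℝ (Fin n))) :
    huberMeasure γ ν Ω ≤ ν.variation Ω := by
  have h := huberMeasure_le (Ω := Ω) hγ ν (y := 0) (integrable_zero _ _ _)
  have h0 : (fun x => huberScale γ • (0 : EuclideanSpace ℝ (Fin n) →
      EuclideanSpace ℝ (Fin n)) x) = 0 := by ext1 x; simp
  rw [h0, withDensityᵥ_zero, sub_zero] at h
  simpa using h

lemma variation_le_huberMeasure_add {γ : ℝ≥0∞} {c : ℝ≥0} (hc : 0 < c) (hγ : (c : ℝ≥0∞) ≤ γ)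
    (ν : VectorMeasure (EuclideanSpace ℝ (Fin n)) (EuclideanSpace ℝ (Fin n))) :
    ν.variation Ω ≤ huberMeasure γ ν Ω +
      ENNReal.ofReal (1 / (2 * (c : ℝ))) * volume (Ω : Set (EuclideanSpace ℝ (Fin n))) := by
  by_cases hγ' : γ = ∞
  · rw [huberMeasure, if_pos hγ']
    exact le_self_add
  have hγ0 : γ ≠ 0 := fun h => by
    rw [h] at hγ
    exact hc.ne' (by simpa using hγ)
  have hle : (c : ℝ) ≤ γ.toReal := by
    have := (ENNReal.toReal_le_toReal ENNReal.coe_ne_top hγ').2 hγ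
    simpa using this
  have hc' : (0 : ℝ) < c := hc
  have h := variation_sub_withDensityᵥ (Ω := Ω) ν (b := 0) (integrable_zero _ _ _)
  rw [withDensityᵥ_zero, sub_zero] at h
  rw [h, huberMeasure_apply hγ', add_right_comm]
  gcongr
  have h1 : ENNReal.ofReal (1 / (2 * (c : ℝ))) * volume (Ω : Set (EuclideanSpace ℝ (Fin n))) =
      ∫⁻ _ in (Ω : Set (EuclideanSpace ℝ (Fin n))), ENNReal.ofReal (1 / (2 * (c : ℝ))) := by
    rw [setLIntegral_const]
  rw [h1, ← lintegral_add_right _ measurable_const]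
  refine lintegral_mono fun x => ?_
  have h2 := norm_le_huberNorm_add hγ0 hγ' (acDensity ν x)
  rw [Pi.zero_apply, sub_zero, ← ofReal_norm,
    ← ENNReal.ofReal_add (huberNorm_nonneg hγ0 _) (by positivity)]
  refine ENNReal.ofReal_le_ofReal (h2.trans ?_)
  gcongr

end Huber

end TVDenoising


namespace TVDenoising

/-! ### Strong minimisers in a Hilbert space -/

section StrongMinimum

variable {H : Type*} [NormedAddCommGroup H] [InnerProductSpace ℝ H]

lemma norm_sq_convex_combination (x y : H) (s : ℝ) :
    ‖(1 - s) • x + s • y‖ ^ 2 = (1 - s) * ‖x‖ ^ 2 + s * ‖y‖ ^ 2 - s * (1 - s) * ‖x - y‖ ^ 2 := by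
  rw [norm_add_sq_real, norm_sub_sq_real, norm_smul, norm_smul, mul_pow, mul_pow,
    Real.norm_eq_abs, Real.norm_eq_abs, sq_abs, sq_abs, inner_smul_left, inner_smul_right]
  simp
  ring

/-- The sum of half the squared distance to `a` and a closed convex function, given by its
epigraph, has a minimiser, at which it grows quadratically. -/
lemma exists_strong_minimiser [CompleteSpace H] {C : Set (H × ℝ)} (hC : IsClosed C)
    (hconv : Convex ℝ C) (hne : C.Nonempty) (h0 : ∀ p ∈ C, 0 ≤ p.2) (a : H) :
    ∃ p ∈ C, ∀ q ∈ C,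
      ‖p.1 - a‖ ^ 2 / 2 + p.2 + ‖p.1 - q.1‖ ^ 2 / 2 ≤ ‖q.1 - a‖ ^ 2 / 2 + q.2 := by
  set F : H × ℝ → ℝ := fun p => ‖p.1 - a‖ ^ 2 / 2 + p.2 with hF
  have hbdd : BddBelow (F '' C) := ⟨0, by
    rintro _ ⟨p, hp, rfl⟩
    exact add_nonneg (by positivity) (h0 p hp)⟩
  set m := sInf (F '' C) with hm
  have hmle {p : H × ℝ} (hp : p ∈ C) : m ≤ F p := csInf_le hbdd ⟨p, hp, rfl⟩
  have hcomb {p q : H × ℝ} (hp : p ∈ C) (hq : q ∈ C) {s : ℝ} (hs0 : 0 ≤ s) (hs1 : s ≤ 1) :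
      m ≤ (1 - s) * F p + s * F q - s * (1 - s) * ‖p.1 - q.1‖ ^ 2 / 2 := by
    refine (hmle (hconv hp hq (sub_nonneg.2 hs1) hs0 (by ring))).trans_eq ?_
    have h1 : (1 - s) • p.1 + s • q.1 - a = (1 - s) • (p.1 - a) + s • (q.1 - a) := by
      module
    have h2 := norm_sq_convex_combination (p.1 - a) (q.1 - a) s
    rw [sub_sub_sub_cancel_right] at h2
    simp only [hF, Prod.fst_add, Prod.smul_fst, Prod.snd_add, Prod.smul_snd, smul_eq_mul, h1, h2]
    ring
  have hex (k : ℕ) : ∃ p ∈ C, F p < m + 1 / ((k : ℝ) + 1) := by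
    obtain ⟨_, ⟨p, hp, rfl⟩, h⟩ := exists_lt_of_csInf_lt (hne.image F)
      (show sInf (F '' C) < m + 1 / ((k : ℝ) + 1) from lt_add_of_pos_right _ (by positivity))
    exact ⟨p, hp, h⟩
  choose p hpC hpF using hex
  -- Midpoints lie in the convex set `C`, so their value is at least `m`; the parallelogram identity
  -- then makes the minimising sequence Cauchy.
  have hdist (k l : ℕ) : ‖(p k).1 - (p l).1‖ ^ 2 ≤ 4 * (1 / ((k : ℝ) + 1) + 1 / ((l : ℝ) + 1)) := by
    have h1 := hcomb (hpC k) (hpC l) (s := 1 / 2) (by norm_num) (by norm_num)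
    have h2 := hpF k
    have h3 := hpF l
    linarith
  have hcau : CauchySeq fun k => (p k).1 := by
    rw [Metric.cauchySeq_iff']
    intro ε hε
    obtain ⟨N, hN⟩ := exists_nat_one_div_lt (show 0 < ε ^ 2 / 8 by positivity)
    refine ⟨N, fun k hk => ?_⟩
    have h1 : 1 / ((k : ℝ) + 1) ≤ 1 / ((N : ℝ) + 1) := by gcongr
    have h2 := hdist k N
    rw [dist_eq_norm]
    exact lt_of_pow_lt_pow_left₀ 2 hε.le (by linarith)
  obtain ⟨x, hx⟩ := cauchySeq_tendsto_of_complete hcau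
  have hFm : Filter.Tendsto (fun k => F (p k)) Filter.atTop (𝓝 m) := by
    refine tendsto_of_tendsto_of_tendsto_of_le_of_le tendsto_const_nhds ?_ (fun k => hmle (hpC k))
      fun k => (hpF k).le
    simpa using tendsto_const_nhds.add (tendsto_one_div_add_atTop_nhds_zero_nat (𝕜 := ℝ))
  -- The heights converge because both the total values and the distances do. Closedness of `C` then
  -- places the limit in it, without weak compactness.
  have ht : Filter.Tendsto (fun k => (p k).2) Filter.atTop (𝓝 (m - ‖x - a‖ ^ 2 / 2)) := by
    have := hFm.sub (((hx.sub_const a).norm.pow 2).div_const 2)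
    refine this.congr fun k => ?_
    simp [hF]
  have hmem : (x, m - ‖x - a‖ ^ 2 / 2) ∈ C :=
    hC.mem_of_tendsto (hx.prodMk_nhds ht) (.of_forall hpC)
  refine ⟨_, hmem, fun q hq => ?_⟩
  have hFx : F (x, m - ‖x - a‖ ^ 2 / 2) = m := by simp [hF]
  -- Minimality along the segment towards `q`, divided by its parameter `s`; letting `s → 0` gives
  -- the growth with constant `½`.
  have hlim : ∀ s ∈ Set.Ioo (0 : ℝ) 1, m + (1 - s) * (‖x - q.1‖ ^ 2 / 2) ≤ F q := by
    intro s hs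
    have h1 := hcomb hmem hq hs.1.le hs.2.le
    rw [hFx] at h1
    have h2 : 0 ≤ s * (F q - m - (1 - s) * (‖x - q.1‖ ^ 2 / 2)) := by
      dsimp only at h1
      linarith
    have := nonneg_of_mul_nonneg_right h2 hs.1
    linarith
  have hcont : Filter.Tendsto (fun s : ℝ => m + (1 - s) * (‖x - q.1‖ ^ 2 / 2)) (𝓝[>] 0)
      (𝓝 (m + (1 - 0) * (‖x - q.1‖ ^ 2 / 2))) :=
    (Continuous.tendsto (by fun_prop) 0).mono_left nhdsWithin_le_nhds
  have := le_of_tendsto hcont (by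
    filter_upwards [Ioo_mem_nhdsGT (zero_lt_one' ℝ)] with s hs using hlim s hs)
  change F (x, m - ‖x - a‖ ^ 2 / 2) + ‖x - q.1‖ ^ 2 / 2 ≤ F q
  rw [hFx]
  linarith

end StrongMinimum

/-! ### The Dirichlet term in dual form -/

section Gradient

variable {n : ℕ} {Ω : Opens (EuclideanSpace ℝ (Fin n))}

lemma integral_inner_eq_inner_testToLp (ρ : Measure (EuclideanSpace ℝ (Fin n)))
    [IsFiniteMeasureOnCompacts ρ] (g : Lp (EuclideanSpace ℝ (Fin n)) 2 ρ)
    (Φ : TestFunction Ω (EuclideanSpace ℝ (Fin n)) ⊤) :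
    ∫ x, inner ℝ (Φ x) (g x) ∂ρ = inner ℝ g (testToLp Ω ρ Φ) := by
  rw [L2.inner_def]
  refine integral_congr_ae ?_
  filter_upwards [coeFn_testToLp ρ Φ] with x hx
  rw [hx, real_inner_comm]

lemma gradNormSq_le [IsFiniteMeasure (volume.restrict (Ω : Set (EuclideanSpace ℝ (Fin n))))]
    {u : EuclideanSpace ℝ (Fin n) → ℝ}
    (hu : IntegrableOn u Ω) {g : EuclideanSpace ℝ (Fin n) → EuclideanSpace ℝ (Fin n)}
    (hg : MemLp g 2 (volume.restrict Ω))
    (h : ∀ Φ : TestFunction Ω (EuclideanSpace ℝ (Fin n)) ⊤,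
      ∫ x in Ω, u x * divergence Φ x = - ∫ x in Ω, inner ℝ (Φ x) (g x)) :
    gradNormSq Ω u ≤ eLpNorm g 2 (volume.restrict Ω) ^ 2 := by
  have hgi : IntegrableOn g Ω := hg.integrable one_le_two
  exact iInf₂_le g ⟨hu.locallyIntegrableOn, hgi.locallyIntegrableOn,
    (forall_gradient_iff_forall_divergence hu hgi).2 h⟩

/-- Young's inequality `⟨a, b⟩ ≤ ½|a|² + ½|b|²`: the left side is an affine minorant in `u` of the
convex function `(μ/2)‖∇u‖²`. -/
lemma sqrt_mul_divPairing_sub_le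
    [IsFiniteMeasure (volume.restrict (Ω : Set (EuclideanSpace ℝ (Fin n))))]
    {u : EuclideanSpace ℝ (Fin n) → ℝ} (hu : IntegrableOn u Ω) (μ : ℝ≥0)
    (Φ : TestFunction Ω (EuclideanSpace ℝ (Fin n)) ⊤) :
    ENNReal.ofReal (√μ * (∫ x in Ω, u x * divergence Φ x) -
      ‖testToLp Ω (volume.restrict Ω) Φ‖ ^ 2 / 2) ≤ (μ : ℝ≥0∞) / 2 * gradNormSq Ω u := by
  -- Multiplication by `0` does not commute with an infimum that may be `∞`, so `μ = 0` is separate.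
  rcases eq_or_ne μ 0 with rfl | hμ
  · rw [ENNReal.ofReal_of_nonpos]
    · exact zero_le
    · simpa using by positivity
  have hμ2 : (μ : ℝ≥0∞) / 2 ≠ 0 := by simpa using hμ
  have hμ3 : (μ : ℝ≥0∞) / 2 ≠ ∞ := ENNReal.div_ne_top ENNReal.coe_ne_top two_ne_zero
  rw [gradNormSq, ENNReal.mul_iInf_of_ne hμ2 hμ3]
  refine le_iInf fun g => ?_
  rw [ENNReal.mul_iInf_of_ne hμ2 hμ3]
  refine le_iInf fun hg => ?_
  have hgm : AEStronglyMeasurable g (volume.restrict Ω) := hg.2.1.aestronglyMeasurable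
  by_cases hgt : eLpNorm g 2 (volume.restrict Ω) = ∞
  · rw [hgt, ENNReal.top_pow two_ne_zero, ENNReal.mul_top hμ2]
    exact le_top
  have hg2 : MemLp g 2 (volume.restrict Ω) := ⟨hgm, Ne.lt_top hgt⟩
  have hgi : IntegrableOn g Ω := hg2.integrable one_le_two
  have h1 := (forall_gradient_iff_forall_divergence hu hgi).1 hg.2.2 Φ
  have h2 : ∫ x in Ω, inner ℝ (Φ x) (g x) =
      inner ℝ (hg2.toLp g) (testToLp Ω (volume.restrict Ω) Φ) := by
    rw [← integral_inner_eq_inner_testToLp]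
    refine integral_congr_ae ?_
    filter_upwards [hg2.coeFn_toLp] with x hx
    rw [hx]
  have h3 := neg_le_of_abs_le (abs_real_inner_le_norm (hg2.toLp g) (testToLp Ω (volume.restrict Ω) Φ))
  have h4 : eLpNorm g 2 (volume.restrict Ω) = ENNReal.ofReal ‖hg2.toLp g‖ := by
    rw [Lp.norm_toLp, ENNReal.ofReal_toReal hgt]
  have h5 : (μ : ℝ≥0∞) / 2 = ENNReal.ofReal ((μ : ℝ) / 2) := by
    rw [ENNReal.ofReal_div_of_pos two_pos]
    simp
  rw [h1, h2, h4, h5, ← ENNReal.ofReal_pow (norm_nonneg _), ← ENNReal.ofReal_mul (by positivity)]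
  refine ENNReal.ofReal_le_ofReal ?_
  have h6 : √(μ : ℝ) ^ 2 = μ := Real.sq_sqrt μ.2
  have h7 := Real.sqrt_nonneg (μ : ℝ)
  generalize √(μ : ℝ) = s at *
  rw [← h6]
  generalize ‖hg2.toLp g‖ = a at *
  generalize ‖testToLp Ω (volume.restrict Ω) Φ‖ = b at *
  nlinarith [sq_nonneg (s * a - b), mul_le_mul_of_nonneg_left (neg_le.1 h3) h7]

end Gradient

/-! ### Existence of denoised functions -/

section Energy

variable {n : ℕ} {Ω : Opens (EuclideanSpace ℝ (Fin n))}

lemma halfSqDist_eq {f u : EuclideanSpace ℝ (Fin n) → ℝ}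
    (hf : MemLp f 2 (volume.restrict (Ω : Set (EuclideanSpace ℝ (Fin n)))))
    (hu : MemLp u 2 (volume.restrict (Ω : Set (EuclideanSpace ℝ (Fin n))))) :
    halfSqDist Ω f u = ENNReal.ofReal (‖hf.toLp f - hu.toLp u‖ ^ 2 / 2) := by
  rw [halfSqDist, ENNReal.ofReal_div_of_pos two_pos, ENNReal.ofReal_pow (norm_nonneg _),
    ← MemLp.toLp_sub hf hu, Lp.norm_toLp, ENNReal.ofReal_toReal (hf.sub hu).eLpNorm_ne_top]
  simp
  rfl

lemma memLp_of_halfSqDist_lt_top {f u : EuclideanSpace ℝ (Fin n) → ℝ}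
    (hf : MemLp f 2 (volume.restrict (Ω : Set (EuclideanSpace ℝ (Fin n)))))
    (hu : IntegrableOn u Ω) (h : halfSqDist Ω f u < ∞) :
    MemLp u 2 (volume.restrict (Ω : Set (EuclideanSpace ℝ (Fin n)))) := by
  have h1 : MemLp (fun x => f x - u x) 2 (volume.restrict (Ω : Set (EuclideanSpace ℝ (Fin n)))) := by
    refine ⟨hf.aestronglyMeasurable.sub hu.aestronglyMeasurable, ?_⟩
    by_contra h2
    rw [not_lt, top_le_iff] at h2
    rw [halfSqDist, h2, ENNReal.top_pow two_ne_zero, ENNReal.top_div_of_ne_top (by simp)] at h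
    exact h.ne rfl
  refine (hf.sub h1).congr_norm hu.aestronglyMeasurable (.of_forall fun x => ?_)
  simp

/-- The class in `L²(Ω)` of the divergence of a test field, as a linear map. -/
noncomputable def divToLp (Ω : Opens (EuclideanSpace ℝ (Fin n))) :
    TestFunction Ω (EuclideanSpace ℝ (Fin n)) ⊤ →ₗ[ℝ]
      Lp ℝ 2 (volume.restrict (Ω : Set (EuclideanSpace ℝ (Fin n)))) where
  toFun Φ := ((continuous_divergence Φ.contDiff).memLp_of_hasCompactSupport
    (hasCompactSupport_divergence Φ.hasCompactSupport)).toLp (divergence Φ)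
  map_add' Φ Ψ := by
    rw [← MemLp.toLp_add]
    congr 1
    ext1 x
    exact divergence_add (TestFunction.differentiable Φ x) (TestFunction.differentiable Ψ x)
  map_smul' c Φ := by
    rw [RingHom.id_apply, ← MemLp.toLp_const_smul]
    congr 1
    ext1 x
    exact divergence_const_smul c (TestFunction.differentiable Φ x)

lemma inner_divToLp {u : EuclideanSpace ℝ (Fin n) → ℝ}
    (u' : Lp ℝ 2 (volume.restrict (Ω : Set (EuclideanSpace ℝ (Fin n)))))
    (hu : u' =ᵐ[volume.restrict (Ω : Set (EuclideanSpace ℝ (Fin n)))] u)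
    (Φ : TestFunction Ω (EuclideanSpace ℝ (Fin n)) ⊤) :
    inner ℝ u' (divToLp Ω Φ) = ∫ x in Ω, u x * divergence Φ x := by
  rw [L2.inner_def]
  refine integral_congr_ae ?_
  have h : divToLp Ω Φ =ᵐ[volume.restrict (Ω : Set (EuclideanSpace ℝ (Fin n)))] divergence Φ :=
    MemLp.coeFn_toLp ((continuous_divergence Φ.contDiff).memLp_of_hasCompactSupport
      (hasCompactSupport_divergence Φ.hasCompactSupport))
  filter_upwards [hu, h] with x h1 h2
  rw [h1, h2]
  simp [mul_comm]

/-- Optimise at `s = a / b²`; for `b = 0` a linear function of `s` bounded above cannot have `a >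
0`. This recovers an `L²` bound from the dual form of the Dirichlet term. -/
lemma le_sqrt_mul_of_forall_smul {a b m : ℝ} (hb : 0 ≤ b)
    (h : ∀ s : ℝ, s * a - s ^ 2 * b ^ 2 / 2 ≤ m) : a ≤ √(2 * m) * b := by
  rcases hb.eq_or_lt with rfl | hb
  · by_contra! ha
    rw [mul_zero] at ha
    have := h ((m + 1) / a)
    rw [div_mul_cancel₀ _ ha.ne'] at this
    simp at this
    linarith
  · have h1 := h (a / b ^ 2)
    have h2 : a / b ^ 2 * a - (a / b ^ 2) ^ 2 * b ^ 2 / 2 = (a / b) ^ 2 / 2 := by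
      field_simp
      ring
    rw [h2] at h1
    have h3 : a / b ≤ √(2 * m) := Real.le_sqrt_of_sq_le (by linarith)
    rwa [div_le_iff₀ hb] at h3

/-- Pairs of a function and an auxiliary field in `L²(Ω)`. -/
abbrev L2Pair (Ω : Opens (EuclideanSpace ℝ (Fin n))) : Type :=
  WithLp 2 (Lp ℝ 2 (volume.restrict (Ω : Set (EuclideanSpace ℝ (Fin n)))) ×
    Lp (EuclideanSpace ℝ (Fin n)) 2 (volume.restrict (Ω : Set (EuclideanSpace ℝ (Fin n)))))

/-- The functional `Φ ↦ ∫_Ω u div Φ + c ∫_Ω ⟨y, Φ⟩` on test fields. -/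
noncomputable def fieldPairing (c : ℝ) (z : L2Pair Ω) :
    TestFunction Ω (EuclideanSpace ℝ (Fin n)) ⊤ →ₗ[ℝ] ℝ :=
  (innerₛₗ ℝ z.fst) ∘ₗ divToLp Ω + c • (innerₛₗ ℝ z.snd) ∘ₗ testToLp Ω _

lemma fieldPairing_apply (c : ℝ) (z : L2Pair Ω)
    (Φ : TestFunction Ω (EuclideanSpace ℝ (Fin n)) ⊤) :
    fieldPairing c z Φ = inner ℝ z.fst (divToLp Ω Φ) + c * inner ℝ z.snd (testToLp Ω _ Φ) := rfl

/-- The epigraph of the convex part of the denoising functional, in dual form. -/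
def denoisingEpigraph (Ω : Opens (EuclideanSpace ℝ (Fin n))) (c β μ : ℝ) : Set (L2Pair Ω × ℝ) :=
  {p | ∀ Φ₁ Φ₂ : TestFunction Ω (EuclideanSpace ℝ (Fin n)) ⊤, (∀ x, ‖Φ₁ x‖ ≤ 1) →
    β * fieldPairing c p.1 Φ₁ + (√μ * inner ℝ p.1.fst (divToLp Ω Φ₂) -
      ‖testToLp Ω (volume.restrict Ω) Φ₂‖ ^ 2 / 2) ≤ p.2}

/-- The set is an intersection of closed half-spaces, one for each pair of test fields. This
replaces the lower semicontinuity theorems for the total variation and the Dirichlet term. -/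
lemma isClosed_denoisingEpigraph (c β μ : ℝ) : IsClosed (denoisingEpigraph Ω c β μ) := by
  have h1 : Continuous fun p : L2Pair Ω × ℝ => p.1.fst :=
    (WithLp.prod_continuous_ofLp ..).fst.comp continuous_fst
  have h2 : Continuous fun p : L2Pair Ω × ℝ => p.1.snd :=
    (WithLp.prod_continuous_ofLp ..).snd.comp continuous_fst
  simp only [denoisingEpigraph, Set.ofPred_forall, fieldPairing_apply]
  refine isClosed_iInter fun Φ₁ => isClosed_iInter fun Φ₂ => isClosed_iInter fun _ =>
    isClosed_le ?_ continuous_snd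
  fun_prop

lemma convex_denoisingEpigraph (c β μ : ℝ) : Convex ℝ (denoisingEpigraph Ω c β μ) := by
  intro p hp q hq s t hs ht hst Φ₁ Φ₂ hΦ
  have h1 := mul_le_mul_of_nonneg_left (hp Φ₁ Φ₂ hΦ) hs
  have h2 := mul_le_mul_of_nonneg_left (hq Φ₁ Φ₂ hΦ) ht
  have h3 : ‖testToLp Ω (volume.restrict Ω) Φ₂‖ ^ 2 / 2 =
      s * (‖testToLp Ω (volume.restrict Ω) Φ₂‖ ^ 2 / 2) +
      t * (‖testToLp Ω (volume.restrict Ω) Φ₂‖ ^ 2 / 2) := by rw [← add_mul, hst, one_mul]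
  simp only [fieldPairing_apply, Prod.fst_add, Prod.smul_fst, Prod.snd_add, Prod.smul_snd,
    smul_eq_mul, WithLp.add_fst, WithLp.smul_fst, WithLp.add_snd, WithLp.smul_snd, inner_add_left,
    real_inner_smul_left] at h1 h2 ⊢
  linarith

lemma nonempty_denoisingEpigraph (c β μ : ℝ) : (denoisingEpigraph Ω c β μ).Nonempty :=
  ⟨0, fun Φ₁ Φ₂ _ => by
    have : 0 ≤ ‖testToLp Ω (volume.restrict Ω) Φ₂‖ ^ 2 / 2 := by positivity
    simpa [fieldPairing_apply] using this⟩

lemma nonneg_of_mem_denoisingEpigraph {c β μ : ℝ} {p : L2Pair Ω × ℝ}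
    (hp : p ∈ denoisingEpigraph Ω c β μ) : 0 ≤ p.2 := by
  have := hp 0 0 fun x => by simp
  simpa using this

lemma isDerivMeasure_of_fieldPairing
    [IsFiniteMeasure (volume.restrict (Ω : Set (EuclideanSpace ℝ (Fin n))))]
    {c : ℝ} {z : L2Pair Ω}
    {ν : VectorMeasure (EuclideanSpace ℝ (Fin n)) (EuclideanSpace ℝ (Fin n))}
    (h1 : ν.variation (Ω : Set (EuclideanSpace ℝ (Fin n)))ᶜ = 0) (h2 : ν.variation Ω < ∞)
    (h3 : ∀ Φ : TestFunction Ω (EuclideanSpace ℝ (Fin n)) ⊤,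
        VectorMeasure.integral ν Φ (innerSL ℝ) = fieldPairing c z Φ) :
    IsDerivMeasure Ω z.fst ((volume.restrict Ω).withDensityᵥ (fun x => c • z.snd x) - ν) := by
  have hΩm : MeasurableSet (Ω : Set (EuclideanSpace ℝ (Fin n))) := Ω.isOpen.measurableSet
  have hu : IntegrableOn z.fst (Ω : Set (EuclideanSpace ℝ (Fin n))) :=
    (Lp.memLp z.fst).integrable one_le_two
  have hy : Integrable (fun x => c • z.snd x)
      (volume.restrict (Ω : Set (EuclideanSpace ℝ (Fin n)))) :=
    ((Lp.memLp z.snd).integrable one_le_two).fun_smul c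
  have hle := VectorMeasure.variation_sub_le
    (μ := (volume.restrict Ω).withDensityᵥ (fun x => c • z.snd x)) (ν := ν)
  have hvar := Measure.variation_withDensityᵥ hy
  have hfin : IsFiniteMeasure
      ((volume.restrict Ω).withDensityᵥ (fun x => c • z.snd x)).variation := by
    rw [hvar]
    exact ⟨by simpa using! hy.2⟩
  have hfin2 := isFiniteMeasure_variation h1 h2
  refine (isDerivMeasure_iff hu).2 ⟨?_, ?_, fun Φ => ?_⟩
  · refine le_antisymm ((hle _).trans ?_) zero_le
    rw [Measure.add_apply, h1, add_zero, hvar]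
    refine le_of_eq (withDensity_absolutelyContinuous _ _ ?_)
    rw [Measure.restrict_apply hΩm.compl]
    simp
  · refine (hle _).trans_lt ?_
    rw [Measure.add_apply]
    exact ENNReal.add_lt_top.2 ⟨measure_lt_top _ _, h2⟩
  · obtain ⟨C, hC⟩ := TestFunction.exists_bound Φ
    rw [VectorMeasure.integral_sub_vectorMeasure
      (Integrable.of_bound Φ.continuous.aestronglyMeasurable C (.of_forall hC))
      (Integrable.of_bound Φ.continuous.aestronglyMeasurable C (.of_forall hC)), h3,
      TestFunction.integral_withDensityᵥ Φ hy, fieldPairing_apply,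
      inner_divToLp z.fst (ae_eq_refl _)]
    simp only [inner_smul_right]
    rw [integral_const_mul, integral_inner_eq_inner_testToLp]
    ring

/-- Bounded pairings are represented by a vector measure and an `L²` gradient, so the dual
constraint bounds the actual energy. Positivity of `β` is essential: for `β = 0` the constraint
would not force `BV`. -/
lemma denoisingEnergy_le_of_mem_denoisingEpigraph
    (hΩ : volume (Ω : Set (EuclideanSpace ℝ (Fin n))) ≠ ∞)
    {f : EuclideanSpace ℝ (Fin n) → ℝ} (hf : MemLp f 2 (volume.restrict Ω)) {γ : ℝ≥0∞}
    (hγ : γ ≠ 0) {μ β : ℝ≥0} (hβ : 0 < β) {p : L2Pair Ω × ℝ}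
    (hp : p ∈ denoisingEpigraph Ω (huberScale γ / √β) β μ) :
    (p.1.fst : EuclideanSpace ℝ (Fin n) → ℝ) ∈ BV Ω ∧
      denoisingEnergy Ω f γ μ β p.1.fst ≤
        ENNReal.ofReal (‖p.1 - WithLp.toLp 2 (hf.toLp f, 0)‖ ^ 2 / 2 + p.2) := by
  obtain ⟨z, t⟩ := p
  have hfin : IsFiniteMeasure (volume.restrict (Ω : Set (EuclideanSpace ℝ (Fin n)))) :=
    ⟨by simpa using hΩ.lt_top⟩
  have hβ' : (0 : ℝ) < β := hβ
  have hu : IntegrableOn z.fst (Ω : Set (EuclideanSpace ℝ (Fin n))) :=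
    (Lp.memLp z.fst).integrable one_le_two
  set c : ℝ := huberScale γ / √β with hc
  let S₁ : Set ℝ := {r | ∃ Φ : TestFunction Ω (EuclideanSpace ℝ (Fin n)) ⊤, (∀ x, ‖Φ x‖ ≤ 1) ∧
    r = fieldPairing c z Φ}
  let S₂ : Set ℝ := {r | ∃ Φ : TestFunction Ω (EuclideanSpace ℝ (Fin n)) ⊤,
    r = √μ * inner ℝ z.fst (divToLp Ω Φ) - ‖testToLp Ω (volume.restrict Ω) Φ‖ ^ 2 / 2}
  have hS₁0 : 0 ∈ S₁ := ⟨0, fun x => by simp, by simp⟩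
  have hS₂0 : 0 ∈ S₂ := ⟨0, by simp⟩
  -- The two test fields vary independently, so the joint constraint splits into a bound for `β sup
  -- S₁ + sup S₂`; these suprema stand for `|Du - c y|(Ω)` and `(μ/2)‖∇u‖²`.
  have hsum : ∀ r ∈ S₁, ∀ s ∈ S₂, β * r + s ≤ t := by
    rintro _ ⟨Φ₁, h, rfl⟩ _ ⟨Φ₂, rfl⟩
    exact hp Φ₁ Φ₂ h
  have hS₁ : BddAbove S₁ := ⟨t / β, fun r hr => by
    rw [le_div_iff₀' hβ']
    simpa using hsum r hr 0 hS₂0⟩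
  have hS₂ : BddAbove S₂ := ⟨t, fun s hs => by simpa using hsum 0 hS₁0 s hs⟩
  set M₁ := sSup S₁ with hM₁
  set M₂ := sSup S₂ with hM₂
  have hM₁0 : 0 ≤ M₁ := le_csSup hS₁ hS₁0
  have hM₂0 : 0 ≤ M₂ := le_csSup hS₂ hS₂0
  have hMt : β * M₁ + M₂ ≤ t := by
    have h1 : ∀ r ∈ S₁, β * r + M₂ ≤ t := fun r hr => by
      have : M₂ ≤ t - β * r := csSup_le ⟨0, hS₂0⟩ fun s hs => by linarith [hsum r hr s hs]
      linarith
    have : M₁ ≤ (t - M₂) / β := csSup_le ⟨0, hS₁0⟩ fun r hr => by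
      rw [le_div_iff₀' hβ']
      linarith [h1 r hr]
    rw [le_div_iff₀' hβ'] at this
    linarith
  obtain ⟨ν, hν1, hν2, hν3⟩ := exists_vectorMeasure_representation (fieldPairing c z) hM₁0
    fun Φ hΦ => le_csSup hS₁ ⟨Φ, hΦ, rfl⟩
  have hD := isDerivMeasure_of_fieldPairing hν1 (hν2.trans_lt ENNReal.ofReal_lt_top) hν3
  refine ⟨⟨hu, _, hD⟩, ?_⟩
  have hβs : (0 : ℝ) < √β := Real.sqrt_pos.2 hβ'
  have hhuber : β * huberMeasure γ (D Ω z.fst) Ω ≤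
      ENNReal.ofReal (β * M₁ + ‖z.snd‖ ^ 2 / 2) := by
    -- The second component of a pair is `√β` times the Huber field, so that the quadratic cost `β ·
    -- ½|y|²` becomes half a squared distance in the pair space.
    have hy : MemLp (fun x => (√(β : ℝ))⁻¹ • z.snd x) 2
        (volume.restrict (Ω : Set (EuclideanSpace ℝ (Fin n)))) :=
      (Lp.memLp z.snd).const_smul (√(β : ℝ))⁻¹
    have h1 := huberMeasure_le hγ (D Ω z.fst) (Ω := Ω) (hy.integrable one_le_two)
    have h2 : (fun x => huberScale γ • (√(β : ℝ))⁻¹ • z.snd x) = fun x => c • z.snd x := by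
      ext1 x
      rw [smul_smul, hc, div_eq_mul_inv]
    have h3 : eLpNorm (fun x => (√(β : ℝ))⁻¹ • z.snd x) 2
        (volume.restrict (Ω : Set (EuclideanSpace ℝ (Fin n)))) =
        ENNReal.ofReal ((√(β : ℝ))⁻¹ * ‖z.snd‖) := by
      rw [ENNReal.ofReal_mul (by positivity), Lp.norm_def,
        ENNReal.ofReal_toReal (Lp.eLpNorm_ne_top _)]
      have := eLpNorm_const_smul (√(β : ℝ))⁻¹ z.snd 2
        (volume.restrict (Ω : Set (EuclideanSpace ℝ (Fin n))))
      rw [← ofReal_norm, Real.norm_of_nonneg (by positivity)] at this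
      exact this
    rw [h2, h3, hD.D_eq, sub_sub_cancel_left, VectorMeasure.variation_neg,
      ← ENNReal.ofReal_pow (by positivity)] at h1
    have h4 : ENNReal.ofReal (((√(β : ℝ))⁻¹ * ‖z.snd‖) ^ 2) / 2 =
        ENNReal.ofReal (((√(β : ℝ))⁻¹ * ‖z.snd‖) ^ 2 / 2) := by
      rw [ENNReal.ofReal_div_of_pos two_pos, ENNReal.ofReal_ofNat]
    rw [h4] at h1
    have h5 : (β : ℝ≥0∞) = ENNReal.ofReal β := by simp
    rw [hD.D_eq]
    refine (mul_le_mul_right (h1.trans (add_le_add_left hν2 _)) _).trans_eq ?_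
    rw [h5, ← ENNReal.ofReal_add hM₁0 (by positivity), ← ENNReal.ofReal_mul hβ'.le]
    congr 1
    rw [mul_pow, inv_pow, Real.sq_sqrt hβ'.le]
    field_simp
  have hgrad : (μ : ℝ≥0∞) / 2 * gradNormSq Ω z.fst ≤ ENNReal.ofReal M₂ := by
    rcases eq_or_ne μ 0 with rfl | hμ
    · simp
    have hμ' : (0 : ℝ) < μ := lt_of_le_of_ne μ.2 fun h => hμ (by ext; exact h.symm)
    have hμs : (0 : ℝ) < √μ := Real.sqrt_pos.2 hμ'
    obtain ⟨g, hg, hg2⟩ := exists_L2_representation (volume.restrict Ω)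
      (√(μ : ℝ) • (innerₛₗ ℝ z.fst) ∘ₗ divToLp Ω) (Real.sqrt_nonneg (2 * M₂)) fun Φ => by
        refine le_sqrt_mul_of_forall_smul (norm_nonneg _) fun s => ?_
        have := le_csSup hS₂ ⟨s • Φ, rfl⟩
        rw [map_smul, map_smul, norm_smul, inner_smul_right, mul_pow, Real.norm_eq_abs, sq_abs]
          at this
        refine le_trans (le_of_eq ?_) this
        simp only [LinearMap.smul_apply, LinearMap.comp_apply, innerₛₗ_apply_apply, smul_eq_mul]
        ring
    have hgm : MemLp (fun x => -(√(μ : ℝ))⁻¹ • g x) 2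
        (volume.restrict (Ω : Set (EuclideanSpace ℝ (Fin n)))) :=
      (Lp.memLp g).const_smul (-(√(μ : ℝ))⁻¹)
    have h1 := gradNormSq_le hu hgm fun Φ => by
      have h2 := hg2 Φ
      simp only [inner_smul_right]
      rw [integral_const_mul, integral_inner_eq_inner_testToLp, ← h2,
        ← inner_divToLp z.fst (ae_eq_refl _)]
      simp only [LinearMap.smul_apply, LinearMap.comp_apply, innerₛₗ_apply_apply, smul_eq_mul]
      field_simp
    have h3 : eLpNorm (fun x => -(√(μ : ℝ))⁻¹ • g x) 2
        (volume.restrict (Ω : Set (EuclideanSpace ℝ (Fin n)))) =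
        ENNReal.ofReal ((√(μ : ℝ))⁻¹ * ‖g‖) := by
      rw [ENNReal.ofReal_mul (by positivity), Lp.norm_def,
        ENNReal.ofReal_toReal (Lp.eLpNorm_ne_top _)]
      have := eLpNorm_const_smul (-(√(μ : ℝ))⁻¹) g 2
        (volume.restrict (Ω : Set (EuclideanSpace ℝ (Fin n))))
      rw [← ofReal_norm, norm_neg, Real.norm_of_nonneg (by positivity)] at this
      exact this
    have h5 : (μ : ℝ≥0∞) / 2 = ENNReal.ofReal ((μ : ℝ) / 2) := by
      rw [ENNReal.ofReal_div_of_pos two_pos]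
      simp
    rw [h3, ← ENNReal.ofReal_pow (by positivity)] at h1
    refine (mul_le_mul_right h1 _).trans ?_
    rw [h5, ← ENNReal.ofReal_mul (by positivity)]
    refine ENNReal.ofReal_le_ofReal ?_
    have h6 : ‖g‖ ^ 2 ≤ 2 * M₂ := by
      refine (pow_le_pow_left₀ (norm_nonneg _) hg 2).trans_eq ?_
      rw [Real.sq_sqrt (by positivity)]
    rw [mul_pow, inv_pow, Real.sq_sqrt hμ'.le]
    field_simp
    linarith
  have hdist : halfSqDist Ω f z.fst = ENNReal.ofReal (‖z.fst - hf.toLp f‖ ^ 2 / 2) := by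
    rw [halfSqDist_eq hf (Lp.memLp z.fst), Lp.toLp_coeFn, norm_sub_rev]
  rw [denoisingEnergy, hdist, WithLp.prod_norm_sq_eq_of_L2]
  simp only [WithLp.sub_fst, WithLp.sub_snd, WithLp.toLp_fst, WithLp.toLp_snd, sub_zero]
  refine (add_le_add (add_le_add_right hhuber _) hgrad).trans ?_
  rw [← ENNReal.ofReal_add (by positivity) (by positivity),
    ← ENNReal.ofReal_add (by positivity) (by positivity)]
  refine ENNReal.ofReal_le_ofReal ?_
  linarith

/-- The converse: the optimal Huber field lifts a function of finite energy to a pair without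
raising the energy, so minimality among pairs descends to functions. -/
lemma exists_mem_denoisingEpigraph
    (hΩ : volume (Ω : Set (EuclideanSpace ℝ (Fin n))) ≠ ∞)
    {f : EuclideanSpace ℝ (Fin n) → ℝ} (hf : MemLp f 2 (volume.restrict Ω)) {γ : ℝ≥0∞}
    (hγ : γ ≠ 0) {μ β : ℝ≥0} (hβ : 0 < β) {w : EuclideanSpace ℝ (Fin n) → ℝ} (hw : w ∈ BV Ω)
    (hw2 : MemLp w 2 (volume.restrict Ω)) (hE : denoisingEnergy Ω f γ μ β w < ∞) :
    ∃ p ∈ denoisingEpigraph Ω (huberScale γ / √β) β μ, p.1.fst = hw2.toLp w ∧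
      ENNReal.ofReal (‖p.1 - WithLp.toLp 2 (hf.toLp f, 0)‖ ^ 2 / 2 + p.2) ≤
        denoisingEnergy Ω f γ μ β w := by
  have hfin : IsFiniteMeasure (volume.restrict (Ω : Set (EuclideanSpace ℝ (Fin n)))) :=
    ⟨by simpa using hΩ.lt_top⟩
  have hβ' : (0 : ℝ) < β := hβ
  have hβs : (0 : ℝ) < √β := Real.sqrt_pos.2 hβ'
  have hD := (isDerivMeasure_iff hw.1).1 (isDerivMeasure_D hw)
  have hfinD := isFiniteMeasure_variation hD.1 hD.2.1
  obtain ⟨y, hy2, hy⟩ := exists_le_huberMeasure hΩ hγ (D Ω w)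
  have hyi : Integrable (fun x => huberScale γ • y x)
      (volume.restrict (Ω : Set (EuclideanSpace ℝ (Fin n)))) :=
    (hy2.integrable one_le_two).fun_smul _
  set τ := D Ω w - (volume.restrict Ω).withDensityᵥ (fun x => huberScale γ • y x) with hτ
  have hle : τ.variation ≤ (D Ω w).variation +
    ((volume.restrict Ω).withDensityᵥ (fun x => huberScale γ • y x)).variation :=
    VectorMeasure.variation_sub_le
  have hvar := Measure.variation_withDensityᵥ hyi
  have hfiny : IsFiniteMeasure
      ((volume.restrict Ω).withDensityᵥ (fun x => huberScale γ • y x)).variation := by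
    rw [hvar]
    exact ⟨by simpa using! hyi.2⟩
  have hτ1 : τ.variation (Ω : Set (EuclideanSpace ℝ (Fin n)))ᶜ = 0 := by
    refine le_antisymm ((hle _).trans ?_) zero_le
    rw [Measure.add_apply, hD.1, zero_add, hvar]
    refine le_of_eq (withDensity_absolutelyContinuous _ _ ?_)
    rw [Measure.restrict_apply Ω.isOpen.measurableSet.compl]
    simp
  have hτ2 : τ.variation Ω < ∞ := by
    refine (hle _).trans_lt ?_
    rw [Measure.add_apply]
    exact ENNReal.add_lt_top.2 ⟨hD.2.1, measure_lt_top _ _⟩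
  have hμg : (μ : ℝ≥0∞) / 2 * gradNormSq Ω w ≠ ∞ := fun h => by
    rw [denoisingEnergy, h] at hE
    simp at hE
  set V := (τ.variation Ω).toReal with hV
  set m := ((μ : ℝ≥0∞) / 2 * gradNormSq Ω w).toReal with hm
  have hV0 : 0 ≤ V := ENNReal.toReal_nonneg
  have hm0 : 0 ≤ m := ENNReal.toReal_nonneg
  refine ⟨(WithLp.toLp 2 (hw2.toLp w, √(β : ℝ) • hy2.toLp y), β * V + m), ?_, rfl, ?_⟩
  · intro Φ₁ Φ₂ hΦ
    have h1 := TestFunction.integral_le_variation Φ₁ hΦ hτ1 hτ2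
    obtain ⟨C, hC⟩ := TestFunction.exists_bound Φ₁
    rw [hτ, VectorMeasure.integral_sub_vectorMeasure
      (Integrable.of_bound Φ₁.continuous.aestronglyMeasurable C (.of_forall hC))
      (Integrable.of_bound Φ₁.continuous.aestronglyMeasurable C (.of_forall hC)),
      TestFunction.integral_withDensityᵥ Φ₁ hyi] at h1
    simp only [inner_smul_right] at h1
    have h2 : ∫ x in Ω, inner ℝ (Φ₁ x) (y x) =
        inner ℝ (hy2.toLp y) (testToLp Ω (volume.restrict Ω) Φ₁) := by
      rw [← integral_inner_eq_inner_testToLp]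
      refine integral_congr_ae ?_
      filter_upwards [hy2.coeFn_toLp] with x hx
      rw [hx]
    rw [integral_const_mul, h2] at h1
    have h3 := sqrt_mul_divPairing_sub_le hw.1 μ Φ₂
    rw [ENNReal.ofReal_le_iff_le_toReal hμg] at h3
    have h4 : fieldPairing (huberScale γ / √(β : ℝ))
        (WithLp.toLp 2 (hw2.toLp w, √(β : ℝ) • hy2.toLp y)) Φ₁ ≤ V := by
      rw [fieldPairing_apply]
      simp only [WithLp.toLp_fst, WithLp.toLp_snd]
      rw [inner_divToLp _ hw2.coeFn_toLp, hD.2.2 Φ₁, real_inner_smul_left, ← mul_assoc,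
        div_mul_cancel₀ _ hβs.ne']
      linarith [neg_le_of_abs_le h1]
    have h5 := mul_le_mul_of_nonneg_left h4 hβ'.le
    dsimp only
    rw [WithLp.toLp_fst, inner_divToLp _ hw2.coeFn_toLp]
    linarith
  · rw [denoisingEnergy, halfSqDist_eq hf hw2, WithLp.prod_norm_sq_eq_of_L2]
    simp only [WithLp.sub_fst, WithLp.sub_snd, WithLp.toLp_fst, WithLp.toLp_snd, sub_zero]
    have h6 : eLpNorm y 2 (volume.restrict (Ω : Set (EuclideanSpace ℝ (Fin n)))) =
        ENNReal.ofReal ‖hy2.toLp y‖ := by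
      rw [Lp.norm_toLp, ENNReal.ofReal_toReal hy2.eLpNorm_ne_top]
    have h7 : ENNReal.ofReal (β * V + ‖√(β : ℝ) • hy2.toLp y‖ ^ 2 / 2) ≤
        β * huberMeasure γ (D Ω w) Ω := by
      refine le_trans (le_of_eq ?_) (mul_le_mul_right hy _)
      have h8 : τ.variation Ω = ENNReal.ofReal V := (ENNReal.ofReal_toReal hτ2.ne).symm
      have h5 : (β : ℝ≥0∞) = ENNReal.ofReal β := by simp
      have h9 : ENNReal.ofReal (‖hy2.toLp y‖ ^ 2) / 2 = ENNReal.ofReal (‖hy2.toLp y‖ ^ 2 / 2) := by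
        rw [ENNReal.ofReal_div_of_pos two_pos, ENNReal.ofReal_ofNat]
      rw [h8, h6, ← ENNReal.ofReal_pow (norm_nonneg _), h9,
        ← ENNReal.ofReal_add hV0 (by positivity), h5, ← ENNReal.ofReal_mul hβ'.le, norm_smul, mul_pow,
        Real.norm_of_nonneg hβs.le, Real.sq_sqrt hβ'.le]
      congr 1
      ring
    have h10 : ENNReal.ofReal m = (μ : ℝ≥0∞) / 2 * gradNormSq Ω w := ENNReal.ofReal_toReal hμg
    rw [← h10]
    refine le_trans (le_of_eq ?_) (add_le_add_left (add_le_add_right h7 _) _)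
    rw [← ENNReal.ofReal_add (by positivity) (by positivity),
      ← ENNReal.ofReal_add (by positivity) (by positivity), norm_sub_rev]
    congr 1
    ring

/-- Existence of a minimiser of the denoising functional, with quadratic growth. -/
lemma exists_strong_denoised
    (hΩ : volume (Ω : Set (EuclideanSpace ℝ (Fin n))) ≠ ∞)
    {f : EuclideanSpace ℝ (Fin n) → ℝ} (hf : MemLp f 2 (volume.restrict Ω)) {γ : ℝ≥0∞}
    (hγ : γ ≠ 0) (μ : ℝ≥0) {β : ℝ≥0} (hβ : 0 < β) :
    ∃ u ∈ BV Ω, MemLp u 2 (volume.restrict Ω) ∧ ∀ w ∈ BV Ω,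
      denoisingEnergy Ω f γ μ β u + halfSqDist Ω u w ≤ denoisingEnergy Ω f γ μ β w := by
  obtain ⟨p, hp, hmin⟩ := exists_strong_minimiser
    (isClosed_denoisingEpigraph (huberScale γ / √β) β μ)
    (convex_denoisingEpigraph _ _ _) (nonempty_denoisingEpigraph _ _ _)
    (fun _ => nonneg_of_mem_denoisingEpigraph) (WithLp.toLp 2 (hf.toLp f, 0) : L2Pair Ω)
  obtain ⟨hBV, hle⟩ := denoisingEnergy_le_of_mem_denoisingEpigraph hΩ hf hγ hβ hp
  refine ⟨_, hBV, Lp.memLp _, fun w hw => ?_⟩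
  rcases eq_or_ne (denoisingEnergy Ω f γ μ β w) ∞ with hE | hE
  · rw [hE]; exact le_top
  have hw2 : MemLp w 2 (volume.restrict (Ω : Set (EuclideanSpace ℝ (Fin n)))) := by
    refine memLp_of_halfSqDist_lt_top hf hw.1 (lt_of_le_of_lt ?_ hE.lt_top)
    rw [denoisingEnergy, add_assoc]
    exact le_self_add
  obtain ⟨q, hq, hq1, hq2⟩ := exists_mem_denoisingEpigraph hΩ hf hγ hβ hw hw2 hE.lt_top
  refine le_trans ?_ ((ENNReal.ofReal_le_ofReal (hmin q hq)).trans hq2)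
  have hp0 := nonneg_of_mem_denoisingEpigraph hp
  rw [ENNReal.ofReal_add (by positivity) (by positivity)]
  refine add_le_add hle ?_
  rw [halfSqDist_eq (Lp.memLp _) hw2, Lp.toLp_coeFn, ← hq1]
  refine ENNReal.ofReal_le_ofReal ?_
  -- The distance of pairs dominates that of their first components, so quadratic growth passes to
  -- the functions.
  have := WithLp.prod_norm_sq_eq_of_L2 (p.1 - q.1)
  rw [this, WithLp.sub_fst]
  have h0 : 0 ≤ ‖(p.1 - q.1).snd‖ ^ 2 := by positivity
  linarith

end Energy

end TVDenoising


namespace TVDenoising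

/-! ### Mollification in `L²` with off-centre kernels -/

section Mollification

open scoped Convolution

variable {n : ℕ} {V : Type*} [NormedAddCommGroup V]

lemma tendsto_eLpNorm_translate_sub {G : EuclideanSpace ℝ (Fin n) → V} (hG : MemLp G 2) :
    Filter.Tendsto (fun s => eLpNorm (fun x => G (x - s) - G x) 2) (𝓝 0) (𝓝 0) := by
  have hmp : ∀ s : EuclideanSpace ℝ (Fin n), MeasurePreserving
      (⟨fun x => x - s, by fun_prop⟩ : C(EuclideanSpace ℝ (Fin n), EuclideanSpace ℝ (Fin n))) :=
    fun s => measurePreserving_sub_right volume s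
  have hg : Continuous fun s : EuclideanSpace ℝ (Fin n) =>
      (⟨fun x => x - s, by fun_prop⟩ :
        C(EuclideanSpace ℝ (Fin n), EuclideanSpace ℝ (Fin n))) :=
    ContinuousMap.continuous_of_continuous_uncurry _ (by
      change Continuous fun p : EuclideanSpace ℝ (Fin n) × EuclideanSpace ℝ (Fin n) => p.2 - p.1
      fun_prop)
  have hc := (continuous_const (y := hG.toLp G)).compMeasurePreservingLp hg hmp (by simp)
  have h0 : Lp.compMeasurePreserving _ (hmp 0) (hG.toLp G) = hG.toLp G := by
    rw [Lp.toLp_compMeasurePreserving]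
    exact MemLp.toLp_congr _ _ (.of_forall fun x => by simp)
  have h1 := ((hc.tendsto 0).sub_const (hG.toLp G)).enorm
  rw [h0, sub_self, enorm_zero] at h1
  refine h1.congr fun s => ?_
  rw [Lp.toLp_compMeasurePreserving, ← MemLp.toLp_sub, Lp.enorm_toLp]
  rfl

variable [NormedSpace ℝ V]

/-- Averaging a function against translations in the support of a probability density `κ` moves it
in `L²` by at most the largest distance to one of these translates. -/
lemma eLpNorm_convolution_sub_le [CompleteSpace V] {κ : EuclideanSpace ℝ (Fin n) → ℝ}
    (hκ : Continuous κ) (hκc : HasCompactSupport κ) (hκ0 : ∀ s, 0 ≤ κ s) (hκ1 : ∫ s, κ s = 1)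
    {G : EuclideanSpace ℝ (Fin n) → V} (hG : MemLp G 2) {ε : ℝ≥0∞}
    (hε : ∀ s, κ s ≠ 0 → eLpNorm (fun x => G (x - s) - G x) 2 ≤ ε) :
    eLpNorm (fun x => (κ ⋆[ContinuousLinearMap.lsmul ℝ ℝ] G) x - G x) 2 ≤ ε := by
  have hκi : Integrable κ := hκ.integrable_of_hasCompactSupport hκc
  set P : Measure (EuclideanSpace ℝ (Fin n)) :=
    volume.withDensity fun s => ENNReal.ofReal (κ s) with hP
  have hκm : Measurable fun s => ENNReal.ofReal (κ s) := hκ.measurable.ennreal_ofReal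
  have : IsProbabilityMeasure P := ⟨by
    rw [hP, withDensity_apply _ .univ, Measure.restrict_univ,
      ← ofReal_integral_eq_lintegral_ofReal hκi (.of_forall hκ0), hκ1, ENNReal.ofReal_one]⟩
  have hPac : P ≪ volume := withDensity_absolutelyContinuous _ _
  have hGm := hG.aestronglyMeasurable
  have hmeas : AEStronglyMeasurable
      (fun p : EuclideanSpace ℝ (Fin n) × EuclideanSpace ℝ (Fin n) => G (p.1 - p.2) - G p.1)
      (volume.prod P) :=
    (hGm.comp_quasiMeasurePreserving
      (quasiMeasurePreserving_sub_of_right_invariant volume P)).sub hGm.comp_fst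
  have hpt : ∀ᵐ x, ‖(κ ⋆[ContinuousLinearMap.lsmul ℝ ℝ] G) x - G x‖ₑ ^ 2 ≤
      ∫⁻ s, ‖G (x - s) - G x‖ₑ ^ 2 ∂P := by
    filter_upwards [hmeas.prodMk_left] with x hx
    have hex : Integrable fun s => κ s • G (x - s) :=
      hκc.convolutionExists_left (ContinuousLinearMap.lsmul ℝ ℝ) hκ
        (hG.locallyIntegrable one_le_two) x
    have h1 : (κ ⋆[ContinuousLinearMap.lsmul ℝ ℝ] G) x - G x =
        ∫ s, κ s • (G (x - s) - G x) := by
      simp only [smul_sub]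
      rw [integral_sub hex (hκi.smul_const _), integral_smul_const, hκ1, one_smul]
      rfl
    -- Under the probability measure `κ ds` the `L¹` norm is at most the `L²` norm, so the square
    -- moves inside the average; Tonelli then reduces the claim to single translates.
    have h2 : ‖∫ s, κ s • (G (x - s) - G x)‖ₑ ≤ eLpNorm (fun s => G (x - s) - G x) 1 P := by
      refine (enorm_integral_le_lintegral_enorm _).trans_eq ?_
      rw [eLpNorm_one_eq_lintegral_enorm, hP, lintegral_withDensity_eq_lintegral_mul₀'
        hκm.aemeasurable (by simpa using hx.enorm)]
      refine lintegral_congr fun s => ?_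
      rw [enorm_smul, Pi.mul_apply, Real.enorm_of_nonneg (hκ0 s)]
    rw [h1, ← eLpNorm_two_sq]
    gcongr
    exact h2.trans (eLpNorm_le_eLpNorm_of_exponent_le one_le_two hx)
  rw [← ENNReal.pow_le_pow_left_iff two_ne_zero, eLpNorm_two_sq]
  refine (lintegral_mono_ae hpt).trans ?_
  rw [lintegral_lintegral_swap (hmeas.enorm.pow_const 2)]
  have h3 : ∀ᵐ s ∂P, ∫⁻ x, ‖G (x - s) - G x‖ₑ ^ 2 ≤ ε ^ 2 := by
    rw [hP, ae_withDensity_iff hκm]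
    refine .of_forall fun s hs => ?_
    rw [← eLpNorm_two_sq]
    gcongr
    exact hε s fun h => hs (by simp [h])
  refine (lintegral_mono_ae h3).trans ?_
  simp

end Mollification

end TVDenoising


namespace TVDenoising

/-! ### Adjoint mollification of test fields -/

section SmoothedFields

open scoped Convolution Pointwise

variable {n : ℕ} {Ω : Opens (EuclideanSpace ℝ (Fin n))}

lemma convolution_reflect_apply {V : Type*} [NormedAddCommGroup V] [NormedSpace ℝ V]
    (κ : EuclideanSpace ℝ (Fin n) → ℝ) (φ : EuclideanSpace ℝ (Fin n) → V)
    (y : EuclideanSpace ℝ (Fin n)) :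
    ((fun s => κ (-s)) ⋆[ContinuousLinearMap.lsmul ℝ ℝ] φ) y = ∫ s, κ s • φ (y + s) := by
  rw [← integral_neg_eq_self]
  simp [convolution, sub_eq_add_neg]

/-- The adjoint of the convolution with `κ` is the convolution with the reflection of `κ`. -/
lemma integral_inner_convolution {V : Type*} [NormedAddCommGroup V] [InnerProductSpace ℝ V]
    [CompleteSpace V] {κ : EuclideanSpace ℝ (Fin n) → ℝ} (hκ : Continuous κ)
    (hκc : HasCompactSupport κ) {G φ : EuclideanSpace ℝ (Fin n) → V} (hG : Integrable G)
    (hφ : Continuous φ) (hφc : HasCompactSupport φ) :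
    ∫ x, inner ℝ ((κ ⋆[ContinuousLinearMap.lsmul ℝ ℝ] G) x) (φ x) =
      ∫ y, inner ℝ (G y) (((fun s => κ (-s)) ⋆[ContinuousLinearMap.lsmul ℝ ℝ] φ) y) := by
  have hκi : Integrable κ := hκ.integrable_of_hasCompactSupport hκc
  obtain ⟨C, hC⟩ := hφ.bounded_above_of_compact_support hφc
  have h1 : ∀ x, inner ℝ ((κ ⋆[ContinuousLinearMap.lsmul ℝ ℝ] G) x) (φ x) =
      ∫ s, inner ℝ (φ x) (κ s • G (x - s)) := fun x => by
    rw [real_inner_comm, integral_inner]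
    · rfl
    · exact hκc.convolutionExists_left (ContinuousLinearMap.lsmul ℝ ℝ) hκ hG.locallyIntegrable x
  have h2 : ∀ y, inner ℝ (G y) (((fun s => κ (-s)) ⋆[ContinuousLinearMap.lsmul ℝ ℝ] φ) y) =
      ∫ s, inner ℝ (φ (y + s)) (κ s • G y) := fun y => by
    rw [convolution_reflect_apply, ← integral_inner]
    · refine integral_congr_ae (.of_forall fun s => ?_)
      simp only [inner_smul_right, real_inner_comm]
    · exact (hκ.smul (hφ.comp (continuous_const.add continuous_id))).integrable_of_hasCompactSupport
        (hκc.smul_right)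
  have h3 : Integrable (fun p : EuclideanSpace ℝ (Fin n) × EuclideanSpace ℝ (Fin n) =>
      inner ℝ (φ p.1) (κ p.2 • G (p.1 - p.2))) (volume.prod volume) :=
    integrable_inner_of_bdd (Φ := fun p : EuclideanSpace ℝ (Fin n) × EuclideanSpace ℝ (Fin n) =>
      φ p.1) (by fun_prop) (fun p => hC p.1)
      (hκi.convolution_integrand (ContinuousLinearMap.lsmul ℝ ℝ) hG)
  have h4 : Integrable (fun p : EuclideanSpace ℝ (Fin n) × EuclideanSpace ℝ (Fin n) =>
      inner ℝ (φ (p.2 + p.1)) (κ p.1 • G p.2)) (volume.prod volume) :=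
    integrable_inner_of_bdd (Φ := fun p : EuclideanSpace ℝ (Fin n) × EuclideanSpace ℝ (Fin n) =>
      φ (p.2 + p.1)) (by fun_prop) (fun p => hC _) (hκi.smul_prod hG)
  simp only [h1, h2]
  rw [integral_integral_swap h3, integral_integral_swap
    (f := fun y s => inner ℝ (φ (y + s)) (κ s • G y)) h4.swap]
  refine integral_congr_ae (.of_forall fun s => ?_)
  simp only
  rw [← integral_sub_right_eq_self (fun y => inner ℝ (φ (y + s)) (κ s • G y)) s]
  simp

lemma divergence_convolution {κ : EuclideanSpace ℝ (Fin n) → ℝ} (hκ : Continuous κ)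
    {Φ : EuclideanSpace ℝ (Fin n) → EuclideanSpace ℝ (Fin n)} (hΦ : ContDiff ℝ (⊤ : ℕ∞) Φ)
    (hΦc : HasCompactSupport Φ) (x : EuclideanSpace ℝ (Fin n)) :
    divergence (κ ⋆[ContinuousLinearMap.lsmul ℝ ℝ] Φ) x =
      (κ ⋆[ContinuousLinearMap.lsmul ℝ ℝ] divergence Φ) x := by
  have hd := hΦ.continuous_fderiv (by simp)
  have h1 := (hΦc.hasFDerivAt_convolution_right (ContinuousLinearMap.lsmul ℝ ℝ)
    (μ := volume) hκ.locallyIntegrable (hΦ.of_le (by simp)) x).fderiv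
  have h2 : ∀ i : Fin n, Integrable fun s =>
      κ s • fderiv ℝ Φ (x - s) (EuclideanSpace.single i 1) := fun i =>
    (hΦc.fderiv_apply ℝ _).convolutionExists_right (ContinuousLinearMap.lsmul ℝ ℝ)
      hκ.locallyIntegrable (hd.clm_apply continuous_const) x
  have h3 : ∀ i : Fin n, Integrable fun s =>
      κ s * fderiv ℝ Φ (x - s) (EuclideanSpace.single i 1) i := fun i => by
    simpa using (EuclideanSpace.proj i : EuclideanSpace ℝ (Fin n) →L[ℝ] ℝ).integrable_comp (h2 i)
  simp only [divergence, h1, convolution_precompR_apply (ContinuousLinearMap.lsmul ℝ ℝ)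
    hκ.locallyIntegrable (hΦc.fderiv ℝ) hd]
  simp only [convolution, ContinuousLinearMap.lsmul_apply, smul_eq_mul, divergence,
    Finset.mul_sum]
  rw [integral_finsetSum _ fun i _ => h3 i]
  refine Finset.sum_congr rfl fun i _ => ?_
  rw [integral_apply (h2 i)]
  simp

lemma norm_convolution_reflect_le {κ : EuclideanSpace ℝ (Fin n) → ℝ} (hκ0 : ∀ s, 0 ≤ κ s)
    (hκi : Integrable κ) (hκ1 : ∫ s, κ s = 1) {V : Type*} [NormedAddCommGroup V] [NormedSpace ℝ V]
    {φ : EuclideanSpace ℝ (Fin n) → V} (hφ : ∀ x, ‖φ x‖ ≤ 1) (y : EuclideanSpace ℝ (Fin n)) :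
    ‖((fun s => κ (-s)) ⋆[ContinuousLinearMap.lsmul ℝ ℝ] φ) y‖ ≤ 1 := by
  rw [convolution_reflect_apply, ← hκ1]
  refine norm_integral_le_of_norm_le hκi (.of_forall fun s => ?_)
  rw [norm_smul, Real.norm_of_nonneg (hκ0 s)]
  exact mul_le_of_le_one_right (hκ0 s) (hφ _)

lemma tsupport_convolution_reflect_subset {κ : EuclideanSpace ℝ (Fin n) → ℝ}
    (hκc : HasCompactSupport κ) {V : Type*} [NormedAddCommGroup V] [NormedSpace ℝ V]
    {φ : EuclideanSpace ℝ (Fin n) → V} (hφc : HasCompactSupport φ)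
    {y : EuclideanSpace ℝ (Fin n)}
    (hy : y ∈ tsupport ((fun s => κ (-s)) ⋆[ContinuousLinearMap.lsmul ℝ ℝ] φ)) :
    ∃ s ∈ tsupport κ, y + s ∈ tsupport φ := by
  have hκc' : HasCompactSupport fun s => κ (-s) := hκc.comp_homeomorph (Homeomorph.neg _)
  have h1 : y ∈ tsupport (fun s => κ (-s)) + tsupport φ :=
    closure_minimal ((support_convolution_subset _).trans
      (Set.add_subset_add (subset_tsupport _) (subset_tsupport _)))
      (IsCompact.add hκc' hφc).isClosed hy
  obtain ⟨a, ha, b, hb, rfl⟩ := Set.mem_add.1 h1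
  refine ⟨-a, tsupport_comp_subset_preimage κ continuous_neg ha, ?_⟩
  rwa [add_comm a b, add_neg_cancel_right]

lemma contDiff_convolution_reflect {κ : EuclideanSpace ℝ (Fin n) → ℝ} (hκ : Continuous κ)
    {V : Type*} [NormedAddCommGroup V] [NormedSpace ℝ V] {φ : EuclideanSpace ℝ (Fin n) → V}
    (hφ : ContDiff ℝ (⊤ : ℕ∞) φ) (hφc : HasCompactSupport φ) :
    ContDiff ℝ (⊤ : ℕ∞) ((fun s => κ (-s)) ⋆[ContinuousLinearMap.lsmul ℝ ℝ] φ) :=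
  hφc.contDiff_convolution_right (n := ⊤) (ContinuousLinearMap.lsmul ℝ ℝ)
    (hκ.comp continuous_neg).locallyIntegrable hφ

lemma hasCompactSupport_convolution_reflect {κ : EuclideanSpace ℝ (Fin n) → ℝ}
    (hκc : HasCompactSupport κ) {V : Type*} [NormedAddCommGroup V] [NormedSpace ℝ V]
    {φ : EuclideanSpace ℝ (Fin n) → V} (hφc : HasCompactSupport φ) :
    HasCompactSupport ((fun s => κ (-s)) ⋆[ContinuousLinearMap.lsmul ℝ ℝ] φ) :=
  HasCompactSupport.convolution (ContinuousLinearMap.lsmul ℝ ℝ)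
    (hκc.comp_homeomorph (Homeomorph.neg _)) hφc

lemma tsupport_smul_subset_inter {V : Type*} [NormedAddCommGroup V] [NormedSpace ℝ V]
    {ψ : EuclideanSpace ℝ (Fin n) → ℝ} {g : EuclideanSpace ℝ (Fin n) → V} :
    tsupport (fun y => ψ y • g y) ⊆ tsupport ψ ∩ tsupport g :=
  fun _ hy => ⟨closure_mono (Function.support_smul_subset_left ψ g) hy,
    closure_mono (Function.support_smul_subset_right ψ g) hy⟩

/-- The test field `ψ · (κ̌ ⋆ Φ)`, where `κ̌` is the reflection of `κ`. -/
noncomputable def smoothedField {ψ κ : EuclideanSpace ℝ (Fin n) → ℝ}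
    (hψ : ContDiff ℝ (⊤ : ℕ∞) ψ) (hκ : Continuous κ) (hκc : HasCompactSupport κ)
    (h : ∀ y ∈ tsupport ψ, ∀ s ∈ tsupport κ, y + s ∈ Ω → y ∈ Ω)
    (Φ : TestFunction Ω (EuclideanSpace ℝ (Fin n)) ⊤) :
    TestFunction Ω (EuclideanSpace ℝ (Fin n)) ⊤ where
  toFun y := ψ y • ((fun s => κ (-s)) ⋆[ContinuousLinearMap.lsmul ℝ ℝ] Φ) y
  contDiff' := ContDiff.smul (f := ψ)
    (g := (fun s => κ (-s)) ⋆[ContinuousLinearMap.lsmul ℝ ℝ] Φ) hψ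
    (contDiff_convolution_reflect hκ Φ.contDiff Φ.hasCompactSupport)
  hasCompactSupport' := HasCompactSupport.smul_left (f := ψ)
    (f' := (fun s => κ (-s)) ⋆[ContinuousLinearMap.lsmul ℝ ℝ] Φ)
    (hasCompactSupport_convolution_reflect hκc Φ.hasCompactSupport)
  tsupport_subset' := fun y hy => by
    have hy' := tsupport_smul_subset_inter
      (g := (fun s => κ (-s)) ⋆[ContinuousLinearMap.lsmul ℝ ℝ] Φ) hy
    obtain ⟨s, hs, hs'⟩ := tsupport_convolution_reflect_subset hκc Φ.hasCompactSupport hy'.2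
    exact h y hy'.1 s hs (Φ.tsupport_subset hs')

lemma divergence_smoothedField {ψ κ : EuclideanSpace ℝ (Fin n) → ℝ}
    (hψ : ContDiff ℝ (⊤ : ℕ∞) ψ) (hκ : Continuous κ) (hκc : HasCompactSupport κ)
    (h : ∀ y ∈ tsupport ψ, ∀ s ∈ tsupport κ, y + s ∈ Ω → y ∈ Ω)
    (Φ : TestFunction Ω (EuclideanSpace ℝ (Fin n)) ⊤) (y : EuclideanSpace ℝ (Fin n)) :
    divergence (smoothedField hψ hκ hκc h Φ) y =
      ψ y * ((fun s => κ (-s)) ⋆[ContinuousLinearMap.lsmul ℝ ℝ] divergence Φ) y +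
      inner ℝ (gradient ψ y) (((fun s => κ (-s)) ⋆[ContinuousLinearMap.lsmul ℝ ℝ] Φ) y) := by
  have hd : ContDiff ℝ (⊤ : ℕ∞) ((fun s => κ (-s)) ⋆[ContinuousLinearMap.lsmul ℝ ℝ] Φ) :=
    contDiff_convolution_reflect hκ Φ.contDiff Φ.hasCompactSupport
  rw [← divergence_convolution (κ := fun s => κ (-s)) (hκ.comp continuous_neg) Φ.contDiff
    Φ.hasCompactSupport]
  exact divergence_smul_fun (hψ.differentiable (by simp) y) (hd.differentiable (by simp) y)

lemma TestFunction.sum_apply {F : Type*} [NormedAddCommGroup F] [NormedSpace ℝ F] {ι : Type*}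
    (s : Finset ι) (Θ : ι → TestFunction Ω F ⊤) (x : EuclideanSpace ℝ (Fin n)) :
    (∑ i ∈ s, Θ i) x = ∑ i ∈ s, Θ i x := by
  induction s using Finset.cons_induction with
  | empty => rfl
  | cons a s ha ih =>
    rw [Finset.sum_cons, Finset.sum_cons, ← ih]
    rfl

end SmoothedFields

end TVDenoising


namespace TVDenoising

/-! ### Inward shifts at a Lipschitz boundary and the commutator estimate -/

section LocalSmoothing

open scoped Convolution

variable {n : ℕ} {Ω : Opens (EuclideanSpace ℝ (Fin n))}

/-- A convolution at `x` samples at `x - s`, so shifts `s` near `-t v` sample in the inward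
direction `v`. The conclusion is what the adjoint needs: a test field moved by such `s` stays
supported in `Ω`. -/
lemma HasLipschitzBoundary.exists_inward_translation (hΩ : HasLipschitzBoundary Ω)
    {x : EuclideanSpace ℝ (Fin n)} (hx : x ∈ closure (Ω : Set (EuclideanSpace ℝ (Fin n)))) :
    ∃ U : Set (EuclideanSpace ℝ (Fin n)), IsOpen U ∧ x ∈ U ∧ Bornology.IsBounded U ∧
      ∀ r > 0, ∃ p : EuclideanSpace ℝ (Fin n), ∃ δ > 0, ‖p‖ + δ < r ∧
        ∀ y ∈ U, ∀ s ∈ Metric.closedBall p δ, y + s ∈ Ω → y ∈ Ω := by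
  by_cases hxΩ : x ∈ Ω
  · obtain ⟨ρ, hρ, hρΩ⟩ := Metric.isOpen_iff.1 Ω.isOpen x hxΩ
    refine ⟨Metric.ball x ρ, Metric.isOpen_ball, Metric.mem_ball_self hρ, Metric.isBounded_ball,
      fun r hr => ⟨0, r / 2, half_pos hr, by simpa using hr, fun y hy _ _ _ => hρΩ hy⟩⟩
  · have hfr : x ∈ frontier (Ω : Set (EuclideanSpace ℝ (Fin n))) := by
      rw [Ω.isOpen.frontier_eq]
      exact ⟨hx, hxΩ⟩
    obtain ⟨v, g, K, hv, hg, hgv, hloc⟩ := hΩ x hfr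
    obtain ⟨ρ, hρ, hρW⟩ := Metric.eventually_nhds_iff_ball.1 hloc
    refine ⟨Metric.ball x (ρ / 2), Metric.isOpen_ball, Metric.mem_ball_self (half_pos hρ),
      Metric.isBounded_ball, fun r hr => ?_⟩
    set t := min r (ρ / 2) / 2 with ht
    have hm : 0 < min r (ρ / 2) := lt_min hr (half_pos hρ)
    have ht0 : 0 < t := half_pos hm
    have htr : 2 * t ≤ r := by rw [ht]; linarith [min_le_left r (ρ / 2)]
    have htρ : 2 * t ≤ ρ / 2 := by rw [ht]; linarith [min_le_right r (ρ / 2)]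
    have hK : (0 : ℝ) ≤ K := K.2
    have hK2 : 0 < 2 * (1 + (K : ℝ)) := by linarith
    have hδ : t / (2 * (1 + K)) * (2 * (1 + K)) = t := div_mul_cancel₀ _ hK2.ne'
    -- An error `z` in the shift costs at most `(1 + K)‖z‖` in height relative to the graph. With
    -- this radius that is at most `t/2`, less than the height `t` gained.
    set δ := t / (2 * (1 + (K : ℝ))) with hδd
    have hδ0 : 0 < δ := div_pos ht0 hK2
    have hδt : δ < t := by nlinarith
    have hp : ‖-(t • v)‖ = t := by rw [norm_neg, norm_smul, hv, Real.norm_of_nonneg ht0.le, mul_one]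
    refine ⟨-(t • v), δ, hδ0, by rw [hp]; linarith, fun y hy s hs hys => ?_⟩
    rw [Metric.mem_ball, dist_eq_norm] at hy
    rw [Metric.mem_closedBall, dist_eq_norm] at hs
    set z := s - -(t • v) with hz
    have hs' : s = z + (-t) • v := by rw [hz, neg_smul]; abel
    have hsn : ‖s‖ ≤ δ + t := by
      have := norm_add_le z (-(t • v))
      rw [hp] at this
      rw [hs', neg_smul]
      linarith
    have h1 : y + s ∈ Metric.ball x ρ := by
      rw [Metric.mem_ball, dist_eq_norm, add_sub_right_comm]
      have := norm_add_le (y - x) s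
      linarith
    have h2 : y ∈ Metric.ball x ρ := by
      rw [Metric.mem_ball, dist_eq_norm]
      linarith
    refine (hρW y h2).2 ?_
    have h3 := (hρW _ h1).1 hys
    rw [hs', ← add_assoc, hgv, inner_add_right, inner_add_right, inner_smul_right,
      real_inner_self_eq_norm_sq, hv] at h3
    have h4 : g y ≤ g (y + z) + K * ‖z‖ := by
      have := hg.dist_le_mul y (y + z)
      rw [Real.dist_eq, dist_eq_norm, sub_add_cancel_left, norm_neg] at this
      linarith [le_abs_self (g y - g (y + z))]
    have h5 : inner ℝ v z ≤ ‖z‖ := by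
      have := real_inner_le_norm v z
      rwa [hv, one_mul] at this
    nlinarith

lemma abs_integral_inner_testFunction_le (hΩ : volume (Ω : Set (EuclideanSpace ℝ (Fin n))) ≠ ∞)
    {h : EuclideanSpace ℝ (Fin n) → EuclideanSpace ℝ (Fin n)}
    (hm : AEStronglyMeasurable h volume) {η : ℝ} (hη : 0 ≤ η)
    (hh : eLpNorm h 2 ≤ ENNReal.ofReal η)
    (Φ : TestFunction Ω (EuclideanSpace ℝ (Fin n)) ⊤) (hΦ : ∀ x, ‖Φ x‖ ≤ 1) :
    |∫ x, inner ℝ (h x) (Φ x)| ≤ η * √(volume.real (Ω : Set (EuclideanSpace ℝ (Fin n)))) := by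
  have h0 : ∀ x, x ∉ (Ω : Set (EuclideanSpace ℝ (Fin n))) → inner ℝ (h x) (Φ x) = 0 :=
    fun x hx => by
      rw [image_eq_zero_of_notMem_tsupport fun hx' => hx (Φ.tsupport_subset hx'), inner_zero_right]
  rw [← setIntegral_eq_integral_of_forall_compl_eq_zero h0, ← Real.norm_eq_abs,
    ← ENNReal.ofReal_le_ofReal_iff (by positivity), ofReal_norm]
  have h1 : ‖∫ x in Ω, inner ℝ (h x) (Φ x)‖ₑ ≤ eLpNorm h 1 (volume.restrict Ω) := by
    refine (enorm_integral_le_lintegral_enorm _).trans ?_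
    rw [eLpNorm_one_eq_lintegral_enorm]
    refine lintegral_mono fun x => ?_
    rw [← ofReal_norm, ← ofReal_norm]
    refine ENNReal.ofReal_le_ofReal ((norm_inner_le_norm _ _).trans ?_)
    exact mul_le_of_le_one_right (norm_nonneg _) (hΦ x)
  refine h1.trans ((eLpNorm_le_eLpNorm_mul_rpow_measure_univ one_le_two hm.restrict).trans ?_)
  rw [ENNReal.ofReal_mul hη]
  refine mul_le_mul' ((eLpNorm_restrict_le _ _ _ _).trans hh) (le_of_eq ?_)
  rw [Measure.restrict_apply_univ, Real.sqrt_eq_rpow, measureReal_def,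
    ← ENNReal.ofReal_rpow_of_nonneg ENNReal.toReal_nonneg (by norm_num), ENNReal.ofReal_toReal hΩ]
  norm_num

variable {ι : Type*} [Fintype ι] {ψ κ : ι → EuclideanSpace ℝ (Fin n) → ℝ}

/-- Mollifying the pieces of a partition of unity in directions that point into `Ω` increases the
pairing with divergences only by commutator terms. -/
lemma integral_sum_convolution_mul_divergence_le
    (hψ : ∀ i, ContDiff ℝ (⊤ : ℕ∞) (ψ i)) (hψc : ∀ i, HasCompactSupport (ψ i))
    (hψ0 : ∀ i x, 0 ≤ ψ i x) (hψ1 : ∀ x ∈ Ω, ∑ i, ψ i x = 1)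
    (hκ : ∀ i, Continuous (κ i)) (hκc : ∀ i, HasCompactSupport (κ i))
    (hκ0 : ∀ i s, 0 ≤ κ i s) (hκ1 : ∀ i, ∫ s, κ i s = 1)
    (hin : ∀ i, ∀ y ∈ tsupport (ψ i), ∀ s ∈ tsupport (κ i), y + s ∈ Ω → y ∈ Ω)
    {f : EuclideanSpace ℝ (Fin n) → ℝ} (hf : f ∈ BV Ω)
    (Φ : TestFunction Ω (EuclideanSpace ℝ (Fin n)) ⊤) (hΦ : ∀ x, ‖Φ x‖ ≤ 1) :
    ∫ x in Ω, (∑ i, (κ i ⋆[ContinuousLinearMap.lsmul ℝ ℝ] fun y =>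
      ψ i y * (Ω : Set (EuclideanSpace ℝ (Fin n))).indicator f y) x) * divergence Φ x ≤
    (TV Ω f).toReal + ∑ i, |∫ x, inner ℝ ((κ i ⋆[ContinuousLinearMap.lsmul ℝ ℝ] fun y =>
      (Ω : Set (EuclideanSpace ℝ (Fin n))).indicator f y • gradient (ψ i) y) x -
      (Ω : Set (EuclideanSpace ℝ (Fin n))).indicator f x • gradient (ψ i) x) (Φ x)| := by
  set F := (Ω : Set (EuclideanSpace ℝ (Fin n))).indicator f with hFd
  have hF : Integrable F := hf.1.integrable_indicator Ω.isOpen.measurableSet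
  have hκi : ∀ i, Integrable (κ i) := fun i => (hκ i).integrable_of_hasCompactSupport (hκc i)
  have hψF : ∀ i, Integrable fun y => ψ i y * F y := fun i => by
    obtain ⟨C, hC⟩ := (hψ i).continuous.bounded_above_of_compact_support (hψc i)
    exact hF.bdd_mul (c := C) (hψ i).continuous.aestronglyMeasurable (.of_forall hC)
  have hG : ∀ i, Integrable fun y => F y • gradient (ψ i) y := fun i => by
    obtain ⟨C, hC⟩ := (continuous_gradient (hψ i)).bounded_above_of_compact_support
      (hasCompactSupport_gradient (hψc i))
    exact hF.smul_bdd C (continuous_gradient (hψ i)).aestronglyMeasurable (.of_forall hC)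
  have hdc : Continuous (divergence Φ) := continuous_divergence Φ.contDiff
  have hdcs : HasCompactSupport (divergence Φ) := hasCompactSupport_divergence Φ.hasCompactSupport
  set Θ : ι → TestFunction Ω (EuclideanSpace ℝ (Fin n)) ⊤ := fun i =>
    smoothedField (hψ i) (hκ i) (hκc i) (hin i) Φ with hΘ
  have hΦκ : ∀ i y, ‖((fun s => κ i (-s)) ⋆[ContinuousLinearMap.lsmul ℝ ℝ] Φ) y‖ ≤ 1 :=
    fun i y => norm_convolution_reflect_le (hκ0 i) (hκi i) (hκ1 i) hΦ y
  -- Move the convolution onto `div Φ`, then apply the product rule to `ψ i` times the mollified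
  -- field; the gradient term is the price of the cutoff.
  have hterm : ∀ i, ∫ x, (κ i ⋆[ContinuousLinearMap.lsmul ℝ ℝ] fun y => ψ i y * F y) x *
      divergence Φ x = (∫ x in Ω, f x * divergence (Θ i) x) -
      ∫ x, inner ℝ ((κ i ⋆[ContinuousLinearMap.lsmul ℝ ℝ] fun y => F y • gradient (ψ i) y) x)
        (Φ x) := fun i => by
    have h1 := integral_inner_convolution (hκ i) (hκc i) (hψF i) hdc hdcs
    have h2 := integral_inner_convolution (hκ i) (hκc i) (hG i) Φ.continuous Φ.hasCompactSupport
    simp only [RCLike.inner_apply, conj_trivial] at h1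
    simp only [mul_comm _ (divergence Φ _), h1, h2]
    have h3 : ∫ x in Ω, f x * divergence (Θ i) x = ∫ x, F x * divergence (Θ i) x := by
      rw [← integral_indicator Ω.isOpen.measurableSet]
      refine integral_congr_ae (.of_forall fun x => ?_)
      simp only [hFd, Set.indicator_mul_left]
    rw [h3, ← integral_sub (integrable_mul_divergence hF _)]
    · refine integral_congr_ae (.of_forall fun x => ?_)
      simp only [hΘ, divergence_smoothedField, real_inner_smul_left]
      ring
    · have := integrable_inner_of_bdd (Φ := (fun s => κ i (-s)) ⋆[ContinuousLinearMap.lsmul ℝ ℝ] Φ)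
        (contDiff_convolution_reflect (hκ i) Φ.contDiff
          Φ.hasCompactSupport).continuous.aestronglyMeasurable (hΦκ i) (hG i)
      simpa only [real_inner_comm] using this
  -- The cutoffs sum to `1` on `Ω`, so their gradients cancel there. Subtracting this zero turns the
  -- gradient terms into differences between a function and its mollification.
  have hzero : ∑ i, ∫ x, inner ℝ (F x • gradient (ψ i) x) (Φ x) = 0 := by
    rw [← integral_finsetSum]
    · refine integral_eq_zero_of_ae (.of_forall fun x => ?_)
      simp only [Pi.zero_apply, ← sum_inner, ← Finset.smul_sum]
      by_cases hx : x ∈ (Ω : Set (EuclideanSpace ℝ (Fin n)))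
      · have h1 : ∑ i, gradient (ψ i) x = gradient (fun y => ∑ i, ψ i y) x := by
          simp only [gradient]
          rw [fderiv_fun_sum fun i _ => (hψ i).differentiable (by simp) x, map_sum]
        have h2 : (fun y => ∑ i, ψ i y) =ᶠ[𝓝 x] fun _ => 1 := by
          filter_upwards [Ω.isOpen.mem_nhds hx] with y hy using hψ1 y hy
        rw [h1, gradient, h2.fderiv_eq]
        simp
      · simp [hFd, hx]
    · intro i _
      simpa only [real_inner_comm] using TestFunction.integrable_inner Φ (hG i)
  -- The sum of the fields `Θ i` is pointwise a convex combination of vectors of norm at most `1`,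
  -- so it is a single admissible field for `TV f`.
  have hpair : ∑ i, ∫ x in Ω, f x * divergence (Θ i) x ≤ (TV Ω f).toReal := by
    have h1 : ∑ i, ∫ x in Ω, f x * divergence (Θ i) x =
        ∫ x in Ω, f x * divergence (∑ i, Θ i : TestFunction Ω _ ⊤) x :=
      (map_sum (divPairing hf.1) Θ Finset.univ).symm
    rw [h1]
    refine divPairing_le_TV hf _ fun x => ?_
    rw [TestFunction.sum_apply]
    by_cases hx : x ∈ (Ω : Set (EuclideanSpace ℝ (Fin n)))
    · rw [← hψ1 x hx]
      refine norm_sum_le_of_le _ fun i _ => ?_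
      change ‖ψ i x • ((fun s => κ i (-s)) ⋆[ContinuousLinearMap.lsmul ℝ ℝ] Φ) x‖ ≤ _
      rw [norm_smul, Real.norm_of_nonneg (hψ0 i x)]
      exact mul_le_of_le_one_right (hψ0 i x) (hΦκ i x)
    · rw [Finset.sum_eq_zero fun i _ =>
        image_eq_zero_of_notMem_tsupport fun hx' => hx ((Θ i).tsupport_subset hx')]
      simp
  have h0 : ∀ x, x ∉ (Ω : Set (EuclideanSpace ℝ (Fin n))) →
      (∑ i, (κ i ⋆[ContinuousLinearMap.lsmul ℝ ℝ] fun y => ψ i y * F y) x) * divergence Φ x = 0 :=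
    fun x hx => by
      rw [Function.notMem_support.1 fun hx' => hx (Φ.tsupport_subset
        (support_divergence_subset Φ hx')), mul_zero]
  have hci : ∀ i, Integrable fun x => inner ℝ
      ((κ i ⋆[ContinuousLinearMap.lsmul ℝ ℝ] fun y => F y • gradient (ψ i) y) x) (Φ x) := by
    intro i
    simpa only [real_inner_comm] using TestFunction.integrable_inner Φ
      ((hκi i).integrable_convolution (ContinuousLinearMap.lsmul ℝ ℝ) (hG i))
  have hGi : ∀ i, Integrable fun x => inner ℝ (F x • gradient (ψ i) x) (Φ x) := by
    intro i
    simpa only [real_inner_comm] using TestFunction.integrable_inner Φ (hG i)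
  rw [setIntegral_eq_integral_of_forall_compl_eq_zero h0]
  simp only [Finset.sum_mul]
  rw [integral_finsetSum]
  · simp only [hterm, inner_sub_left]
    rw [Finset.sum_sub_distrib]
    have h1 : ∑ i, |∫ x, (inner ℝ ((κ i ⋆[ContinuousLinearMap.lsmul ℝ ℝ] fun y =>
        F y • gradient (ψ i) y) x) (Φ x) - inner ℝ (F x • gradient (ψ i) x) (Φ x))| ≥
        ∑ i, -((∫ x, inner ℝ ((κ i ⋆[ContinuousLinearMap.lsmul ℝ ℝ] fun y =>
        F y • gradient (ψ i) y) x) (Φ x)) - ∫ x, inner ℝ (F x • gradient (ψ i) x) (Φ x)) :=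
      Finset.sum_le_sum fun i _ => by
        rw [← integral_sub (hci i) (hGi i)]
        exact neg_le_abs _
    rw [Finset.sum_neg_distrib, Finset.sum_sub_distrib, hzero] at h1
    linarith
  · intro i _
    obtain ⟨C, hC⟩ := hdc.bounded_above_of_compact_support hdcs
    exact ((hκi i).integrable_convolution (ContinuousLinearMap.lsmul ℝ ℝ) (hψF i)).mul_bdd
      (c := C) hdc.aestronglyMeasurable (.of_forall hC)

end LocalSmoothing

end TVDenoising


namespace TVDenoising

/-! ### Strict approximation by functions smooth up to the boundary -/

section SmoothApproximation

open scoped Convolution Manifold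

variable {n : ℕ} {Ω : Opens (EuclideanSpace ℝ (Fin n))}

lemma gradNormSq_lt_top_of_contDiff
    (hΩ : volume (Ω : Set (EuclideanSpace ℝ (Fin n))) ≠ ∞) {w : EuclideanSpace ℝ (Fin n) → ℝ}
    (hw : ContDiff ℝ (⊤ : ℕ∞) w) (hwc : HasCompactSupport w) : gradNormSq Ω w < ∞ := by
  have : IsFiniteMeasure (volume.restrict (Ω : Set (EuclideanSpace ℝ (Fin n)))) :=
    ⟨by simpa using hΩ.lt_top⟩
  have hg : MemLp (gradient w) 2 (volume.restrict (Ω : Set (EuclideanSpace ℝ (Fin n)))) :=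
    (continuous_gradient hw).memLp_of_hasCompactSupport (hasCompactSupport_gradient hwc)
  have hwi : Integrable w := hw.continuous.integrable_of_hasCompactSupport hwc
  refine (gradNormSq_le hwi.integrableOn hg fun Φ => ?_).trans_lt
    (ENNReal.pow_lt_top hg.eLpNorm_lt_top)
  have hd := Φ.contDiff.continuous_fderiv (by simp)
  have hdw := hw.continuous_fderiv (by simp)
  have h0 : ∀ x, x ∉ (Ω : Set (EuclideanSpace ℝ (Fin n))) → w x * divergence Φ x = 0 :=
    fun x hx => by
      rw [Function.notMem_support.1 fun hx' => hx (Φ.tsupport_subset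
        (support_divergence_subset Φ hx')), mul_zero]
  have h0' : ∀ x, x ∉ (Ω : Set (EuclideanSpace ℝ (Fin n))) → inner ℝ (Φ x) (gradient w x) = 0 :=
    fun x hx => by
      rw [image_eq_zero_of_notMem_tsupport fun hx' => hx (Φ.tsupport_subset hx'), inner_zero_left]
  rw [setIntegral_eq_integral_of_forall_compl_eq_zero h0,
    setIntegral_eq_integral_of_forall_compl_eq_zero h0']
  have hi1 : ∀ i : Fin n, Integrable fun x =>
      w x • fderiv ℝ Φ x (EuclideanSpace.single i 1) := fun i =>
    (hw.continuous.smul (hd.clm_apply continuous_const)).integrable_of_hasCompactSupport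
      hwc.smul_right
  have hi2 : ∀ i : Fin n, Integrable fun x =>
      fderiv ℝ w x (EuclideanSpace.single i 1) • Φ x := fun i =>
    ((hdw.clm_apply continuous_const).smul Φ.continuous).integrable_of_hasCompactSupport
      Φ.hasCompactSupport.smul_left
  have hi3 : Integrable fun x => w x • Φ x :=
    (hw.continuous.smul Φ.continuous).integrable_of_hasCompactSupport hwc.smul_right
  have hpart : ∀ i : Fin n, ∫ x, w x * fderiv ℝ Φ x (EuclideanSpace.single i 1) i =
      - ∫ x, fderiv ℝ w x (EuclideanSpace.single i 1) * Φ x i := fun i => by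
    have h1 := congrArg (fun z : EuclideanSpace ℝ (Fin n) => z i)
      (integral_smul_fderiv_eq_neg_fderiv_smul_of_integrable (hi2 i) (hi1 i) hi3
        (fun x _ => hw.differentiable (by simp) x) fun x _ => TestFunction.differentiable Φ x)
    simp only [PiLp.neg_apply, integral_apply (hi1 i), integral_apply (hi2 i)] at h1
    simpa using h1
  simp only [divergence, Finset.mul_sum, PiLp.inner_apply, RCLike.inner_apply, conj_trivial,
    gradient_apply]
  rw [integral_finsetSum, integral_finsetSum, ← Finset.sum_neg_distrib]
  · exact Finset.sum_congr rfl fun i _ => hpart i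
  · intro i _
    simpa using (EuclideanSpace.proj i : EuclideanSpace ℝ (Fin n) →L[ℝ] ℝ).integrable_comp (hi2 i)
  · intro i _
    simpa using (EuclideanSpace.proj i : EuclideanSpace ℝ (Fin n) →L[ℝ] ℝ).integrable_comp (hi1 i)

/-- A finite smooth partition of unity on the closure of a bounded Lipschitz set whose members are
supported in sets that have arbitrarily short inward translations. -/
lemma HasLipschitzBoundary.exists_partition (hΩ : HasLipschitzBoundary Ω)
    (hb : Bornology.IsBounded (Ω : Set (EuclideanSpace ℝ (Fin n)))) :
    ∃ (ι : Type) (_ : Fintype ι) (ψ : ι → EuclideanSpace ℝ (Fin n) → ℝ),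
      (∀ i, ContDiff ℝ (⊤ : ℕ∞) (ψ i)) ∧ (∀ i, HasCompactSupport (ψ i)) ∧ (∀ i x, 0 ≤ ψ i x) ∧
      (∀ x ∈ Ω, ∑ i, ψ i x = 1) ∧
      ∀ i, ∀ r > 0, ∃ p : EuclideanSpace ℝ (Fin n), ∃ δ > 0, ‖p‖ + δ < r ∧
        ∀ y ∈ tsupport (ψ i), ∀ s ∈ Metric.closedBall p δ, y + s ∈ Ω → y ∈ Ω := by
  have hc : IsCompact (closure (Ω : Set (EuclideanSpace ℝ (Fin n)))) := hb.isCompact_closure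
  choose! U hUo hxU hUb hU using fun x => hΩ.exists_inward_translation (x := x)
  obtain ⟨T, hT, hcov⟩ := hc.elim_nhds_subcover U fun x hx => (hUo x hx).mem_nhds (hxU x hx)
  obtain ⟨e⟩ : Nonempty (Fin T.card ≃ T) := ⟨T.equivFin.symm⟩
  have hmem : ∀ i, (e i : EuclideanSpace ℝ (Fin n)) ∈
      closure (Ω : Set (EuclideanSpace ℝ (Fin n))) := fun i => hT _ (e i).2
  obtain ⟨ψ, hψ⟩ := SmoothPartitionOfUnity.exists_isSubordinate 𝓘(ℝ, EuclideanSpace ℝ (Fin n))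
    isClosed_closure (fun i => U (e i)) (fun i => hUo _ (hmem i)) fun x hx => by
      obtain ⟨z, hz, hxz⟩ := Set.mem_iUnion₂.1 (hcov hx)
      exact Set.mem_iUnion.2 ⟨e.symm ⟨z, hz⟩, by simpa using hxz⟩
  refine ⟨Fin T.card, inferInstance, fun i => ψ i, fun i => (ψ i).contMDiff.contDiff,
    fun i => ?_, fun i x => ψ.nonneg i x, fun x hx => ?_, fun i r hr => ?_⟩
  · exact Metric.isCompact_of_isClosed_isBounded (isClosed_tsupport _) ((hUb _ (hmem i)).subset (hψ i))
  · rw [← finsum_eq_sum_of_fintype]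
    exact ψ.sum_eq_one (subset_closure hx)
  · obtain ⟨p, δ, hδ, hpδ, h⟩ := hU _ (hmem i) r hr
    exact ⟨p, δ, hδ, hpδ, fun y hy => h y (hψ i hy)⟩

/-- Strict approximation in `BV` by functions that are smooth up to the boundary. -/
lemma exists_smooth_strict_approximation (hΩ : HasLipschitzBoundary Ω)
    (hb : Bornology.IsBounded (Ω : Set (EuclideanSpace ℝ (Fin n))))
    {f : EuclideanSpace ℝ (Fin n) → ℝ} (hf : f ∈ BV Ω)
    (hf2 : MemLp f 2 (volume.restrict Ω)) {ε : ℝ} (hε : 0 < ε) :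
    ∃ w : EuclideanSpace ℝ (Fin n) → ℝ, w ∈ BV Ω ∧ MemLp w 2 (volume.restrict Ω) ∧
      gradNormSq Ω w < ∞ ∧ TV Ω w ≤ ENNReal.ofReal ((TV Ω f).toReal + ε) ∧
      eLpNorm (fun x => w x - f x) 2 (volume.restrict Ω) ≤ ENNReal.ofReal ε := by
  have hvol : volume (Ω : Set (EuclideanSpace ℝ (Fin n))) ≠ ∞ := hb.measure_lt_top.ne
  obtain ⟨ι, _, ψ, hψ, hψc, hψ0, hψ1, hin⟩ := hΩ.exists_partition hb
  set F := (Ω : Set (EuclideanSpace ℝ (Fin n))).indicator f with hFd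
  have hF : MemLp F 2 := (memLp_indicator_iff_restrict Ω.isOpen.measurableSet).2 hf2
  have hψF : ∀ i, MemLp (fun y => ψ i y * F y) 2 := fun i => by
    obtain ⟨C, hC⟩ := (hψ i).continuous.bounded_above_of_compact_support (hψc i)
    exact hF.mul (memLp_top_of_bound (hψ i).continuous.aestronglyMeasurable C (.of_forall hC))
  have hG : ∀ i, MemLp (fun y => F y • gradient (ψ i) y) 2 := fun i => by
    obtain ⟨C, hC⟩ := (continuous_gradient (hψ i)).bounded_above_of_compact_support
      (hasCompactSupport_gradient (hψc i))
    exact MemLp.smul (memLp_top_of_bound (continuous_gradient (hψ i)).aestronglyMeasurable C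
      (.of_forall hC)) hF
  set N : ℝ := (Fintype.card ι : ℝ) with hN
  set b : ℝ := √(volume.real (Ω : Set (EuclideanSpace ℝ (Fin n)))) with hbd
  have hb0 : 0 ≤ b := Real.sqrt_nonneg _
  have hN0 : 0 ≤ N := Nat.cast_nonneg _
  -- One tolerance for `N` pieces and two purposes: the `L²` errors sum to `N η`, and the
  -- commutators, paired with fields on `Ω`, to `N η b` with `b = |Ω|^(1/2)`.
  set η : ℝ := ε / ((N + 1) * (1 + b)) with hηd
  have hη : 0 < η := by positivity
  have hNη : N * η ≤ ε := by
    rw [hηd, ← mul_div_assoc, div_le_iff₀ (by positivity)]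
    nlinarith [mul_nonneg hN0 hb0, mul_nonneg hε.le hb0, mul_nonneg hε.le (mul_nonneg hN0 hb0)]
  have hNηb : N * (η * b) ≤ ε := by
    rw [hηd, div_mul_eq_mul_div, ← mul_div_assoc, div_le_iff₀ (by positivity)]
    nlinarith [mul_nonneg hε.le hb0, mul_nonneg hε.le hN0]
  have hκex : ∀ i, ∃ κ : EuclideanSpace ℝ (Fin n) → ℝ, ContDiff ℝ (⊤ : ℕ∞) κ ∧
      HasCompactSupport κ ∧ (∀ s, 0 ≤ κ s) ∧ ∫ s, κ s = 1 ∧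
      (∀ y ∈ tsupport (ψ i), ∀ s ∈ tsupport κ, y + s ∈ Ω → y ∈ Ω) ∧
      eLpNorm (fun x => (κ ⋆[ContinuousLinearMap.lsmul ℝ ℝ] fun y => ψ i y * F y) x -
        ψ i x * F x) 2 ≤ ENNReal.ofReal η ∧
      eLpNorm (fun x => (κ ⋆[ContinuousLinearMap.lsmul ℝ ℝ] fun y => F y • gradient (ψ i) y) x -
        F x • gradient (ψ i) x) 2 ≤ ENNReal.ofReal η := fun i => by
    have hη' : 0 < ENNReal.ofReal η := ENNReal.ofReal_pos.2 hη
    obtain ⟨r, hr, hr'⟩ := Metric.eventually_nhds_iff_ball.1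
      (((tendsto_eLpNorm_translate_sub (hψF i)).eventually (gt_mem_nhds hη')).and
        ((tendsto_eLpNorm_translate_sub (hG i)).eventually (gt_mem_nhds hη')))
    obtain ⟨p, δ, hδ, hpδ, h⟩ := hin i r hr
    let B : ContDiffBump p := ⟨δ / 2, δ, half_pos hδ, half_lt_self hδ⟩
    have hB : ∀ s ∈ tsupport (B.normed volume), s ∈ Metric.closedBall p δ := fun s hs => by
      rwa [B.tsupport_normed_eq] at hs
    have hBr : ∀ s, B.normed volume s ≠ 0 → s ∈ Metric.ball 0 r := fun s hs => by
      have := Metric.mem_closedBall.1 (hB s (subset_tsupport _ hs))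
      rw [mem_ball_zero_iff]
      rw [dist_eq_norm] at this
      have := norm_add_le (s - p) p
      rw [sub_add_cancel] at this
      linarith
    have hc : Continuous (B.normed volume) := B.contDiff_normed (n := 0).continuous
    refine ⟨B.normed volume, B.contDiff_normed, B.hasCompactSupport_normed,
      fun s => B.nonneg_normed s, B.integral_normed, fun y hy s hs => h y hy s (hB s hs), ?_, ?_⟩
    · exact eLpNorm_convolution_sub_le hc B.hasCompactSupport_normed (fun s => B.nonneg_normed s)
        B.integral_normed (hψF i) fun s hs => (hr' s (hBr s hs)).1.le
    · exact eLpNorm_convolution_sub_le hc B.hasCompactSupport_normed (fun s => B.nonneg_normed s)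
        B.integral_normed (hG i) fun s hs => (hr' s (hBr s hs)).2.le
  choose κ hκ hκc hκ0 hκ1 hκin hκF hκG using hκex
  have hψFc : ∀ i, HasCompactSupport fun y => ψ i y * F y := fun i => (hψc i).mul_right
  have hsm : ∀ i, ContDiff ℝ (⊤ : ℕ∞)
      (κ i ⋆[ContinuousLinearMap.lsmul ℝ ℝ] fun y => ψ i y * F y) := fun i =>
    (hκc i).contDiff_convolution_left (n := ⊤) (ContinuousLinearMap.lsmul ℝ ℝ) (hκ i)
      ((hψF i).locallyIntegrable one_le_two)
  have hcs : ∀ i, HasCompactSupport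
      (κ i ⋆[ContinuousLinearMap.lsmul ℝ ℝ] fun y => ψ i y * F y) := fun i =>
    (hκc i).convolution (ContinuousLinearMap.lsmul ℝ ℝ) (hψFc i)
  have hw : ContDiff ℝ (⊤ : ℕ∞) fun x =>
      ∑ i, (κ i ⋆[ContinuousLinearMap.lsmul ℝ ℝ] fun y => ψ i y * F y) x :=
    ContDiff.sum fun i _ => hsm i
  have hwc : HasCompactSupport fun x =>
      ∑ i, (κ i ⋆[ContinuousLinearMap.lsmul ℝ ℝ] fun y => ψ i y * F y) x := by
    have : ∀ T : Finset ι, HasCompactSupport fun x =>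
        ∑ i ∈ T, (κ i ⋆[ContinuousLinearMap.lsmul ℝ ℝ] fun y => ψ i y * F y) x := fun T => by
      induction T using Finset.cons_induction with
      | empty => simpa using! HasCompactSupport.zero
      | cons a T ha ih =>
        simp only [Finset.sum_cons]
        exact (hcs a).add ih
    exact this Finset.univ
  have hBV := mem_BV_of_divPairing_le (Ω := Ω)
    (hw.continuous.integrable_of_hasCompactSupport hwc).integrableOn
    (M := (TV Ω f).toReal + ε) (by positivity) fun Φ hΦ => by
      refine (integral_sum_convolution_mul_divergence_le hψ hψc hψ0 hψ1
        (fun i => (hκ i).continuous) hκc hκ0 hκ1 hκin hf Φ hΦ).trans ?_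
      gcongr
      refine (Finset.sum_le_card_nsmul _ _ (η * b) fun i _ => ?_).trans ?_
      · refine abs_integral_inner_testFunction_le hvol ?_ hη.le (hκG i) Φ hΦ
        exact ((hκc i).contDiff_convolution_left (n := ⊤) (ContinuousLinearMap.lsmul ℝ ℝ) (hκ i)
          ((hG i).locallyIntegrable one_le_two)).continuous.aestronglyMeasurable.sub
          (hG i).aestronglyMeasurable
      · rw [nsmul_eq_mul, Finset.card_univ]
        exact hNηb
  refine ⟨_, hBV.1, (hw.continuous.memLp_of_hasCompactSupport hwc),
    gradNormSq_lt_top_of_contDiff hvol hw hwc, hBV.2, ?_⟩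
  have h1 : eLpNorm (fun x => (∑ i, (κ i ⋆[ContinuousLinearMap.lsmul ℝ ℝ] fun y =>
      ψ i y * F y) x) - f x) 2 (volume.restrict (Ω : Set (EuclideanSpace ℝ (Fin n)))) =
      eLpNorm (∑ i, fun x => (κ i ⋆[ContinuousLinearMap.lsmul ℝ ℝ] fun y =>
      ψ i y * F y) x - ψ i x * F x) 2
        (volume.restrict (Ω : Set (EuclideanSpace ℝ (Fin n)))) := by
    refine eLpNorm_congr_ae ((ae_restrict_iff' Ω.isOpen.measurableSet).2 (.of_forall fun x hx => ?_))
    rw [Finset.sum_apply, Finset.sum_sub_distrib, ← Finset.sum_mul, hψ1 x hx, one_mul, hFd,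
      Set.indicator_of_mem hx]
  rw [h1]
  refine (eLpNorm_restrict_le _ _ _ _).trans ((eLpNorm_sum_le (fun i _ =>
    (hsm i).continuous.aestronglyMeasurable.sub (hψF i).aestronglyMeasurable) one_le_two).trans ?_)
  refine (Finset.sum_le_card_nsmul _ _ (ENNReal.ofReal η) fun i _ => hκF i).trans ?_
  rw [nsmul_eq_mul, Finset.card_univ, ← ENNReal.ofReal_natCast, ← ENNReal.ofReal_mul hN0]
  exact ENNReal.ofReal_le_ofReal hNη

end SmoothApproximation

end TVDenoising


namespace TVDenoising

/-! ### Comparison of energies and positivity of the optimal parameter -/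

section Positivity

variable {n : ℕ} {Ω : Opens (EuclideanSpace ℝ (Fin n))}

lemma denoisingEnergy_le {f w : EuclideanSpace ℝ (Fin n) → ℝ}
    (hf : MemLp f 2 (volume.restrict (Ω : Set (EuclideanSpace ℝ (Fin n)))))
    (hw : MemLp w 2 (volume.restrict (Ω : Set (EuclideanSpace ℝ (Fin n)))))
    {γ : ℝ≥0∞} (hγ : γ ≠ 0) {μ β : ℝ≥0} {T c : ℝ} (hT : 0 ≤ T) (hc : 0 ≤ c)
    (hTV : TV Ω w ≤ ENNReal.ofReal T)
    (hG : (μ : ℝ≥0∞) / 2 * gradNormSq Ω w ≤ ENNReal.ofReal c) :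
    denoisingEnergy Ω f γ μ β w ≤
      ENNReal.ofReal (‖hf.toLp f - hw.toLp w‖ ^ 2 / 2 + β * T + c) := by
  rw [denoisingEnergy, halfSqDist_eq hf hw, ENNReal.ofReal_add (by positivity) hc,
    ENNReal.ofReal_add (by positivity) (by positivity), ENNReal.ofReal_mul β.coe_nonneg,
    ENNReal.ofReal_coe_nnreal]
  gcongr
  exact (huberMeasure_le_variation hγ _).trans hTV

lemma exists_mul_gradNormSq_le {w : EuclideanSpace ℝ (Fin n) → ℝ} (hw : gradNormSq Ω w < ∞)
    {c : ℝ} (hc : 0 < c) :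
    ∃ m : ℝ≥0, 0 < m ∧ ∀ μ ≤ m, (μ : ℝ≥0∞) / 2 * gradNormSq Ω w ≤ ENNReal.ofReal c := by
  obtain ⟨m, hm, h⟩ := ENNReal.exists_nnreal_pos_mul_lt hw.ne (ENNReal.ofReal_pos.2 hc).ne'
  refine ⟨m, hm, fun μ hμ => le_trans ?_ h.le⟩
  gcongr
  exact ENNReal.half_le_self.trans (by exact_mod_cast hμ)

lemma norm_toLp_sub_le {f w : EuclideanSpace ℝ (Fin n) → ℝ}
    (hf : MemLp f 2 (volume.restrict (Ω : Set (EuclideanSpace ℝ (Fin n)))))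
    (hw : MemLp w 2 (volume.restrict (Ω : Set (EuclideanSpace ℝ (Fin n)))))
    {ε : ℝ} (hε : 0 ≤ ε)
    (h : eLpNorm (fun x => w x - f x) 2 (volume.restrict Ω) ≤ ENNReal.ofReal ε) :
    ‖hf.toLp f - hw.toLp w‖ ≤ ε := by
  rw [norm_sub_rev, ← MemLp.toLp_sub hw hf, Lp.norm_toLp]
  exact ENNReal.toReal_le_of_le_ofReal hε h

lemma exists_testField_lt_of_TV_lt {f : EuclideanSpace ℝ (Fin n) → ℝ} (hf : f ∈ BV Ω) {T : ℝ}
    (hT : 0 ≤ T) (h : ENNReal.ofReal T < TV Ω f) :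
    ∃ Φ : TestFunction Ω (EuclideanSpace ℝ (Fin n)) ⊤, (∀ x, ‖Φ x‖ ≤ 1) ∧
      T < ∫ x in Ω, f x * divergence Φ x := by
  by_contra! hΦ
  exact h.not_ge (TV_le_of_divPairing_le hf hT hΦ)

lemma inner_toLp_divToLp {u : EuclideanSpace ℝ (Fin n) → ℝ}
    (hu : MemLp u 2 (volume.restrict (Ω : Set (EuclideanSpace ℝ (Fin n)))))
    (Φ : TestFunction Ω (EuclideanSpace ℝ (Fin n)) ⊤) :
    inner ℝ (hu.toLp u) (divToLp Ω Φ) = ∫ x in Ω, u x * divergence Φ x :=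
  inner_divToLp _ hu.coeFn_toLp Φ

/-- If the total variation of `u` is at least `T + δ`, then its Huber regularisation is at least
`T` for large `γ`. -/
lemma ofReal_le_huberMeasure {u : EuclideanSpace ℝ (Fin n) → ℝ} {γ : ℝ≥0∞} {c : ℝ≥0}
    (hc : 0 < c) (hγ : (c : ℝ≥0∞) ≤ γ) {T δ : ℝ} (hδ : 0 ≤ δ)
    (hvol : ENNReal.ofReal (1 / (2 * (c : ℝ))) * volume (Ω : Set (EuclideanSpace ℝ (Fin n))) ≤
      ENNReal.ofReal δ) (hT : ENNReal.ofReal (T + δ) ≤ TV Ω u) :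
    ENNReal.ofReal T ≤ huberMeasure γ (D Ω u) Ω := by
  have h := hT.trans ((variation_le_huberMeasure_add hc hγ (D Ω u)).trans
    (add_le_add_right hvol _))
  have h2 := tsub_le_iff_right.2 h
  rwa [← ENNReal.ofReal_sub _ hδ, add_sub_cancel_right] at h2

lemma halfSqDist_le_denoisingEnergy (f : EuclideanSpace ℝ (Fin n) → ℝ) (γ : ℝ≥0∞) (μ : ℝ≥0)
    (α : ℝ≥0∞) (u : EuclideanSpace ℝ (Fin n) → ℝ) :
    halfSqDist Ω f u ≤ denoisingEnergy Ω f γ μ α u := by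
  rw [denoisingEnergy, add_assoc]
  exact le_self_add

lemma norm_toLp_sub_le_of_halfSqDist_le {f u : EuclideanSpace ℝ (Fin n) → ℝ}
    (hf : MemLp f 2 (volume.restrict (Ω : Set (EuclideanSpace ℝ (Fin n)))))
    (hu : MemLp u 2 (volume.restrict (Ω : Set (EuclideanSpace ℝ (Fin n))))) {c η : ℝ}
    (h : halfSqDist Ω f u ≤ ENNReal.ofReal c) (hc : 0 ≤ c) (hη : 0 ≤ η) (hcη : c ≤ η ^ 2 / 2) :
    ‖hf.toLp f - hu.toLp u‖ ≤ η := by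
  rw [halfSqDist_eq hf hu, ENNReal.ofReal_le_ofReal_iff hc] at h
  exact (abs_le_of_sq_le_sq' (by linarith) hη).2

/-- Lower semicontinuity of the total variation with an explicit rate: the test field is fixed, and
its pairing is Lipschitz in `L²`. -/
lemma le_TV_of_norm_toLp_sub_le {f u : EuclideanSpace ℝ (Fin n) → ℝ}
    (hf : MemLp f 2 (volume.restrict (Ω : Set (EuclideanSpace ℝ (Fin n)))))
    (hu : MemLp u 2 (volume.restrict (Ω : Set (EuclideanSpace ℝ (Fin n))))) (huBV : u ∈ BV Ω)
    {Φ : TestFunction Ω (EuclideanSpace ℝ (Fin n)) ⊤} (hΦ : ∀ x, ‖Φ x‖ ≤ 1) {η : ℝ}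
    (h : ‖hf.toLp f - hu.toLp u‖ ≤ η) :
    inner ℝ (hf.toLp f) (divToLp Ω Φ) - η * ‖divToLp Ω Φ‖ ≤ (TV Ω u).toReal := by
  refine le_trans ?_ (divPairing_le_TV huBV Φ hΦ)
  rw [← inner_toLp_divToLp hu]
  have h1 := real_inner_le_norm (hf.toLp f - hu.toLp u) (divToLp Ω Φ)
  rw [inner_sub_left] at h1
  have := mul_le_mul_of_nonneg_right h (norm_nonneg (divToLp Ω Φ))
  linarith

/-- A minimiser whose regularised total variation exceeds that of a competitor `q` by `δ` is closer
to `q` than the data `f`. -/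
lemma half_sq_norm_toLp_sub_le {f u q : EuclideanSpace ℝ (Fin n) → ℝ}
    (hf : MemLp f 2 (volume.restrict (Ω : Set (EuclideanSpace ℝ (Fin n)))))
    (hu : MemLp u 2 (volume.restrict (Ω : Set (EuclideanSpace ℝ (Fin n)))))
    (hq : MemLp q 2 (volume.restrict (Ω : Set (EuclideanSpace ℝ (Fin n)))))
    {γ : ℝ≥0∞} (hγ : γ ≠ 0) {μ β : ℝ≥0} {T δ c : ℝ} (hT : 0 ≤ T) (hδ : 0 ≤ δ) (hc : 0 ≤ c)
    (hmin : denoisingEnergy Ω f γ μ β u + halfSqDist Ω u q ≤ denoisingEnergy Ω f γ μ β q)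
    (huR : ENNReal.ofReal (T + δ) ≤ huberMeasure γ (D Ω u) Ω) (hqT : TV Ω q ≤ ENNReal.ofReal T)
    (hG : (μ : ℝ≥0∞) / 2 * gradNormSq Ω q ≤ ENNReal.ofReal c) :
    ‖hu.toLp u - hq.toLp q‖ ^ 2 / 2 ≤ ‖hf.toLp f - hq.toLp q‖ ^ 2 / 2 + c - β * δ := by
  -- The fidelity and gradient terms of `u` are simply dropped.
  have h1 : ENNReal.ofReal (β * (T + δ) + ‖hu.toLp u - hq.toLp q‖ ^ 2 / 2) ≤
      denoisingEnergy Ω f γ μ β u + halfSqDist Ω u q := by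
    rw [halfSqDist_eq hu hq, ENNReal.ofReal_add (by positivity) (by positivity),
      ENNReal.ofReal_mul β.coe_nonneg, ENNReal.ofReal_coe_nnreal, denoisingEnergy]
    gcongr
    refine le_trans ?_ le_self_add
    refine le_trans ?_ le_add_self
    gcongr
  have h2 := (ENNReal.ofReal_le_ofReal_iff (by positivity)).1
    ((h1.trans hmin).trans (denoisingEnergy_le hf hq hγ hT hc hqT hG))
  linarith

set_option maxHeartbeats 400000 in
theorem exists_forall_isOptimalParameter_pos 
    (hΩb : Bornology.IsBounded (Ω : Set (EuclideanSpace ℝ (Fin n))))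
    (hΩL : HasLipschitzBoundary Ω) {f f₀ : EuclideanSpace ℝ (Fin n) → ℝ}
    (hf : f ∈ BV Ω) (hf2 : MemLp f 2 (volume.restrict Ω))
    (hf₀ : f₀ ∈ BV Ω) (hf₀2 : MemLp f₀ 2 (volume.restrict Ω)) (hTV : TV Ω f₀ < TV Ω f) :
    ∃ μbar γbar : ℝ≥0, 0 < μbar ∧ 0 < γbar ∧ ∀ μ : ℝ≥0, μ ≤ μbar →
      ∀ γ : ℝ≥0∞, (γbar : ℝ≥0∞) ≤ γ → ∀ α : ℝ≥0∞, IsOptimalParameter Ω f f₀ γ μ α → 0 < α := by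
  have hvol : volume (Ω : Set (EuclideanSpace ℝ (Fin n))) ≠ ∞ := hΩb.measure_lt_top.ne
  set T₀ := (TV Ω f₀).toReal with hT₀
  have hT₀0 : 0 ≤ T₀ := ENNReal.toReal_nonneg
  obtain ⟨Φ, hΦ, hΦf⟩ := exists_testField_lt_of_TV_lt hf hT₀0
    (by rwa [hT₀, ENNReal.ofReal_toReal (TV_lt_top hf₀).ne])
  -- The gap has four shares: one is lost as `u` differs from `f`, one to the Huber regularisation,
  -- one as `TV q` may exceed `T₀`, and one remains as profit.
  obtain ⟨δ, hδ, hδf⟩ : ∃ δ > 0, T₀ + 4 * δ = ∫ x in Ω, f x * divergence Φ x :=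
    ⟨((∫ x in Ω, f x * divergence Φ x) - T₀) / 4, by linarith, by ring⟩
  rw [← inner_toLp_divToLp hf2] at hδf
  have hΦf₀ := divPairing_le_TV hf₀ Φ hΦ
  rw [← inner_toLp_divToLp hf₀2, ← hT₀] at hΦf₀
  clear_value T₀
  set C := ‖divToLp Ω Φ‖ with hC
  have hC0 : 0 ≤ C := norm_nonneg _
  set A := ‖hf2.toLp f - hf₀2.toLp f₀‖ with hA
  have hA0 : 0 < A := by
    have h := real_inner_le_norm (hf2.toLp f - hf₀2.toLp f₀) (divToLp Ω Φ)
    rw [inner_sub_left, ← hδf, ← hA, ← hC] at h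
    by_contra! hA'
    nlinarith
  clear_value A C
  set η := δ / (C + 1) with hη
  have hη0 : 0 < η := by positivity
  have hCη : η * C ≤ δ := by
    rw [hη, div_mul_eq_mul_div, div_le_iff₀ (by positivity)]
    nlinarith
  clear_value η
  obtain ⟨p, hpBV, hp2, hpG, hpTV, hpf⟩ :=
    exists_smooth_strict_approximation hΩL hΩb hf hf2 (half_pos hη0)
  replace hpf := norm_toLp_sub_le hf2 hp2 (half_pos hη0).le hpf
  set Tp := (TV Ω f).toReal + η / 2 with hTp
  have hTp0 : 0 < Tp := by positivity
  clear_value Tp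
  have hηT : 0 < η ^ 2 / 8 / Tp := by positivity
  -- With this `β` the energy of `p` is at most `3η²/8` (fidelity, total variation and gradient at
  -- most `η²/8` each), which forces `‖f - u‖ ≤ η`. It is fixed before `μ` and `γ`.
  obtain ⟨β, hβ⟩ : ∃ β : ℝ≥0, (β : ℝ) = η ^ 2 / 8 / Tp := ⟨_, Real.coe_toNNReal _ hηT.le⟩
  have hβ0' : (0 : ℝ) < β := hβ ▸ hηT
  have hβ0 : 0 < β := hβ0'
  have hβp : (β : ℝ) * Tp = η ^ 2 / 8 := by rw [hβ, div_mul_cancel₀ _ hTp0.ne']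
  have hβδ : 0 < β * δ := mul_pos hβ0' hδ
  -- If `A² - βδ` were negative, the root would be `0`, still below `A`.
  set B := √(A ^ 2 - β * δ) with hB
  have hB0 : 0 ≤ B := Real.sqrt_nonneg _
  have hBA : B < A := by
    rw [hB, Real.sqrt_lt' hA0]
    linarith
  clear_value B
  obtain ⟨ρ, hρ0, hρ⟩ : ∃ ρ > 0, 3 * ρ = A - B := ⟨(A - B) / 3, by linarith, by ring⟩
  -- The last bound gives `(A + ε)² ≤ A² + βδ/2`. Together with `2 · βδ/4` from the gradient of `q`
  -- this uses half of the profit `2βδ`, leaving exactly `B²`.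
  obtain ⟨ε, hε0, hεδ, hερ, hε1, hεβ⟩ : ∃ ε > 0, ε ≤ δ ∧ ε ≤ ρ ∧ ε ≤ 1 ∧
      ε * (2 * A + 1) ≤ β * δ / 2 := by
    refine ⟨min (min δ ρ) (min 1 (β * δ / 2 / (2 * A + 1))), by positivity, ?_, ?_, ?_, ?_⟩
    · exact (min_le_left _ _).trans (min_le_left _ _)
    · exact (min_le_left _ _).trans (min_le_right _ _)
    · exact (min_le_right _ _).trans (min_le_left _ _)
    · rw [← le_div_iff₀ (by positivity)]
      exact (min_le_right _ _).trans (min_le_right _ _)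
  obtain ⟨q, hqBV, hq2, hqG, hqTV, hqf⟩ :=
    exists_smooth_strict_approximation hΩL hΩb hf₀ hf₀2 hε0
  rw [← hT₀] at hqTV
  replace hqf := norm_toLp_sub_le hf₀2 hq2 hε0.le hqf
  obtain ⟨r, hrBV, hr2, hrG, -, hrf⟩ :=
    exists_smooth_strict_approximation hΩL hΩb hf hf2 (half_pos hρ0)
  replace hrf := norm_toLp_sub_le hf2 hr2 (half_pos hρ0).le hrf
  obtain ⟨m₁, hm₁, hm₁'⟩ := exists_mul_gradNormSq_le hpG (show 0 < η ^ 2 / 8 by positivity)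
  obtain ⟨m₂, hm₂, hm₂'⟩ := exists_mul_gradNormSq_le hqG (show 0 < β * δ / 4 by positivity)
  obtain ⟨m₃, hm₃, hm₃'⟩ := exists_mul_gradNormSq_le hrG (show 0 < ρ ^ 2 / 8 by positivity)
  obtain ⟨c, hc, hcδ⟩ : ∃ c : ℝ≥0, 0 < c ∧ ENNReal.ofReal (1 / (2 * (c : ℝ))) *
      volume (Ω : Set (EuclideanSpace ℝ (Fin n))) ≤ ENNReal.ofReal δ := by
    obtain ⟨m, hm, h⟩ := ENNReal.exists_nnreal_pos_mul_lt hvol (ENNReal.ofReal_pos.2 hδ).ne'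
    refine ⟨(2 * m)⁻¹, by positivity, ?_⟩
    have h1 : 1 / (2 * (((2 * m)⁻¹ : ℝ≥0) : ℝ)) = m := by
      have : (m : ℝ) ≠ 0 := by exact_mod_cast hm.ne'
      push_cast
      field_simp
    rw [h1, ENNReal.ofReal_coe_nnreal]
    exact h.le
  refine ⟨min m₁ (min m₂ m₃), c, lt_min hm₁ (lt_min hm₂ hm₃), hc, fun μ hμ γ hγ α hα => ?_⟩
  by_contra! hα0
  obtain rfl : α = 0 := le_antisymm hα0 bot_le
  obtain ⟨v, ⟨hvBV, hvmin⟩, hvopt⟩ := hα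
  have hγ0 : γ ≠ 0 := ((ENNReal.coe_pos.2 hc).trans_le hγ).ne'
  obtain ⟨u, huBV, hu2, humin⟩ := exists_strong_denoised hvol hf2 hγ0 μ hβ0
  have huf : ‖hf2.toLp f - hu2.toLp u‖ ≤ η := by
    refine norm_toLp_sub_le_of_halfSqDist_le hf2 hu2 ((halfSqDist_le_denoisingEnergy ..).trans
      ((le_self_add.trans (humin p hpBV)).trans (denoisingEnergy_le hf2 hp2 hγ0 hTp0.le
      (by positivity) hpTV (hm₁' μ (hμ.trans (min_le_left _ _)))))) (by positivity) hη0.le ?_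
    have := pow_le_pow_left₀ (norm_nonneg _) hpf 2
    rw [hβp]
    linarith only [this, sq_nonneg η]
  have huTV : T₀ + δ + δ + δ ≤ (TV Ω u).toReal := by
    refine le_trans ?_ (le_TV_of_norm_toLp_sub_le hf2 hu2 huBV hΦ huf)
    rw [← hδf, ← hC]
    linarith only [hCη]
  have huR : ENNReal.ofReal (T₀ + δ + δ) ≤ huberMeasure γ (D Ω u) Ω :=
    ofReal_le_huberMeasure hc hγ hδ.le hcδ
      ((ENNReal.ofReal_le_iff_le_toReal (TV_lt_top huBV).ne).2 huTV)
  have huB : ‖hu2.toLp u - hq2.toLp q‖ ≤ B := by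
    have h2 := half_sq_norm_toLp_sub_le hf2 hu2 hq2 hγ0 (add_nonneg hT₀0 hδ.le) hδ.le
      (by positivity) (humin q hqBV) huR
      (hqTV.trans (ENNReal.ofReal_le_ofReal (by linarith only [hεδ])))
      (hm₂' μ (hμ.trans ((min_le_right _ _).trans (min_le_left _ _))))
    have h3 : ‖hf2.toLp f - hq2.toLp q‖ ≤ A + ε :=
      (norm_sub_le_norm_sub_add_norm_sub _ (hf₀2.toLp f₀) _).trans (add_le_add hA.ge hqf)
    have h4 := pow_le_pow_left₀ (norm_nonneg _) h3 2
    have h5 : (A + ε) ^ 2 ≤ A ^ 2 + β * δ / 2 := by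
      have : ε * ε ≤ ε * 1 := mul_le_mul_of_nonneg_left hε1 hε0.le
      linarith only [this, hεβ]
    rw [hB]
    refine Real.le_sqrt_of_sq_le ?_
    linarith only [h2, h4, h5]
  have huf₀ : ‖hf₀2.toLp f₀ - hu2.toLp u‖ ≤ B + ρ := by
    have h := norm_sub_le_norm_sub_add_norm_sub (hf₀2.toLp f₀) (hq2.toLp q) (hu2.toLp u)
    rw [norm_sub_rev (hq2.toLp q)] at h
    linarith only [h, hqf, huB, hερ]
  -- At parameter zero the total variation of the competitor `r` is irrelevant; its distance to `f`
  -- and the smallness of `μ` keep `v` within `ρ` of `f`.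
  have hr := denoisingEnergy_le (β := 0) hf2 hr2 hγ0 ENNReal.toReal_nonneg
    (div_nonneg (sq_nonneg ρ) (by norm_num)) (ENNReal.ofReal_toReal (TV_lt_top hrBV).ne).ge
    (hm₃' μ (hμ.trans ((min_le_right _ _).trans (min_le_right _ _))))
  rw [NNReal.coe_zero, zero_mul, add_zero, ENNReal.coe_zero] at hr
  have hvr := ((halfSqDist_le_denoisingEnergy ..).trans (hvmin r hrBV)).trans hr
  have hv2 := memLp_of_halfSqDist_lt_top hf2 hvBV.1 (hvr.trans_lt ENNReal.ofReal_lt_top)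
  have hvf : ‖hf2.toLp f - hv2.toLp v‖ ≤ ρ := by
    refine norm_toLp_sub_le_of_halfSqDist_le hf2 hv2 hvr (by positivity) hρ0.le ?_
    have := pow_le_pow_left₀ (norm_nonneg _) hrf 2
    linarith only [this, sq_nonneg ρ]
  have hopt := hvopt β u ⟨huBV, fun w hw => le_self_add.trans (humin w hw)⟩
  rw [halfSqDist_eq hf₀2 hv2, halfSqDist_eq hf₀2 hu2,
    ENNReal.ofReal_le_ofReal_iff (by positivity)] at hopt
  have h1 : ‖hf₀2.toLp f₀ - hv2.toLp v‖ ≤ ‖hf₀2.toLp f₀ - hu2.toLp u‖ :=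
    (abs_le_of_sq_le_sq' (by linarith only [hopt]) (norm_nonneg _)).2
  have h2 := norm_sub_le_norm_sub_add_norm_sub (hf2.toLp f) (hv2.toLp v) (hf₀2.toLp f₀)
  rw [norm_sub_rev (hv2.toLp v), ← hA] at h2
  -- The contradiction is `A ≤ ‖f - v‖ + ‖f₀ - v‖ ≤ ρ + (B + ρ) = A - ρ`.
  linarith only [h1, h2, huf₀, hvf, hρ, hρ0]

end Positivity

end TVDenoising

theorem theorem1 {n : ℕ} (Ω : Opens (EuclideanSpace ℝ (Fin n)))
    (hΩb : Bornology.IsBounded (Ω : Set (EuclideanSpace ℝ (Fin n))))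
    (hΩL : TVDenoising.HasLipschitzBoundary Ω)
    (f f₀ : EuclideanSpace ℝ (Fin n) → ℝ)
    (hf : f ∈ TVDenoising.BV Ω) (hf2 : MemLp f 2 (volume.restrict Ω))
    (hf₀ : f₀ ∈ TVDenoising.BV Ω) (hf₀2 : MemLp f₀ 2 (volume.restrict Ω))
    (hTV : TVDenoising.TV Ω f₀ < TVDenoising.TV Ω f) :
    ∃ μbar γbar : ℝ≥0, 0 < μbar ∧ 0 < γbar ∧
      ∀ μ : ℝ≥0, μ ≤ μbar → ∀ γ : ℝ≥0∞, (γbar : ℝ≥0∞) ≤ γ →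
        ∀ α : ℝ≥0∞, TVDenoising.IsOptimalParameter Ω f f₀ γ μ α → 0 < α := by
  exact TVDenoising.exists_forall_isOptimalParameter_pos hΩb hΩL hf hf2 hf₀ hf₀2 hTV
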